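/- **Setting.** Let $D$ be a finite set with $\#D\ge 2$, let $(V_j,\|\cdot\|_j)$, $j\in D$, be real Banach spaces, and for $\alpha\subset D$ let $\mathbf V_\alpha=\bigotimes_{j\in\alpha}V_j$ be the algebraic tensor product. Let $T_D$ be a dimension partition tree of $D$: its vertices are non-empty subsets of $D$, the root is $D$, the set $S(\alpha)$ of sons of a vertex $\alpha$ with $\#\alpha\ge2$ has at least two elements and is a partition of $\alpha$, and the vertices with $\#\alpha=1$ (the leaves) have no sons. For each vertex $\alpha$ let $\|\cdot\|_\alpha$ be a norm on $\mathbf V_\alpha$, with $\|\cdot\|_{\{j\}}=\|\cdot\|_j$, such that at every inner (non-leaf) vertex $\alpha$ the tensor product map $\times_{\beta\in S(\alpha)}(\mathbf V_\beta,\|\cdot\|_\beta)\to(\mathbf V_\alpha,\|\cdot\|_\alpha)$ is continuous. Let $\mathbf V_{D,\|\cdot\|_D}$ be the completion of $(\mathbf V_D,\|\cdot\|_D)$. For $\mathbf v\in\mathbf V_D$ let $U_\alpha^{\min}(\mathbf v)$ be the smallest subspace $U\subset\mathbf V_\alpha$ with $\mathbf v\in U\otimes\mathbf V_{D\setminus\alpha}$.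 Let $\mathfrak r=(r_\alpha)_{\alpha\in T_D}$ be a tuple of natural numbers with $r_D=1$, and let $$\mathcal{FT}_{\mathfrak r}(\mathbf V_D)=\{\mathbf v\in\mathbf V_D:\dim U_\alpha^{\min}(\mathbf v)=r_\alpha\text{ for all }\alpha\in T_D\}.$$ For vectors $u^{(k)}_i\in V_k$ ($k\in D$, $1\le i\le r_k$) and coefficients $C=(C^{(\gamma)})_\gamma$, $C^{(\gamma)}\in\mathbb R^{r_\gamma\times\prod_{\beta\in S(\gamma)}r_\beta}$, $\gamma$ inner, put recursively $$\mathbf u^{(\gamma)}_{i}=\sum_{(i_\beta)_{\beta\in S(\gamma)}}C^{(\gamma)}_{i,(i_\beta)}\bigotimes_{\beta\in S(\gamma)}\mathbf u^{(\beta)}_{i_\beta},\qquad \mathbf t(u,C)=\mathbf u^{(D)}_1 .$$ Let $\mathcal R_*$ be the set of those $C$ for which every matricisation of every $C^{(\gamma)}$ with respect to one of the indices $i$, $i_\beta$ ($\beta\in S(\gamma)$) has maximal rank. A *representation* of $\mathbf v\in\mathcal{FT}_{\mathfrak r}(\mathbf V_D)$ consists of closed complements $W_k$ of $U_k^{\min}(\mathbf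 v)$ in $V_k$, bases $(u^{(k)}_i)_{i\le r_k}$ of $U_k^{\min}(\mathbf v)$ ($k\in D$), and $C\in\mathcal R_*$ with $\mathbf t(u,C)=\mathbf v$. For such a representation let $Z^{(D)}(\mathbf v)\subset\mathbf V_D\subset\mathbf V_{D,\|\cdot\|_D}$ be the subspace of all vectors $\dot{\mathbf w}^{(D)}_1$, where $(\dot{\mathbf w}^{(\alpha)}_i)$ runs through the families with $\dot{\mathbf w}^{(k)}_i\in W_k$ arbitrary at the leaves and, for arbitrary $\dot C^{(\gamma)}\in\mathbb R^{r_\gamma\times\prod_{\beta}r_\beta}$, $$\dot{\mathbf w}^{(\gamma)}_i=\sum_{(i_\beta)}\dot C^{(\gamma)}_{i,(i_\beta)}\bigotimes_{\beta\in S(\gamma)}\mathbf u^{(\beta)}_{i_\beta}+\sum_{\beta\in S(\gamma)}\sum_{(i_\delta)_{\delta\in S(\gamma)}}C^{(\gamma)}_{i,(i_\delta)}\ \dot{\mathbf w}^{(\beta)}_{i_\beta}\otimes\bigotimes_{\delta\in S(\gamma)\setminus\{\beta\}}\mathbf u^{(\delta)}_{i_\delta}$$ at every inner vertex $\gamma$.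 Put also $\mathcal U(\mathbf v)=\{\mathbf w\in\mathcal{FT}_{\mathfrak r}(\mathbf V_D):U_k^{\min}(\mathbf w)\oplus W_k=V_k\ \text{for all }k\in D\}$. **Theorem.** Assume that for every inner vertex $\alpha$ there is a constant $c_\alpha$ with $\|\cdot\|_{\vee(S(\alpha))}\le c_\alpha\|\cdot\|_\alpha$ on $\mathbf V_\alpha$, where $$\|\mathbf z\|_{\vee(S(\alpha))}=\sup\Bigl\{\bigl|\bigl(\textstyle\bigotimes_{\beta\in S(\alpha)}\varphi_\beta\bigr)(\mathbf z)\bigr|:\ \varphi_\beta\in(\mathbf V_\beta,\|\cdot\|_\beta)^*,\ \|\varphi_\beta\|\le1\Bigr\}$$ is the injective norm of the sons. Then: 1. Every $\mathbf v\in\mathcal{FT}_{\mathfrak r}(\mathbf V_D)$ has a representation, and for every representation $Z^{(D)}(\mathbf v)$ is a closed complemented subspace of $\mathbf V_{D,\|\cdot\|_D}$. 2. $\mathcal{FT}_{\mathfrak r}(\mathbf V_D)$ is an immersed submanifold of $\mathbf V_{D,\|\cdot\|_D}$: it carries the structure of an analytic Banach manifold, modelled on one Banach space, for which the (injective) inclusion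 $\mathfrak i:\mathcal{FT}_{\mathfrak r}(\mathbf V_D)\to\mathbf V_{D,\|\cdot\|_D}$ is an analytic immersion at every point, and such that for every $\mathbf v$ and every representation of $\mathbf v$ - the image of the tangent space at $\mathbf v$ under $T_{\mathbf v}\mathfrak i$ is $Z^{(D)}(\mathbf v)$; - $\mathcal U(\mathbf v)$ is open, and $(L,C)\mapsto\mathbf t\bigl(((\mathrm{id}+L_k)u^{(k)}_i)_{k,i},C\bigr)$ is an analytic map with everywhere surjective derivative from the open set $\bigl(\times_{k\in D}\mathcal L(U_k^{\min}(\mathbf v),W_k)\bigr)\times\mathcal R_*$ onto $\mathcal U(\mathbf v)$. -/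

import Mathlib

open scoped TensorProduct Manifold ContDiff

universe u₁ u₂

noncomputable section

namespace TreeTensor

/-! ### Dimension partition trees -/

/-- The family `P` of subsets of `D` consists of pairwise disjoint sets with union `α`. -/
def IsPartitionOf {D : Type u₁} [DecidableEq D] (P : Finset (Finset D)) (α : Finset D) : Prop :=
  (∀ β ∈ P, ∀ β' ∈ P, β ≠ β' → Disjoint β β') ∧ P.biUnion id = α

/-- A dimension partition tree of `D`.  The values of `sons` outside `vertices` are irrelevant. -/
structure DimPartTree (D : Type u₁) [Fintype D] [DecidableEq D] where
  vertices : Finset (Finset D)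
  sons : Finset D → Finset (Finset D)
  nonempty_of_mem : ∀ α ∈ vertices, α.Nonempty
  root_mem : Finset.univ ∈ vertices
  sons_subset : ∀ α ∈ vertices, sons α ⊆ vertices
  mem_sons_of_ne_root : ∀ β ∈ vertices, β ≠ Finset.univ → ∃ α ∈ vertices, β ∈ sons α
  two_le_card_sons : ∀ α ∈ vertices, 2 ≤ α.card → 2 ≤ (sons α).card
  sons_partition : ∀ α ∈ vertices, 2 ≤ α.card → IsPartitionOf (sons α) α
  sons_eq_empty : ∀ α ∈ vertices, α.card = 1 → sons α = ∅

/-- The inner vertices, i.e. the vertices which are not leaves. -/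
def DimPartTree.inner {D : Type u₁} [Fintype D] [DecidableEq D] (T : DimPartTree D) :
    Finset (Finset D) :=
  {α ∈ T.vertices | 2 ≤ α.card}

theorem DimPartTree.partition_of_inner {D : Type u₁} [Fintype D] [DecidableEq D]
    (T : DimPartTree D) {α : Finset D} (h : α ∈ T.inner) : IsPartitionOf (T.sons α) α :=
  T.sons_partition α (Finset.mem_filter.1 h).1 (Finset.mem_filter.1 h).2

theorem DimPartTree.card_lt_of_mem_sons {D : Type u₁} [Fintype D] [DecidableEq D]
    (T : DimPartTree D) {α β : Finset D} (h : α ∈ T.inner) (hβ : β ∈ T.sons α) :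
    β.card < α.card := by
  have hv := (Finset.mem_filter.1 h).1
  have hc := (Finset.mem_filter.1 h).2
  obtain ⟨hd, hU⟩ := T.partition_of_inner h
  have hsub : β ⊆ α := by
    rw [← hU]; exact Finset.subset_biUnion_of_mem id hβ
  refine Finset.card_lt_card (Finset.ssubset_iff_subset_ne.2 ⟨hsub, ?_⟩)
  rintro rfl
  obtain ⟨γ, hγ, hne⟩ := Finset.exists_mem_ne (T.two_le_card_sons β hv hc) β
  obtain ⟨x, hx⟩ := T.nonempty_of_mem γ (T.sons_subset β hv hγ)
  have hxβ : x ∈ β := by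
    rw [← hU]; exact Finset.mem_biUnion.2 ⟨γ, hγ, hx⟩
  exact (Finset.disjoint_left.1 (hd γ hγ β hβ hne) hx) hxβ

/-- A tuple of tree-based ranks with `r_D = 1`.  (The values outside the tree are irrelevant.) -/
structure TreeRank (D : Type u₁) [Fintype D] where
  rank : Finset D → ℕ
  rank_root : rank Finset.univ = 1

/-- The only value of the index `i_D`. -/
def TreeRank.rootIndex {D : Type u₁} [Fintype D] (r : TreeRank D) : Fin (r.rank Finset.univ) :=
  ⟨0, r.rank_root ▸ Nat.zero_lt_one⟩

/-- Coefficient tensors `C^(γ) ∈ ℝ^{r_γ × ×_{β ∈ S(γ)} r_β}` for the inner vertices `γ`. -/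
abbrev Coef {D : Type u₁} [Fintype D] [DecidableEq D] (T : DimPartTree D) (r : TreeRank D) :
    Type u₁ :=
  ∀ γ : T.inner, Fin (r.rank γ) → (∀ β : T.sons γ, Fin (r.rank β)) → ℝ

/-- The matricisation of `C^(γ)` with respect to the son `μ` of `γ`: its rows are indexed by `i_μ`,
its columns by `i_γ` and the `i_β` with `β ≠ μ`. -/
def Coef.matricisation {D : Type u₁} [Fintype D] [DecidableEq D] {T : DimPartTree D}
    {r : TreeRank D} (C : Coef T r) (γ : T.inner) (μ : T.sons γ) :
    Matrix (Fin (r.rank μ))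
      (Fin (r.rank γ) × ∀ β : {β : T.sons γ // β ≠ μ}, Fin (r.rank β)) ℝ :=
  Matrix.of fun i q =>
    C γ q.1 ((Equiv.piSplitAt μ fun β : T.sons γ => Fin (r.rank β)).symm (i, q.2))

/-- A matrix of maximal rank. -/
def MaxRank {m n : Type*} [Fintype m] [Fintype n] (M : Matrix m n ℝ) : Prop :=
  M.rank = min (Fintype.card m) (Fintype.card n)

/-- All matricisations of all `C^(γ)` have maximal rank. (At the root, where `r_D = 1`, the first
condition only says that `C^(D) ≠ 0`.) -/
def Coef.IsMaxRank {D : Type u₁} [Fintype D] [DecidableEq D] {T : DimPartTree D}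
    {r : TreeRank D} (C : Coef T r) : Prop :=
  ∀ γ : T.inner, MaxRank (Matrix.of (C γ)) ∧ ∀ μ : T.sons γ, MaxRank (C.matricisation γ μ)

/-! ### Algebraic tensor products -/

section Algebra

variable {D : Type u₁} (V : D → Type u₂) [∀ j, AddCommGroup (V j)] [∀ j, Module ℝ (V j)]

/-- The algebraic tensor product `V_α = ⨂_{j ∈ α} V_j`, without any topology. -/
def TS (α : Finset D) : Type (max u₁ u₂) := ⨂[ℝ] j : α, V j

instance (α : Finset D) : AddCommGroup (TS V α) :=
  inferInstanceAs (AddCommGroup (⨂[ℝ] j : α, V j))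

instance (α : Finset D) : Module ℝ (TS V α) :=
  inferInstanceAs (Module ℝ (⨂[ℝ] j : α, V j))

/-- The elementary tensor `⊗_{j ∈ α} x_j`. -/
def TS.tprod (α : Finset D) : MultilinearMap ℝ (fun j : α => V j) (TS V α) :=
  PiTensorProduct.tprod ℝ

/-- The canonical identification of `V_k` with `V_{{k}}`. -/
def leafEquiv (k : D) : V k ≃ₗ[ℝ] TS V {k} :=
  (PiTensorProduct.subsingletonEquiv (R := ℝ) (s := fun j : ({k} : Finset D) => V j)
    ⟨k, Finset.mem_singleton_self k⟩).symm

variable [DecidableEq D]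

variable {V} in
theorem sub_of_partition {P : Finset (Finset D)} {α : Finset D} (h : IsPartitionOf P α)
    {β : Finset D} (hβ : β ∈ P) {j : D} (hj : j ∈ β) : j ∈ α := by
  rw [← h.2]; exact Finset.mem_biUnion.2 ⟨β, hβ, hj⟩

theorem exists_block {P : Finset (Finset D)} {α : Finset D} (h : IsPartitionOf P α) (j : α) :
    ∃ β ∈ P, j.1 ∈ β := by
  have hj : j.1 ∈ P.biUnion id := h.2.symm ▸ j.2
  simpa using hj

theorem restrict_update {P : Finset (Finset D)} {α : Finset D} (h : IsPartitionOf P α)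
    [DecidableEq α] (x : ∀ j : α, V j) (j : α) {β : Finset D} (hβ : β ∈ P) (hj : j.1 ∈ β)
    (c : V j) :
    (fun β' : P => TS.tprod V β' fun i : β'.1 =>
        Function.update x j c ⟨i, sub_of_partition h β'.2 i.2⟩) =
      Function.update (fun β' : P => TS.tprod V β' fun i : β'.1 =>
          x ⟨i, sub_of_partition h β'.2 i.2⟩) ⟨β, hβ⟩
        (TS.tprod V β (Function.update (fun i : β =>
            x ⟨i, sub_of_partition h hβ i.2⟩) ⟨j, hj⟩ c)) := by
  funext β'
  by_cases hb : β' = ⟨β, hβ⟩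
  · subst hb
    rw [Function.update_self]
    congr 1
    funext i
    by_cases hi : i = ⟨j, hj⟩
    · subst hi
      simp
    · rw [Function.update_of_ne hi, Function.update_of_ne]
      intro hc
      have hij : i.1 = j.1 := congrArg Subtype.val hc
      exact hi (Subtype.ext hij)
  · rw [Function.update_of_ne hb]
    congr 1
    funext i
    rw [Function.update_of_ne]
    intro hc
    have hij : i.1 = j.1 := congrArg Subtype.val hc
    have hne : β'.1 ≠ β := fun hE => hb (Subtype.ext hE)
    exact (Finset.disjoint_left.1 (h.1 _ β'.2 _ hβ hne) i.2) (hij ▸ hj)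

/-- The regrouping map `⊗_{j ∈ α} x_j ↦ ⊗_{β ∈ P} ⊗_{j ∈ β} x_j` as a multilinear map. -/
def splitMultilinear {P : Finset (Finset D)} {α : Finset D} (h : IsPartitionOf P α) :
    MultilinearMap ℝ (fun j : α => V j) (⨂[ℝ] β : P, TS V β) where
  toFun x := PiTensorProduct.tprod ℝ fun β : P =>
    TS.tprod V β fun j : β.1 => x ⟨j, sub_of_partition h β.2 j.2⟩
  map_update_add' := by
    intro dec x j a b
    obtain ⟨β, hβ, hj⟩ := exists_block h j
    simp only [restrict_update V h x j hβ hj, MultilinearMap.map_update_add]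
  map_update_smul' := by
    intro dec x j c a
    obtain ⟨β, hβ, hj⟩ := exists_block h j
    simp only [restrict_update V h x j hβ hj, MultilinearMap.map_update_smul]

/-- The regrouping map `V_α → ⨂_{β ∈ P} V_β` for a partition `P` of `α`. -/
def split {P : Finset (Finset D)} {α : Finset D} (h : IsPartitionOf P α) :
    TS V α →ₗ[ℝ] ⨂[ℝ] β : P, TS V β :=
  PiTensorProduct.lift (splitMultilinear V h)

theorem split_tprod {P : Finset (Finset D)} {α : Finset D} (h : IsPartitionOf P α)
    (x : ∀ j : α, V j) :
    split V h (TS.tprod V α x) = PiTensorProduct.tprod ℝ fun β : P =>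
      TS.tprod V β fun j : β.1 => x ⟨j, sub_of_partition h β.2 j.2⟩ :=
  PiTensorProduct.lift.tprod x

/-- Dependent functions on `α` are families of dependent functions on the blocks. -/
def blockEquiv {P : Finset (Finset D)} {α : Finset D} (h : IsPartitionOf P α)
    (κ : D → Type u₂) : (∀ j : α, κ j) ≃ (∀ β : P, ∀ j : β.1, κ j) :=
  Equiv.ofBijective (fun x β j => x ⟨j, sub_of_partition h β.2 j.2⟩) (by
    constructor
    · intro x y hxy
      funext j
      obtain ⟨β, hβ, hj⟩ := exists_block h j
      exact congrFun (congrFun hxy ⟨β, hβ⟩) ⟨j, hj⟩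
    · intro y
      choose b hb hjb using fun j : α => exists_block h j
      refine ⟨fun j => y ⟨b j, hb j⟩ ⟨j, hjb j⟩, ?_⟩
      funext β j
      have hbb : (⟨b ⟨j, sub_of_partition h β.2 j.2⟩, hb _⟩ : P) = β := by
        by_contra hne
        have hne' : b ⟨j, sub_of_partition h β.2 j.2⟩ ≠ β.1 := fun hE => hne (Subtype.ext hE)
        exact Finset.disjoint_left.1 (h.1 _ (hb _) _ β.2 hne') (hjb _) j.2
      have gen : ∀ (β' : P) (hE : β' = β) (hj' : j.1 ∈ β'.1), y β' ⟨j, hj'⟩ = y β j := by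
        rintro _ rfl _
        rfl
      exact gen _ hbb _)

theorem split_bijective {P : Finset (Finset D)} {α : Finset D} (h : IsPartitionOf P α) :
    Function.Bijective (split V h) := by
  let b : ∀ j : D, Module.Basis (Module.Basis.ofVectorSpaceIndex ℝ (V j)) ℝ (V j) :=
    fun j => Module.Basis.ofVectorSpace ℝ (V j)
  let B : ∀ α : Finset D,
      Module.Basis (∀ j : α, Module.Basis.ofVectorSpaceIndex ℝ (V j)) ℝ (TS V α) :=
    fun α => Basis.piTensorProduct fun j : α => b j
  let N := Basis.piTensorProduct fun β : P => B β
  let e := blockEquiv h fun j => Module.Basis.ofVectorSpaceIndex ℝ (V j)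
  have hs : split V h = ((B α).equiv N e).toLinearMap := by
    refine (B α).ext fun p => ?_
    rw [LinearEquiv.coe_coe, Module.Basis.equiv_apply]
    have h1 : ∀ (α : Finset D) (q), B α q = TS.tprod V α fun j => b j (q j) :=
      fun α q => Basis.piTensorProduct_apply _ q
    rw [h1, split_tprod, Basis.piTensorProduct_apply]
    congr 1
    funext β
    rw [h1]
    rfl
  rw [hs]
  exact ((B α).equiv N e).bijective

/-- The canonical isomorphism `V_α ≅ ⨂_{β ∈ P} V_β` for a partition `P` of `α`. -/
def splitEquiv {P : Finset (Finset D)} {α : Finset D} (h : IsPartitionOf P α) :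
    TS V α ≃ₗ[ℝ] ⨂[ℝ] β : P, TS V β :=
  LinearEquiv.ofBijective (split V h) (split_bijective V h)

/-- The tensor product map `(x_β)_{β ∈ P} ↦ ⊗_{β ∈ P} x_β` from `×_{β ∈ P} V_β` to `V_α`. -/
def merge {P : Finset (Finset D)} {α : Finset D} (h : IsPartitionOf P α) :
    MultilinearMap ℝ (fun β : P => TS V β) (TS V α) :=
  (splitEquiv V h).symm.toLinearMap.compMultilinearMap (PiTensorProduct.tprod ℝ)

theorem merge_tprod {P : Finset (Finset D)} {α : Finset D} (h : IsPartitionOf P α)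
    (x : ∀ j : α, V j) :
    merge V h (fun β : P => TS.tprod V β fun j : β.1 => x ⟨j, sub_of_partition h β.2 j.2⟩) =
      TS.tprod V α x := by
  change (splitEquiv V h).symm (PiTensorProduct.tprod ℝ _) = _
  rw [← split_tprod]
  exact (splitEquiv V h).symm_apply_apply _

theorem isPartitionOf_compl [Fintype D] (α : Finset D) :
    IsPartitionOf {α, αᶜ} (Finset.univ : Finset D) := by
  constructor
  · intro β hβ β' hβ' hne
    simp only [Finset.mem_insert, Finset.mem_singleton] at hβ hβ'
    rcases hβ with rfl | rfl <;> rcases hβ' with rfl | rfl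
    · exact absurd rfl hne
    · exact disjoint_compl_right
    · exact disjoint_compl_left
    · exact absurd rfl hne
  · ext j
    simp

/-- The minimal subspace `U_α^min(v)`: the smallest subspace `U` of `V_α` such that
`v ∈ U ⊗ V_{D ∖ α}`. -/
def Umin [Fintype D] (α : Finset D) (v : TS V Finset.univ) : Submodule ℝ (TS V α) :=
  sInf {U | v ∈ Submodule.span ℝ {z | ∃ x : ∀ β : ({α, αᶜ} : Finset (Finset D)), TS V β,
    x ⟨α, Finset.mem_insert_self α _⟩ ∈ U ∧ merge V (isPartitionOf_compl α) x = z}}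

/-- `U_k^min(v)` as a subspace of `V_k`. -/
def leafMin [Fintype D] (k : D) (v : TS V Finset.univ) : Submodule ℝ (V k) :=
  (Umin V {k} v).comap (leafEquiv V k).toLinearMap

/-- The set `FT_r(V_D)` of tensors `v ∈ V_D` of fixed tree-based rank `r`, as a type without any
topology. -/
def FT [Fintype D] (T : DimPartTree D) (r : TreeRank D) : Type (max u₁ u₂) :=
  {v : TS V Finset.univ // ∀ α ∈ T.vertices, Module.finrank ℝ (Umin V α v) = r.rank α}

variable {V}
variable [Fintype D] {T : DimPartTree D} {r : TreeRank D}

/-- The vectors `u^(α)_i ∈ V_α`, `1 ≤ i ≤ r_α`, obtained from leaf vectors `x^(k)_i ∈ V_k` and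
coefficients `C`: `u^({k})_i = x^(k)_i` and
`u^(γ)_i = ∑_{(i_β)} C^(γ)_{i,(i_β)} ⊗_{β ∈ S(γ)} u^(β)_{i_β}` at an inner vertex `γ`. -/
def frame (x : ∀ k : D, Fin (r.rank {k}) → V k) (C : Coef T r) (α : Finset D) :
    Fin (r.rank α) → TS V α :=
  if h : α ∈ T.inner then fun i =>
    ∑ idx : (∀ β : T.sons α, Fin (r.rank β)), C ⟨α, h⟩ i idx •
      merge V (T.partition_of_inner h) fun β : T.sons α => frame x C β.1 (idx β)
  else if h : ∃ k, {k} = α then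
    h.choose_spec ▸ fun i => leafEquiv V h.choose (x h.choose i)
  else 0
termination_by α.card
decreasing_by exact T.card_lt_of_mem_sons h β.2

theorem frame_inner (x : ∀ k : D, Fin (r.rank {k}) → V k) (C : Coef T r) (γ : T.inner)
    (i : Fin (r.rank γ)) :
    frame x C γ.1 i = ∑ idx : (∀ β : T.sons γ, Fin (r.rank β)), C γ i idx •
      merge V (T.partition_of_inner γ.2) fun β : T.sons γ => frame x C β.1 (idx β) := by
  rw [frame, dif_pos γ.2]

theorem frame_leaf (x : ∀ k : D, Fin (r.rank {k}) → V k) (C : Coef T r) (k : D)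
    (i : Fin (r.rank {k})) : frame x C {k} i = leafEquiv V k (x k i) := by
  have h1 : ({k} : Finset D) ∉ T.inner := by simp [DimPartTree.inner]
  have h2 : ∃ k', ({k'} : Finset D) = {k} := ⟨k, rfl⟩
  rw [frame, dif_neg h1, dif_pos h2]
  have gen : ∀ (k' : D) (hk : ({k'} : Finset D) = {k}),
      (hk ▸ (fun i => leafEquiv V k' (x k' i)) : Fin (r.rank {k}) → TS V {k}) =
        fun i => leafEquiv V k (x k i) := by
    intro k' hk
    obtain rfl := Finset.singleton_injective hk
    rfl
  exact congrFun (gen _ h2.choose_spec) i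

/-- The tensor in `V_D` with leaf vectors `x` and coefficients `C`. -/
def treeTensor (x : ∀ k : D, Fin (r.rank {k}) → V k) (C : Coef T r) : TS V Finset.univ :=
  frame x C Finset.univ r.rootIndex

/-- The families `ẇ^(α)_i ∈ V_α` with `ẇ^({k})_i ∈ W_k` and, for some coefficients `Ċ`,
`ẇ^(γ)_i = ∑ Ċ^(γ)_{i,(i_β)} ⊗_β u^(β)_{i_β} + ∑_{β ∈ S(γ)} ∑_{i_β} ẇ^(β)_{i_β} ⊗ U^(β)_{i,i_β}`,
where `U^(β)_{i,i_β} = ∑ C^(γ)_{i,(i_δ)} ⊗_{δ ∈ S(γ), δ ≠ β} u^(δ)_{i_δ}` (sum over the `i_δ` with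
`δ ≠ β`), at each inner vertex `γ`. -/
def IsTangentFamily (x : ∀ k : D, Fin (r.rank {k}) → V k) (C : Coef T r)
    (W : ∀ k : D, Submodule ℝ (V k)) (w : ∀ α : Finset D, Fin (r.rank α) → TS V α) : Prop :=
  (∀ k i, ∃ y ∈ W k, w {k} i = leafEquiv V k y) ∧
  ∃ C' : Coef T r, ∀ (γ : T.inner) (i : Fin (r.rank γ)),
    w γ.1 i =
      (∑ idx : (∀ β : T.sons γ, Fin (r.rank β)), C' γ i idx •
        merge V (T.partition_of_inner γ.2) fun β : T.sons γ => frame x C β.1 (idx β)) +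
      ∑ β : T.sons γ, ∑ idx : (∀ β : T.sons γ, Fin (r.rank β)), C γ i idx •
        merge V (T.partition_of_inner γ.2)
          (Function.update (fun δ : T.sons γ => frame x C δ.1 (idx δ)) β (w β.1 (idx β)))

/-- The subspace `Z^(D)(v)` of `V_D`. -/
def tangentZ (x : ∀ k : D, Fin (r.rank {k}) → V k) (C : Coef T r)
    (W : ∀ k : D, Submodule ℝ (V k)) : Submodule ℝ (TS V Finset.univ) where
  carrier := {z | ∃ w, IsTangentFamily x C W w ∧ w Finset.univ r.rootIndex = z}
  zero_mem' := by
    refine ⟨fun _ _ => 0, ⟨fun k i => ⟨0, (W k).zero_mem, by simp⟩, 0, fun γ i => ?_⟩, rfl⟩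
    simp
  add_mem' := by
    rintro _ _ ⟨w, ⟨hw, A, hA⟩, rfl⟩ ⟨w', ⟨hw', A', hA'⟩, rfl⟩
    refine ⟨fun α i => w α i + w' α i, ⟨fun k i => ?_, A + A', fun γ i => ?_⟩, rfl⟩
    · obtain ⟨y, hy, e⟩ := hw k i
      obtain ⟨y', hy', e'⟩ := hw' k i
      exact ⟨y + y', (W k).add_mem hy hy', by simp [e, e']⟩
    · simp only [hA γ i, hA' γ i, MultilinearMap.map_update_add, Pi.add_apply, add_smul, smul_add,
        Finset.sum_add_distrib]
      abel
  smul_mem' := by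
    rintro a _ ⟨w, ⟨hw, A, hA⟩, rfl⟩
    refine ⟨fun α i => a • w α i, ⟨fun k i => ?_, a • A, fun γ i => ?_⟩, rfl⟩
    · obtain ⟨y, hy, e⟩ := hw k i
      exact ⟨a • y, (W k).smul_mem a hy, by simp [e]⟩
    · simp only [hA γ i, MultilinearMap.map_update_smul, Pi.smul_apply, smul_add,
        Finset.smul_sum, smul_smul, smul_eq_mul, mul_comm]

end Algebra

/-! ### Norms -/

section Norms

variable {D : Type u₁} [Fintype D] [DecidableEq D] {V : D → Type u₂}
  [∀ j, NormedAddCommGroup (V j)] [∀ j, NormedSpace ℝ (V j)]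

/-- Norms `‖·‖_α` on the tensor spaces `V_α` for the vertices `α` of the tree, which at a leaf
`{k}` are the given norm of `V_k`.  (The values at the other subsets are irrelevant.) -/
structure TreeNorms (T : DimPartTree D) (V : D → Type u₂)
    [∀ j, NormedAddCommGroup (V j)] [∀ j, NormedSpace ℝ (V j)] where
  nm : ∀ α : Finset D, Seminorm ℝ (TS V α)
  eq_zero_of_nm : ∀ α ∈ T.vertices, ∀ x : TS V α, nm α x = 0 → x = 0
  nm_leaf : ∀ (k : D) (x : V k), nm {k} (leafEquiv V k x) = ‖x‖

namespace TreeNorms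

variable {T : DimPartTree D} (N : TreeNorms T V)

/-- At every inner vertex `α` the tensor product map `×_{β ∈ S(α)} V_β → V_α` is continuous. -/
def IsTreeContinuous : Prop :=
  ∀ α : T.inner, ∃ c : ℝ, ∀ x : (∀ β : T.sons α, TS V β),
    N.nm α (merge V (T.partition_of_inner α.2) x) ≤ c * ∏ β : T.sons α, N.nm β (x β)

/-- The injective norm on `V_α = ⨂_{β ∈ S(α)} V_β` with respect to the norms of the sons of `α`:
the supremum of `|(⊗_β φ_β)(z)|` over the functionals `φ_β` on `V_β` of dual norm at most one. -/
def injNorm (α : T.inner) (z : TS V α.1) : ℝ :=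
  sSup {t | ∃ φ : (∀ β : T.sons α, Module.Dual ℝ (TS V β)), (∀ β x, |φ β x| ≤ N.nm β x) ∧
    t = |PiTensorProduct.dualDistrib (PiTensorProduct.tprod ℝ φ)
      (splitEquiv V (T.partition_of_inner α.2) z)|}

/-- `‖·‖_α ≳ ‖·‖_{∨(S(α))}` at every inner vertex `α`. -/
def DominatesInjective : Prop :=
  ∀ α : T.inner, ∃ c : ℝ, ∀ z : TS V α.1, N.injNorm α z ≤ c * N.nm α z

/-- The space `V_D`, normed by `‖·‖_D`. -/
def Normed (_N : TreeNorms T V) : Type (max u₁ u₂) := TS V (Finset.univ : Finset D)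

instance : AddCommGroup N.Normed := inferInstanceAs (AddCommGroup (TS V Finset.univ))

instance : NormedAddCommGroup N.Normed :=
  AddGroupNorm.toNormedAddCommGroup
    { toFun := N.nm Finset.univ
      map_zero' := map_zero _
      add_le' := map_add_le_add _
      neg' := map_neg_eq_map _
      eq_zero_of_map_eq_zero' := N.eq_zero_of_nm _ T.root_mem }

instance : Module ℝ N.Normed := inferInstanceAs (Module ℝ (TS V Finset.univ))

instance : NormedSpace ℝ N.Normed where
  norm_smul_le a x := (map_smul_eq_mul (N.nm Finset.univ) a x).le

/-- The Banach tensor space `V_{D,‖·‖_D}`, the completion of `V_D` with respect to `‖·‖_D`. -/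
abbrev Ambient : Type (max u₁ u₂) := UniformSpace.Completion N.Normed

/-- The canonical embedding of `V_D` into its completion. -/
def embed : TS V (Finset.univ : Finset D) →ₗ[ℝ] N.Ambient :=
  (UniformSpace.Completion.toComplₗᵢ (𝕜 := ℝ) (E := N.Normed)).toLinearMap

/-- The inclusion of `FT_r(V_D)` into `V_{D,‖·‖_D}`. -/
def incl (r : TreeRank D) (v : FT V T r) : N.Ambient := N.embed v.1

end TreeNorms

/-! ### Local data at a tensor of fixed rank -/

/-- A choice, at `v ∈ FT_r(V_D)`, of closed complements `W_k` of `U_k^min(v)` in `V_k`, of bases of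
the `U_k^min(v)`, and of coefficients of maximal rank which represent `v` in these bases. -/
structure ChartData {T : DimPartTree D} {r : TreeRank D} (v : FT V T r) where
  W : ∀ k : D, Submodule ℝ (V k)
  isClosed_W : ∀ k, IsClosed (W k : Set (V k))
  isCompl_W : ∀ k, IsCompl (leafMin V k v.1) (W k)
  u : ∀ k : D, Module.Basis (Fin (r.rank {k})) ℝ (leafMin V k v.1)
  C : Coef T r
  maxRank_C : C.IsMaxRank
  treeTensor_eq : treeTensor (fun k i => (u k i : V k)) C = v.1

namespace ChartData

variable {T : DimPartTree D} {r : TreeRank D} {v : FT V T r} (c : ChartData v)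

/-- The parameter space `×_k L(U_k^min(v), W_k) × ×_γ ℝ^{r_γ × ×_{β ∈ S(γ)} r_β}`. -/
abbrev Params : Type (max u₁ u₂) := (∀ k : D, leafMin V k v.1 →L[ℝ] c.W k) × Coef T r

/-- The parameters with coefficients of maximal rank. -/
def dom : Set c.Params := {p | p.2.IsMaxRank}

/-- The tensor with leaf vectors `(id + L_k) u^(k)_i` and coefficients `C`. -/
def param (p : c.Params) : TS V (Finset.univ : Finset D) :=
  treeTensor (fun k i => (c.u k i : V k) + (p.1 k (c.u k i) : V k)) p.2

/-- The set `U(v)` of the `w ∈ FT_r(V_D)` with `U_k^min(w) ⊕ W_k = V_k` for all `k`. -/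
def nhd : Set (FT V T r) := {w | ∀ k, IsCompl (leafMin V k w.1) (c.W k)}

/-- The subspace `Z^(D)(v)` of `V_{D,‖·‖_D}`. -/
def Z (N : TreeNorms T V) : Submodule ℝ N.Ambient :=
  (tangentZ (fun k i => (c.u k i : V k)) c.C c.W).map N.embed

end ChartData

end Norms

end TreeTensor

end

noncomputable section

/-! ### Submanifolds given by local analytic retractions -/

open Set Topology

/-! Near a tensor `v` of fixed rank, a representation by leaf vectors and coefficients becomes
unique once it is normalised against fixed functionals. The plan is to read this normalised
representation off the tensor by analytic functions defined on an open subset of the completion.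
Parametrisation `f` and reading `s` then satisfy `s ∘ f = id`, and `f ∘ s = id` on tensors of fixed
rank. Such pairs make the set an immersed submanifold with intrinsic tangent spaces
(`exists_submanifold_structure`, `range_fderiv_eq`).

Algebra: `Umin` is generated by the contractions of `v` (`IsContr.mem_Umin`, `Umin_le_of_contr`).
Hence a tree tensor with independent leaf vectors and full-rank coefficients has its frames as bases
of the minimal subspaces (`Umin_treeTensor`). Conversely, bases of the minimal subspaces at all
vertices are frames for full-rank coefficients (`exists_coef`).

Analysis: the injective norm enters only through the boundedness of elementary functionals and
contractions (`boundedDual_dualT`, `boundedMap_contr`). Contractions composed down the tree give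
bounded maps `κ` which send `v` to its own frame and every `w` into the minimal subspaces of `w`
(`exists_contraction`). A dual frame, built by the same recursion from right inverses of the
coefficient matrices, is biorthogonal to the frame of `v` below the root. The matrix of pairings of
the dual frame with `κ w` is the identity at `w = v`, so it is invertible nearby. Correcting `κ w`
by its inverse gives the normalised bases, and from them the coefficients (`localRetraction`).

Tangent spaces: the tree tensor is a composition of bounded multilinear maps, and its derivative
obeys the recursion defining `Z` (`mem_map_tangentZ_iff`, `range_fderiv_eq_Z`). The parametrisation
with all coefficients free has the same range of derivatives, so injectivity of the derivative of
the inclusion makes it a submersion. One model space suffices because closed subspaces of equal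
finite codimension are isomorphic and the spaces of normalised coefficients have equal dimension
(`nonempty_model_equiv`). -/

/-- Local data which exhibit the range of `i : M → X` near `i m` as a submanifold modelled on `E`:
an analytic parametrisation `f` and an analytic left inverse `s` of `f`. -/
structure LocalRetraction {M X : Type*} [NormedAddCommGroup X] [NormedSpace ℝ X] (i : M → X)
    (m : M) (E : Type*) [NormedAddCommGroup E] [NormedSpace ℝ E] where
  s : X → E
  f : E → X
  O : Set X
  Q : Set E
  isOpen_O : IsOpen O
  isOpen_Q : IsOpen Q
  mem_O : i m ∈ O
  contDiffOn_s : ContDiffOn ℝ ω s O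
  contDiffOn_f : ContDiffOn ℝ ω f Q
  f_mem_range : ∀ e ∈ Q, f e ∈ range i
  f_mem_O : ∀ e ∈ Q, f e ∈ O
  s_f : ∀ e ∈ Q, s (f e) = e
  s_mem : ∀ m', i m' ∈ O → s (i m') ∈ Q
  f_s : ∀ m', i m' ∈ O → f (s (i m')) = i m'

namespace LocalRetraction

variable {M X : Type*} [NormedAddCommGroup X] [NormedSpace ℝ X] {i : M → X} {m : M}
  {E E' : Type*} [NormedAddCommGroup E] [NormedSpace ℝ E] [NormedAddCommGroup E'] [NormedSpace ℝ E']

/-- Replacing the model space by an isomorphic one. -/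
def congr (L : LocalRetraction i m E) (g : E ≃L[ℝ] E') : LocalRetraction i m E' where
  s := g ∘ L.s
  f := L.f ∘ g.symm
  O := L.O
  Q := g.symm ⁻¹' L.Q
  isOpen_O := L.isOpen_O
  isOpen_Q := L.isOpen_Q.preimage g.symm.continuous
  mem_O := L.mem_O
  contDiffOn_s := g.contDiff.comp_contDiffOn L.contDiffOn_s
  contDiffOn_f := L.contDiffOn_f.comp g.symm.contDiff.contDiffOn (fun _ h => h)
  f_mem_range e he := L.f_mem_range _ he
  f_mem_O e he := L.f_mem_O _ he
  s_f e he := by simp [L.s_f _ he]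
  s_mem m' h := by simpa using L.s_mem m' h
  f_s m' h := by simpa using L.f_s m' h

theorem contDiffAt_s (L : LocalRetraction i m E) {x : X} (hx : x ∈ L.O) : ContDiffAt ℝ ω L.s x :=
  L.contDiffOn_s.contDiffAt (L.isOpen_O.mem_nhds hx)

theorem contDiffAt_f (L : LocalRetraction i m E) {e : E} (he : e ∈ L.Q) : ContDiffAt ℝ ω L.f e :=
  L.contDiffOn_f.contDiffAt (L.isOpen_Q.mem_nhds he)

theorem hasFDerivAt_s (L : LocalRetraction i m E) {x : X} (hx : x ∈ L.O) :
    HasFDerivAt L.s (fderiv ℝ L.s x) x :=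
  ((L.contDiffAt_s hx).differentiableAt (by simp)).hasFDerivAt

theorem hasFDerivAt_f (L : LocalRetraction i m E) {e : E} (he : e ∈ L.Q) :
    HasFDerivAt L.f (fderiv ℝ L.f e) e :=
  ((L.contDiffAt_f he).differentiableAt (by simp)).hasFDerivAt

/-- The chain rule applied to `s ∘ f = id` on the open set `Q`. -/
theorem fderiv_s_fderiv_f (L : LocalRetraction i m E) {m' : M} (hm : i m' ∈ L.O) (e : E) :
    fderiv ℝ L.s (i m') (fderiv ℝ L.f (L.s (i m')) e) = e := by
  have h1 := L.hasFDerivAt_f (L.s_mem m' hm)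
  have h2 := L.hasFDerivAt_s hm
  rw [← L.f_s m' hm] at h2
  have h3 := h2.comp _ h1
  rw [L.f_s m' hm] at h3
  have h4 : L.s ∘ L.f =ᶠ[𝓝 (L.s (i m'))] id := by
    filter_upwards [L.isOpen_Q.mem_nhds (L.s_mem m' hm)] with e he using L.s_f e he
  have h5 := h3.unique ((hasFDerivAt_id _).congr_of_eventuallyEq h4)
  exact congrArg (fun g : E →L[ℝ] E => g e) h5

/-- A differentiable map into the range of `i` has its derivative in the tangent space. -/
theorem range_le_of_mapsTo {Y : Type*} [NormedAddCommGroup Y] [NormedSpace ℝ Y]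
    (L : LocalRetraction i m E) {m' : M} (hm : i m' ∈ L.O) {P : Y → X} {P' : Y →L[ℝ] X} {y : Y}
    (hP : HasFDerivAt P P' y) (hy : P y = i m') (hr : ∀ᶠ z in 𝓝 y, P z ∈ range i) :
    P'.range ≤ (fderiv ℝ L.f (L.s (i m'))).range := by
  have h1 := L.hasFDerivAt_f (L.s_mem m' hm)
  have h2 := L.hasFDerivAt_s hm
  rw [← hy] at h1 h2
  have h3 := h1.comp (f := L.s ∘ P) y (h2.comp y hP)
  -- On the range of `i` inside `O` the map `f ∘ s` is the identity, so `P` factors through `f` near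
  -- `y`.
  have h4 : (L.f ∘ L.s ∘ P) =ᶠ[𝓝 y] P := by
    have hO : P ⁻¹' L.O ∈ 𝓝 y :=
      hP.continuousAt.preimage_mem_nhds (L.isOpen_O.mem_nhds (by rw [hy]; exact hm))
    filter_upwards [hr, hO] with z ⟨m'', hz⟩ hzO
    have : P z ∈ L.O := hzO
    rw [← hz] at this
    simp only [Function.comp_apply, ← hz]
    exact L.f_s m'' this
  have h5 := hP.unique (h3.congr_of_eventuallyEq h4.symm)
  rintro _ ⟨z, rfl⟩
  rw [h5, hy]
  exact ⟨_, rfl⟩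

/-- Each parametrisation is a differentiable map into the range of `i`, so `range_le_of_mapsTo`
applies in both directions: the tangent space is intrinsic. -/
theorem range_fderiv_eq (L : LocalRetraction i m E) (L' : LocalRetraction i m E') :
    (fderiv ℝ L.f (L.s (i m))).range = (fderiv ℝ L'.f (L'.s (i m))).range := by
  apply le_antisymm
  · refine L'.range_le_of_mapsTo L'.mem_O (L.hasFDerivAt_f (L.s_mem m L.mem_O))
      (L.f_s m L.mem_O) ?_
    filter_upwards [L.isOpen_Q.mem_nhds (L.s_mem m L.mem_O)] with e he using L.f_mem_range e he
  · refine L.range_le_of_mapsTo L.mem_O (L'.hasFDerivAt_f (L'.s_mem m L'.mem_O))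
      (L'.f_s m L'.mem_O) ?_
    filter_upwards [L'.isOpen_Q.mem_nhds (L'.s_mem m L'.mem_O)] with e he using L'.f_mem_range e he

/-- With `A` and `B` the derivatives of `f` and `s`, the identity `B A = id` makes `A B` a
continuous projection onto the range of `A`. -/
theorem closedComplemented_range (L : LocalRetraction i m E) :
    (fderiv ℝ L.f (L.s (i m))).range.ClosedComplemented := by
  set A := fderiv ℝ L.f (L.s (i m))
  set B := fderiv ℝ L.s (i m)
  refine ⟨(A ∘L B).codRestrict _ (fun x => ⟨B x, rfl⟩), ?_⟩
  rintro ⟨_, e, rfl⟩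
  apply Subtype.ext
  change A (B (A e)) = A e
  rw [L.fderiv_s_fderiv_f L.mem_O e]

/-- The splitting of the ambient space at a point of the submanifold. -/
def splitting (L : LocalRetraction i m E) :
    (E × (fderiv ℝ L.s (i m)).ker) ≃L[ℝ] X :=
  ContinuousLinearEquiv.equivOfInverse
    ((fderiv ℝ L.f (L.s (i m))).coprod (fderiv ℝ L.s (i m)).ker.subtypeL)
    ((fderiv ℝ L.s (i m)).prod
      ((ContinuousLinearMap.id ℝ X - fderiv ℝ L.f (L.s (i m)) ∘L fderiv ℝ L.s (i m)).codRestrict _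
        (fun x => by
          rw [LinearMap.mem_ker]
          simp [L.fderiv_s_fderiv_f L.mem_O])))
    (by
      rintro ⟨e, z, hz⟩
      have hz' : fderiv ℝ L.s (i m) z = 0 := hz
      ext <;> simp [L.fderiv_s_fderiv_f L.mem_O, hz'])
    (by intro x; simp)

theorem splitting_apply_zero (L : LocalRetraction i m E) (e : E) :
    L.splitting (e, 0) = fderiv ℝ L.f (L.s (i m)) e := by
  change fderiv ℝ L.f (L.s (i m)) e + ((0 : (fderiv ℝ L.s (i m)).ker) : X) = _
  simp

/-- There is an analytic chart of `X` at `i m` which straightens the parametrisation. -/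
theorem exists_chart [CompleteSpace X] (L : LocalRetraction i m E) :
    ∃ ψ : OpenPartialHomeomorph X X, i m ∈ ψ.source ∧
      ψ ∈ IsManifold.maximalAtlas 𝓘(ℝ, X) ω X ∧
      ∀ e ∈ L.Q, ψ (L.f e) = L.splitting (e, 0) := by
  set A := fderiv ℝ L.f (L.s (i m)) with hA
  -- Replacing the nonlinear part `f ∘ s` by its linearisation gives derivative `id - A B + A B =
  -- id` at `i m`, while `g (f e) = A e` exactly; the inverse function theorem makes `g` a chart.
  set g : X → X := fun y => y - L.f (L.s y) + A (L.s y) with hg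
  have hs := L.contDiffAt_s L.mem_O
  have hf := L.contDiffAt_f (L.s_mem m L.mem_O)
  have hgc : ContDiffAt ℝ ω g (i m) :=
    (contDiffAt_id.sub (hf.comp _ hs)).add (A.contDiff.contDiffAt.comp _ hs)
  have hgd : HasFDerivAt g ((ContinuousLinearEquiv.refl ℝ X : X ≃L[ℝ] X) : X →L[ℝ] X) (i m) := by
    have h1 := L.hasFDerivAt_s L.mem_O
    have h2 := L.hasFDerivAt_f (L.s_mem m L.mem_O)
    have h3 := ((hasFDerivAt_id (i m)).sub (h2.comp _ h1)).add (A.hasFDerivAt.comp _ h1)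
    have h4 : (ContinuousLinearEquiv.refl ℝ X : X →L[ℝ] X) = ContinuousLinearMap.id ℝ X -
        fderiv ℝ L.f (L.s (i m)) ∘L fderiv ℝ L.s (i m) + A ∘L fderiv ℝ L.s (i m) := by
      ext x
      simp [hA]
    rw [h4]
    exact h3
  set ψ₀ := hgc.toOpenPartialHomeomorph g hgd (by simp) with hψ₀
  have hmem : i m ∈ ψ₀.source := hgc.mem_toOpenPartialHomeomorph_source hgd (by simp)
  have hsymm : ContDiffAt ℝ ω ψ₀.symm (ψ₀ (i m)) := by
    refine ψ₀.contDiffAt_symm (ψ₀.map_source hmem) (f₀' := ContinuousLinearEquiv.refl ℝ X) ?_ ?_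
    · rw [ψ₀.left_inv hmem]; exact hgd
    · rw [ψ₀.left_inv hmem]; exact hgc
  -- Analyticity is first known only at one point in each direction; shrinking the source makes the
  -- map and its inverse analytic everywhere, as the groupoid requires.
  obtain ⟨U, hU, hUo, hUm⟩ := eventually_nhds_iff.1 (hgc.eventually (by simp))
  obtain ⟨W, hW, hWo, hWm⟩ := eventually_nhds_iff.1 (hsymm.eventually (by simp))
  have hpre : IsOpen (ψ₀.source ∩ ψ₀ ⁻¹' W) := ψ₀.isOpen_inter_preimage hWo
  refine ⟨ψ₀.restr (U ∩ (ψ₀.source ∩ ψ₀ ⁻¹' W)), ?_, ?_, ?_⟩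
  · rw [OpenPartialHomeomorph.restr_source, (hUo.inter hpre).interior_eq]
    exact ⟨hmem, hUm, hmem, hWm⟩
  · have hcg : ψ₀.restr (U ∩ (ψ₀.source ∩ ψ₀ ⁻¹' W)) ∈ contDiffGroupoid ω 𝓘(ℝ, X) := by
      rw [contDiffGroupoid, mem_groupoid_of_pregroupoid]
      constructor
      · rintro x ⟨hx, -⟩
        simp only [modelWithCornersSelf_coe_symm, preimage_id_eq, id_eq,
          OpenPartialHomeomorph.restr_source, (hUo.inter hpre).interior_eq] at hx
        exact (hU x hx.2.1).contDiffWithinAt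
      · rintro x ⟨hx, -⟩
        simp only [modelWithCornersSelf_coe_symm, preimage_id_eq, id_eq] at hx
        have hx' := (ψ₀.restr (U ∩ (ψ₀.source ∩ ψ₀ ⁻¹' W))).map_target hx
        rw [OpenPartialHomeomorph.restr_source, (hUo.inter hpre).interior_eq] at hx'
        have hxt : x ∈ ψ₀.target := by
          rw [OpenPartialHomeomorph.restr_target] at hx
          exact hx.1
        have hxW : ψ₀ (ψ₀.symm x) ∈ W := hx'.2.2.2
        rw [ψ₀.right_inv hxt] at hxW
        exact (hW x hxW).contDiffWithinAt
    exact StructureGroupoid.mem_maximalAtlas_of_mem_groupoid _ hcg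
  · intro e he
    change g (L.f e) = _
    rw [splitting_apply_zero]
    simp [hg, L.s_f e he, hA]

variable [TopologicalSpace M]

/-- The chart of `M` given by a local retraction, for the topology induced by `i`. -/
def chart (L : LocalRetraction i m E) (hi : IsInducing i) (hinj : Function.Injective i) :
    OpenPartialHomeomorph M E where
  toFun m' := L.s (i m')
  invFun e := haveI : Nonempty M := ⟨m⟩
    Function.invFun i (L.f e)
  source := i ⁻¹' L.O
  target := L.Q
  map_source' m' h := L.s_mem m' h
  map_target' e he := by
    have : Nonempty M := ⟨m⟩
    rw [mem_preimage, Function.invFun_eq (L.f_mem_range e he)]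
    exact L.f_mem_O e he
  left_inv' m' h := by
    have : Nonempty M := ⟨m⟩
    rw [L.f_s m' h]
    exact Function.leftInverse_invFun hinj m'
  right_inv' e he := by
    have : Nonempty M := ⟨m⟩
    rw [Function.invFun_eq (L.f_mem_range e he)]
    exact L.s_f e he
  open_source := L.isOpen_O.preimage hi.continuous
  open_target := L.isOpen_Q
  continuousOn_toFun :=
    L.contDiffOn_s.continuousOn.comp hi.continuous.continuousOn (fun _ h => h)
  continuousOn_invFun := by
    rw [hi.continuousOn_iff]
    refine L.contDiffOn_f.continuousOn.congr fun e he => ?_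
    have : Nonempty M := ⟨m⟩
    exact Function.invFun_eq (L.f_mem_range e he)

theorem chart_symm (L : LocalRetraction i m E) (hi : IsInducing i) (hinj : Function.Injective i)
    {e : E} (he : e ∈ L.Q) : i ((L.chart hi hinj).symm e) = L.f e :=
  have : Nonempty M := ⟨m⟩
  Function.invFun_eq (L.f_mem_range e he)

end LocalRetraction

/-- An injective map with local retractions at all points is an embedded submanifold. -/
theorem exists_submanifold_structure {M X E : Type*} [NormedAddCommGroup X] [NormedSpace ℝ X]
    [CompleteSpace X] [NormedAddCommGroup E] [NormedSpace ℝ E] (i : M → X)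
    (hinj : Function.Injective i) (hL : ∀ m, Nonempty (LocalRetraction i m E)) :
    ∃ (_ : TopologicalSpace M) (_ : ChartedSpace E M), IsManifold 𝓘(ℝ, E) ω M ∧ IsInducing i ∧
      ∀ m, Manifold.IsImmersionAt 𝓘(ℝ, E) 𝓘(ℝ, X) ω i m ∧
        Function.Injective (mfderiv 𝓘(ℝ, E) 𝓘(ℝ, X) i m) ∧
        ∀ L : LocalRetraction i m E,
          (mfderiv 𝓘(ℝ, E) 𝓘(ℝ, X) i m).range = (fderiv ℝ L.f (L.s (i m))).range := by
  have L : ∀ m, LocalRetraction i m E := fun m => (hL m).some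
  let _ : TopologicalSpace M := TopologicalSpace.induced i inferInstance
  have hi : IsInducing i := ⟨rfl⟩
  let _ : ChartedSpace E M :=
    { atlas := range fun m => (L m).chart hi hinj
      chartAt := fun m => (L m).chart hi hinj
      mem_chart_source := fun m => (L m).mem_O
      chart_mem_atlas := fun m => ⟨m, rfl⟩ }
  have hman : IsManifold 𝓘(ℝ, E) ω M := by
    apply isManifold_of_contDiffOn
    rintro _ _ ⟨m, rfl⟩ ⟨m', rfl⟩
    rintro e ⟨he, -⟩
    simp only [modelWithCornersSelf_coe_symm, preimage_id_eq, id_eq,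
      OpenPartialHomeomorph.trans_source, OpenPartialHomeomorph.symm_source] at he
    have heQ : e ∈ (L m).Q := he.1
    have heO : i (((L m).chart hi hinj).symm e) ∈ (L m').O := he.2
    rw [(L m).chart_symm hi hinj heQ] at heO
    -- A change of charts is `s' ∘ f`, hence analytic.
    have h1 := ((L m').contDiffAt_s heO).comp e ((L m).contDiffAt_f heQ)
    refine (h1.congr_of_eventuallyEq ?_).contDiffWithinAt
    filter_upwards [(L m).isOpen_Q.mem_nhds heQ] with e' he'
    change (L m').s (i (((L m).chart hi hinj).symm e')) = _
    rw [(L m).chart_symm hi hinj he']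
    rfl
  refine ⟨inferInstance, inferInstance, hman, hi, fun m => ?_⟩
  have himm : Manifold.IsImmersionAt 𝓘(ℝ, E) 𝓘(ℝ, X) ω i m := by
    obtain ⟨ψ, hψm, hψa, hψ⟩ := (L m).exists_chart
    refine (Manifold.IsImmersionAtOfComplement.mk_of_continuousAt
      hi.continuous.continuousAt (L m).splitting ((L m).chart hi hinj) ψ (L m).mem_O hψm
      (IsManifold.subset_maximalAtlas (mem_range_self m)) hψa ?_).isImmersionAt
    intro e he
    have heQ : e ∈ (L m).Q := by
      rw [OpenPartialHomeomorph.extend_target] at he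
      exact he.1
    change ψ (i (((L m).chart hi hinj).symm e)) = (L m).splitting (e, 0)
    rw [(L m).chart_symm hi hinj heQ, hψ e heQ]
  have hmd : mfderiv 𝓘(ℝ, E) 𝓘(ℝ, X) i m = fderiv ℝ (L m).f ((L m).s (i m)) := by
    have hdiff : MDifferentiableAt 𝓘(ℝ, E) 𝓘(ℝ, X) i m :=
      himm.contMDiffAt.mdifferentiableAt (by simp)
    rw [hdiff.mfderiv]
    have : range (𝓘(ℝ, E) : E → E) = univ := by simp
    rw [this, fderivWithin_univ]
    apply Filter.EventuallyEq.fderiv_eq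
    have hQ := (L m).s_mem m (L m).mem_O
    filter_upwards [(L m).isOpen_Q.mem_nhds hQ] with e he
    exact (L m).chart_symm hi hinj he
  refine ⟨himm, ?_, fun L' => ?_⟩
  · rw [hmd]
    exact Function.LeftInverse.injective ((L m).fderiv_s_fderiv_f (L m).mem_O)
  · rw [hmd]
    exact (L m).range_fderiv_eq L'

end

/-! ### Contractions of algebraic tensor products and minimal subspaces -/

noncomputable section

namespace TreeTensor

open Module

/-- Induction on finitely many coordinates for properties which are linear in each of them. -/
theorem pi_span_induction {ι : Type*} [DecidableEq ι] {M : ι → Type*} [∀ i, AddCommGroup (M i)]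
    [∀ i, Module ℝ (M i)] (S : ∀ i, Set (M i)) (A : Finset ι) (p : (∀ i, M i) → Prop)
    (hp : ∀ x, ∀ i ∈ A, ∃ N : Submodule ℝ (M i), ∀ a, a ∈ N ↔ p (Function.update x i a))
    (base : ∀ x, (∀ i ∈ A, x i ∈ S i) → p x) (x : ∀ i, M i)
    (hx : ∀ i ∈ A, x i ∈ Submodule.span ℝ (S i)) : p x := by
  induction A using Finset.induction_on generalizing p x with
  | empty => exact base x (by simp)
  | insert i A hi ih =>
    obtain ⟨N, hN⟩ := hp x i (Finset.mem_insert_self _ _)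
    suffices x i ∈ N by simpa using (hN _).1 this
    refine (Submodule.span_le.2 fun a ha => (hN a).2 ?_) (hx i (Finset.mem_insert_self _ _))
    -- The induction hypothesis is used for the property weakened by membership of coordinate `i` in
    -- `S i`; it is still linear in each other coordinate, being `p` itself or vacuous.
    refine ih (fun y => y i ∈ S i → p y) ?_ ?_ (Function.update x i a) ?_ (by simpa using ha)
    · intro y j hj
      have hji : i ≠ j := fun h => hi (h ▸ hj)
      by_cases hy : y i ∈ S i
      · obtain ⟨N', hN'⟩ := hp y j (Finset.mem_insert_of_mem hj)
        exact ⟨N', fun b => by simp [hN' b, Function.update_of_ne hji, hy]⟩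
      · exact ⟨⊤, fun b => by simp [Function.update_of_ne hji, hy]⟩
    · intro y hy hyi
      refine base y fun j hj => ?_
      rcases Finset.mem_insert.1 hj with rfl | hj
      exacts [hyi, hy j hj]
    · intro j hj
      have hji : j ≠ i := fun h => hi (h ▸ hj)
      rw [Function.update_of_ne hji]
      exact hx j (Finset.mem_insert_of_mem hj)

/-- A basis adapted to a subspace. -/
theorem exists_adapted_basis {M : Type u₁} [AddCommGroup M] [Module ℝ M] (U : Submodule ℝ M) :
    ∃ (ι : Type u₁) (b : Basis ι ℝ M), ∀ i, b i ∈ U ∨ ∀ x ∈ U, b.coord i x = 0 := by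
  obtain ⟨U', hU⟩ := U.exists_isCompl
  let b := ((Basis.ofVectorSpace ℝ U).prod (Basis.ofVectorSpace ℝ U')).map
    (Submodule.prodEquivOfIsCompl U U' hU)
  refine ⟨_, b, ?_⟩
  rintro (i | i)
  · left
    simp [b]
  · right
    intro x hx
    have h1 : (Submodule.prodEquivOfIsCompl U U' hU).symm x = (⟨x, hx⟩, 0) := by
      rw [LinearEquiv.symm_apply_eq]
      simp
    simp [b, Basis.coord_apply, h1]

section Algebra

variable {D : Type u₁} (V : D → Type u₂) [∀ j, AddCommGroup (V j)] [∀ j, Module ℝ (V j)]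

theorem TS.span_tprod (α : Finset D) :
    Submodule.span ℝ (Set.range (TS.tprod V α)) = ⊤ :=
  PiTensorProduct.span_tprod_eq_top

variable {V} in
theorem TS.ext {α : Finset D} {Y : Type*} [AddCommGroup Y] [Module ℝ Y] {f g : TS V α →ₗ[ℝ] Y}
    (h : ∀ x, f (TS.tprod V α x) = g (TS.tprod V α x)) : f = g :=
  LinearMap.ext_on_range (TS.span_tprod V α) h

variable {V} [DecidableEq D] {P : Finset (Finset D)} {α : Finset D}

theorem splitEquiv_merge (h : IsPartitionOf P α) (x : ∀ β : P, TS V β) :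
    splitEquiv V h (merge V h x) = PiTensorProduct.tprod ℝ x :=
  (splitEquiv V h).apply_symm_apply _

theorem merge_ext (h : IsPartitionOf P α) {Y : Type*} [AddCommGroup Y] [Module ℝ Y]
    {f g : TS V α →ₗ[ℝ] Y} (hfg : ∀ x, f (merge V h x) = g (merge V h x)) : f = g := by
  have : f ∘ₗ (splitEquiv V h).symm.toLinearMap = g ∘ₗ (splitEquiv V h).symm.toLinearMap :=
    PiTensorProduct.ext (MultilinearMap.ext hfg)
  ext z
  simpa using LinearMap.congr_fun this (splitEquiv V h z)

theorem span_merge (h : IsPartitionOf P α) : Submodule.span ℝ (Set.range (merge V h)) = ⊤ := by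
  have h1 : Set.range (merge V h) =
      (splitEquiv V h).symm.toLinearMap '' Set.range (PiTensorProduct.tprod ℝ) := by
    rw [← Set.range_comp]
    rfl
  rw [h1, ← Submodule.map_span, PiTensorProduct.span_tprod_eq_top, Submodule.map_top]
  exact LinearEquiv.range _

/-- The functional `⊗_β ψ_β` on `V_α`. -/
def dualT (h : IsPartitionOf P α) (ψ : ∀ β : P, Dual ℝ (TS V β)) : Dual ℝ (TS V α) :=
  PiTensorProduct.dualDistrib (PiTensorProduct.tprod ℝ ψ) ∘ₗ (splitEquiv V h).toLinearMap

theorem dualT_merge (h : IsPartitionOf P α) (ψ : ∀ β : P, Dual ℝ (TS V β))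
    (x : ∀ β : P, TS V β) : dualT h ψ (merge V h x) = ∏ β, ψ β (x β) := by
  simp [dualT, splitEquiv_merge]

theorem prod_erase_update_self (β : P) (ψ : ∀ δ : P, Dual ℝ (TS V δ)) (x : ∀ δ : P, TS V δ.1)
    (c : TS V β.1) : (∏ ε ∈ Finset.univ.erase β, ψ ε (Function.update x β c ε)) =
      ∏ ε ∈ Finset.univ.erase β, ψ ε (x ε) :=
  Finset.prod_congr rfl fun ε hε => by rw [Function.update_of_ne (Finset.ne_of_mem_erase hε)]

theorem prod_erase_update_of_ne {β δ : P} (hδ : δ ≠ β) (ψ : ∀ δ : P, Dual ℝ (TS V δ))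
    (x : ∀ δ : P, TS V δ.1) (c : TS V δ.1) :
    (∏ ε ∈ Finset.univ.erase β, ψ ε (Function.update x δ c ε)) =
      ψ δ c * ∏ ε ∈ (Finset.univ.erase β).erase δ, ψ ε (x ε) := by
  have hm : δ ∈ Finset.univ.erase β := by simp [hδ]
  rw [← Finset.mul_prod_erase _ _ hm, Function.update_self]
  congr 1
  exact Finset.prod_congr rfl fun ε hε => by
    rw [Function.update_of_ne (Finset.ne_of_mem_erase hε)]

/-- The multilinear map behind `contr`. -/
def contrMultilinear (β : P) (ψ : ∀ δ : P, Dual ℝ (TS V δ)) :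
    MultilinearMap ℝ (fun δ : P => TS V δ) (TS V β.1) where
  toFun x := (∏ δ ∈ Finset.univ.erase β, ψ δ (x δ)) • x β
  map_update_add' := by
    intro dec x δ a b
    rw [Subsingleton.elim dec Subtype.instDecidableEq]
    clear dec
    by_cases hδ : δ = β
    · subst hδ
      simp only [prod_erase_update_self, Function.update_self, smul_add]
    · simp only [prod_erase_update_of_ne hδ, Function.update_of_ne (Ne.symm hδ), map_add, add_mul,
        add_smul]
  map_update_smul' := by
    intro dec x δ c a
    rw [Subsingleton.elim dec Subtype.instDecidableEq]
    clear dec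
    by_cases hδ : δ = β
    · subst hδ
      simp only [prod_erase_update_self, Function.update_self, smul_comm c]
    · simp only [prod_erase_update_of_ne hδ, Function.update_of_ne (Ne.symm hδ), map_smul,
        smul_eq_mul, mul_assoc, smul_smul]

/-- The contraction `id ⊗ ⊗_{δ ≠ β} ψ_δ : V_α → V_β`. -/
def contr (h : IsPartitionOf P α) (β : P) (ψ : ∀ δ : P, Dual ℝ (TS V δ)) :
    TS V α →ₗ[ℝ] TS V β.1 :=
  PiTensorProduct.lift (contrMultilinear β ψ) ∘ₗ (splitEquiv V h).toLinearMap

theorem contr_merge (h : IsPartitionOf P α) (β : P) (ψ : ∀ δ : P, Dual ℝ (TS V δ))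
    (x : ∀ β : P, TS V β) :
    contr h β ψ (merge V h x) = (∏ δ ∈ Finset.univ.erase β, ψ δ (x δ)) • x β := by
  simp only [contr, LinearMap.comp_apply, LinearEquiv.coe_coe, splitEquiv_merge,
    PiTensorProduct.lift.tprod]
  rfl

/-- Functionals of a contraction are elementary functionals of the tensor. This serves twice: to
compute coordinates of tensors, and to bound contractions by the injective norm. -/
theorem dual_contr (h : IsPartitionOf P α) (β : P) (ψ : ∀ δ : P, Dual ℝ (TS V δ))
    (χ : Dual ℝ (TS V β.1)) (z : TS V α) :
    χ (contr h β ψ z) = dualT h (Function.update ψ β χ) z := by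
  have : χ ∘ₗ contr h β ψ = dualT h (Function.update ψ β χ) := by
    refine merge_ext h fun x => ?_
    rw [LinearMap.comp_apply, contr_merge, dualT_merge, map_smul,
      ← Finset.mul_prod_erase _ _ (Finset.mem_univ β), Function.update_self, smul_eq_mul, mul_comm]
    congr 1
    exact Finset.prod_congr rfl fun ε hε => by
      rw [Function.update_of_ne (Finset.ne_of_mem_erase hε)]
  exact LinearMap.congr_fun this z

/-- A tensor all of whose contractions lie in `U_β` lies in `⊗_β U_β`. -/
theorem mem_span_merge_of_contr (h : IsPartitionOf P α) (U : ∀ β : P, Submodule ℝ (TS V β))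
    (z : TS V α) (hz : ∀ β ψ, contr h β ψ z ∈ U β) :
    z ∈ Submodule.span ℝ {w | ∃ x : ∀ β : P, TS V β, (∀ β, x β ∈ U β) ∧ merge V h x = w} := by
  choose ι b hb using fun β : P => exists_adapted_basis (U β)
  -- Expand in the product of bases adapted to the `U β`. If a basis vector lies outside its `U β`,
  -- its coordinate functional annihilates `U β`; the corresponding coefficient is that functional
  -- applied to a contraction of `z`, and vanishes.
  let B := (Basis.piTensorProduct b).map (splitEquiv V h).symm
  have hB : ∀ p, B p = merge V h fun β => b β (p β) := fun p => by
    simp only [B, Basis.map_apply, Basis.piTensorProduct_apply]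
    rfl
  have hc : ∀ p, B.coord p = dualT h fun β => (b β).coord (p β) := by
    classical
    intro p
    refine B.ext fun q => ?_
    rw [hB q, dualT_merge, ← hB q]
    simp only [Basis.coord_apply, Basis.repr_self, Finsupp.single_apply]
    rw [Finset.prod_ite_zero]
    simp [funext_iff]
  rw [← B.linearCombination_repr z, Finsupp.linearCombination_apply]
  refine Submodule.sum_mem _ fun p hp => Submodule.smul_mem _ _ (Submodule.subset_span ?_)
  refine ⟨fun β => b β (p β), fun β => (hb β (p β)).resolve_right fun h0 => ?_, (hB p).symm⟩
  have h1 : B.coord p z ≠ 0 := Finsupp.mem_support_iff.1 hp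
  apply h1
  rw [hc, ← Function.update_eq_self β (fun β => (b β).coord (p β)), ← dual_contr]
  exact h0 _ (hz β _)

/-- The subspace `U ⊗ ⊗_{δ ≠ β} V_δ` of `V_α`. -/
def blockSpan (h : IsPartitionOf P α) (β : P) (U : Submodule ℝ (TS V β.1)) :
    Submodule ℝ (TS V α) :=
  Submodule.span ℝ {z | ∃ x : ∀ β : P, TS V β, x β ∈ U ∧ merge V h x = z}

theorem blockSpan_mono (h : IsPartitionOf P α) (β : P) {U U' : Submodule ℝ (TS V β.1)}
    (hU : U ≤ U') : blockSpan h β U ≤ blockSpan h β U' :=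
  Submodule.span_mono fun _ ⟨x, hx, e⟩ => ⟨x, hU hx, e⟩

theorem mem_blockSpan_of_contr (h : IsPartitionOf P α) (β : P) (U : Submodule ℝ (TS V β.1))
    (z : TS V α) (hz : ∀ ψ, contr h β ψ z ∈ U) : z ∈ blockSpan h β U := by
  have h1 := mem_span_merge_of_contr h (Function.update (fun _ => ⊤) β U) z (by
    intro δ ψ
    by_cases hδ : δ = β
    · subst hδ
      simpa using hz ψ
    · simp [Function.update_of_ne hδ])
  refine Submodule.span_mono ?_ h1
  rintro _ ⟨x, hx, rfl⟩
  exact ⟨x, by simpa using hx β, rfl⟩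

omit [DecidableEq D] in
/-- `κ : V_γ → V_β` is the contraction with a functional on `V_{γ ∖ β}`. -/
def IsContr {β γ : Finset D} (hβ : β ⊆ γ) (κ : TS V γ →ₗ[ℝ] TS V β) : Prop :=
  ∃ s : (∀ j : γ, V j) → ℝ,
    (∀ z z' : ∀ j : γ, V j, (∀ j : γ, j.1 ∉ β → z j = z' j) → s z = s z') ∧
    ∀ z, κ (TS.tprod V γ z) = s z • TS.tprod V β fun j => z ⟨j, hβ j.2⟩

theorem IsPartitionOf.subset (h : IsPartitionOf P α) (β : P) : β.1 ⊆ α :=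
  fun _ hj => sub_of_partition h β.2 hj

theorem isContr_contr (h : IsPartitionOf P α) (β : P) (ψ : ∀ δ : P, Dual ℝ (TS V δ)) :
    IsContr (h.subset β) (contr h β ψ) := by
  refine ⟨fun z => ∏ δ ∈ Finset.univ.erase β, ψ δ (TS.tprod V δ fun j : δ.1 =>
    z ⟨j, sub_of_partition h δ.2 j.2⟩), fun z z' hz => ?_, fun z => ?_⟩
  · refine Finset.prod_congr rfl fun δ hδ => ?_
    congr 2
    funext j
    apply hz
    have hne : δ.1 ≠ β.1 := fun e => Finset.ne_of_mem_erase hδ (Subtype.ext e)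
    exact Finset.disjoint_left.1 (h.1 _ δ.2 _ β.2 hne) j.2
  · rw [← merge_tprod V h, contr_merge]

-- Describing contractions by their weights on elementary tensors makes composition a multiplication
-- of weights, without any identification of the complementary tensor factors.
omit [DecidableEq D] in
theorem IsContr.comp {β γ ε : Finset D} {hβ : β ⊆ γ} {hγ : γ ⊆ ε} {κ : TS V γ →ₗ[ℝ] TS V β}
    {μ : TS V ε →ₗ[ℝ] TS V γ} (hκ : IsContr hβ κ) (hμ : IsContr hγ μ) :
    IsContr (hβ.trans hγ) (κ ∘ₗ μ) := by
  obtain ⟨s, hs, hsz⟩ := hκ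
  obtain ⟨t, ht, htz⟩ := hμ
  refine ⟨fun z => t z * s fun j => z ⟨j, hγ j.2⟩, fun z z' hz => ?_, fun z => ?_⟩
  · refine congrArg₂ (· * ·) (ht z z' fun j hj => hz j fun h => hj (hβ h)) ?_
    exact hs _ _ fun j hj => hz _ hj
  · rw [LinearMap.comp_apply, htz, map_smul, hsz, smul_smul]

/-- Fixing elementary tensors in the blocks other than `γ` turns a contraction of `V_ε` into one
of `V_γ`. -/
theorem IsContr.comp_merge {β ε : Finset D} (h : IsPartitionOf P ε) (γ : P) (hβ : β ⊆ γ.1)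
    {κ : TS V ε →ₗ[ℝ] TS V β} (hκ : IsContr (hβ.trans (h.subset γ)) κ) (x : ∀ δ : P, TS V δ)
    (hx : ∀ δ, δ ≠ γ → x δ ∈ Set.range (TS.tprod V δ.1)) :
    IsContr hβ (κ ∘ₗ (merge V h).toLinearMap x γ) := by
  classical
  obtain ⟨s, hs, hsz⟩ := hκ
  have hx' : ∀ δ : P, ∃ z : ∀ j : δ.1, V j, δ ≠ γ → TS.tprod V δ.1 z = x δ := fun δ => by
    by_cases hδ : δ = γ
    · exact ⟨fun _ => 0, fun h => absurd hδ h⟩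
    · obtain ⟨z, hz⟩ := hx δ hδ
      exact ⟨z, fun _ => hz⟩
  choose z hz using hx'
  let e := blockEquiv h V
  have he : ∀ (y : ∀ δ : P, ∀ j : δ.1, V j) (δ : P) (j : δ.1),
      e.symm y ⟨j, sub_of_partition h δ.2 j.2⟩ = y δ j := fun y δ j =>
    congrFun (congrFun (e.apply_symm_apply y) δ) j
  refine ⟨fun w => s (e.symm (Function.update z γ w)), fun w w' hw => ?_, fun w => ?_⟩
  · apply hs
    intro j hj
    obtain ⟨δ, hδ, hjδ⟩ := exists_block h j
    have h1 := he (Function.update z γ w) ⟨δ, hδ⟩ ⟨j, hjδ⟩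
    have h2 := he (Function.update z γ w') ⟨δ, hδ⟩ ⟨j, hjδ⟩
    refine h1.trans (Eq.trans ?_ h2.symm)
    by_cases hg : (⟨δ, hδ⟩ : P) = γ
    · subst hg
      simpa using hw ⟨j, hjδ⟩ hj
    · simp [Function.update_of_ne hg]
  · have h1 : Function.update x γ (TS.tprod V γ.1 w) = fun δ : P => TS.tprod V δ.1 fun j : δ.1 =>
        e.symm (Function.update z γ w) ⟨j, sub_of_partition h δ.2 j.2⟩ := by
      funext δ
      simp only [he]
      by_cases hg : δ = γ
      · subst hg
        simp
      · rw [Function.update_of_ne hg, Function.update_of_ne hg, hz δ hg]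
    have h2 : (κ ∘ₗ (merge V h).toLinearMap x γ) (TS.tprod V γ.1 w) =
        κ (TS.tprod V ε (e.symm (Function.update z γ w))) := by
      rw [← merge_tprod V h, ← h1]
      rfl
    rw [h2, hsz]
    congr 2
    funext j
    have := he (Function.update z γ w) γ ⟨j, hβ j.2⟩
    simpa using this

-- No index lies outside `β`, so the weight is a constant.
omit [DecidableEq D] in
theorem IsContr.self {β : Finset D} {hβ : β ⊆ β} {κ : TS V β →ₗ[ℝ] TS V β} (hκ : IsContr hβ κ) :
    ∃ c : ℝ, κ = c • LinearMap.id := by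
  obtain ⟨s, hs, hsz⟩ := hκ
  refine ⟨s fun _ => 0, TS.ext fun z => ?_⟩
  rw [hsz, hs z (fun _ => 0) fun j hj => absurd j.2 hj]
  rfl

/-- The generic step down the tree: contractions of a tensor in `U_γ ⊗ …` with
`U_γ ⊂ U_β ⊗ …` lie in `U_β`. -/
theorem IsContr.mem_of_mem_blockSpan {β ε : Finset D} (h : IsPartitionOf P ε) (γ : P)
    (hβ : β ⊆ γ.1) {κ : TS V ε →ₗ[ℝ] TS V β} (hκ : IsContr (hβ.trans (h.subset γ)) κ)
    (U : Submodule ℝ (TS V γ.1)) (U' : Submodule ℝ (TS V β))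
    (hU : ∀ κ' : TS V γ.1 →ₗ[ℝ] TS V β, IsContr hβ κ' → ∀ y ∈ U, κ' y ∈ U')
    {z : TS V ε} (hz : z ∈ blockSpan h γ U) : κ z ∈ U' := by
  have : blockSpan h γ U ≤ U'.comap κ := by
    refine Submodule.span_le.2 ?_
    rintro _ ⟨x, hx, rfl⟩
    change κ (merge V h x) ∈ U'
    -- Only the blocks other than `γ` are reduced to elementary tensors; then `comp_merge` turns `κ`
    -- into a contraction acting on the block `γ`, whose entry stays in `U`.
    refine pi_span_induction (fun δ : P => Set.range (TS.tprod V δ.1)) (Finset.univ.erase γ)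
      (fun x => x γ ∈ U → κ (merge V h x) ∈ U') ?_ ?_ x
      (fun δ _ => by rw [TS.span_tprod]; trivial) hx
    · intro x δ hδ
      have hne : γ ≠ δ := (Finset.ne_of_mem_erase hδ).symm
      by_cases hxU : x γ ∈ U
      · exact ⟨U'.comap (κ ∘ₗ (merge V h).toLinearMap x δ), fun a => by
          simp [Function.update_of_ne hne, hxU]⟩
      · exact ⟨⊤, fun a => by simp [Function.update_of_ne hne, hxU]⟩
    · intro x hx hxU
      have h1 := hU _ (hκ.comp_merge h γ hβ x fun δ hδ => hx δ (by simp [hδ])) _ hxU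
      simpa using h1
  exact this hz

theorem IsContr.mem_of_mem_blockSpan_self (h : IsPartitionOf P α) (β : P)
    {κ : TS V α →ₗ[ℝ] TS V β.1} (hκ : IsContr (h.subset β) κ)
    {U : Submodule ℝ (TS V β.1)} {z : TS V α} (hz : z ∈ blockSpan h β U) : κ z ∈ U := by
  refine IsContr.mem_of_mem_blockSpan h β subset_rfl hκ U U ?_ hz
  intro κ' hκ' y hy
  obtain ⟨c, rfl⟩ := hκ'.self
  exact U.smul_mem c hy

/-! ### Minimal subspaces -/

section Umin

variable [Fintype D]

/-- `α` as a block of the partition `{α, αᶜ}`. -/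
abbrev selfBlock (α : Finset D) : ({α, αᶜ} : Finset (Finset D)) :=
  ⟨α, Finset.mem_insert_self α _⟩

theorem Umin_le {v : TS V Finset.univ} {U : Submodule ℝ (TS V α)}
    (h : v ∈ blockSpan (isPartitionOf_compl α) (selfBlock α) U) : Umin V α v ≤ U :=
  sInf_le h

/-- A contraction maps `U ⊗ …` into `U`, so its value at `v` lies in every subspace competing in the
infimum. -/
theorem IsContr.mem_Umin {κ : TS V Finset.univ →ₗ[ℝ] TS V α}
    (hκ : IsContr (Finset.subset_univ α) κ) (v : TS V Finset.univ) : κ v ∈ Umin V α v := by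
  rw [Umin, Submodule.mem_sInf]
  intro U hU
  exact hκ.mem_of_mem_blockSpan_self (isPartitionOf_compl α) (selfBlock α) hU

theorem Umin_le_of_contr {v : TS V Finset.univ} {U : Submodule ℝ (TS V α)}
    (h : ∀ κ : TS V Finset.univ →ₗ[ℝ] TS V α, IsContr (Finset.subset_univ α) κ → κ v ∈ U) :
    Umin V α v ≤ U :=
  Umin_le (mem_blockSpan_of_contr _ _ _ _ fun ψ =>
    h _ (isContr_contr (isPartitionOf_compl α) (selfBlock α) ψ))

/-- The infimum is attained: all contractions of `v` lie in it, and membership in a block span is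
detected by contractions. -/
theorem mem_blockSpan_Umin (α : Finset D) (v : TS V Finset.univ) :
    v ∈ blockSpan (isPartitionOf_compl α) (selfBlock α) (Umin V α v) :=
  mem_blockSpan_of_contr _ _ _ _ fun ψ =>
    (isContr_contr (isPartitionOf_compl α) (selfBlock α) ψ).mem_Umin v

/-- Composed contractions are contractions, which nests the minimal subspaces along the tree. -/
theorem IsContr.map_Umin {β γ : Finset D} {hβ : β ⊆ γ} {κ : TS V γ →ₗ[ℝ] TS V β}
    (hκ : IsContr hβ κ) {v : TS V Finset.univ} {y : TS V γ} (hy : y ∈ Umin V γ v) :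
    κ y ∈ Umin V β v := by
  have : Umin V γ v ≤ (Umin V β v).comap κ :=
    Umin_le_of_contr fun μ hμ => (hκ.comp hμ).mem_Umin v
  exact this hy

theorem contr_mem_Umin (h : IsPartitionOf P α) (β : P) (ψ : ∀ δ : P, Dual ℝ (TS V δ))
    {v : TS V Finset.univ} {y : TS V α} (hy : y ∈ Umin V α v) :
    contr h β ψ y ∈ Umin V β.1 v :=
  (isContr_contr h β ψ).map_Umin hy

/-- Minimality passes from father to son: a contraction of `v` to `β` can be carried out on the
block `α` first, on vectors of `Umin V α v`. -/
theorem Umin_le_of_le_blockSpan (h : IsPartitionOf P α) (β : P) {v : TS V Finset.univ}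
    {U : Submodule ℝ (TS V β.1)} (hU : Umin V α v ≤ blockSpan h β U) : Umin V β.1 v ≤ U := by
  refine Umin_le_of_contr fun κ hκ => ?_
  refine IsContr.mem_of_mem_blockSpan (isPartitionOf_compl α) (selfBlock α) (h.subset β) hκ
    (Umin V α v) U (fun κ' hκ' y hy => ?_) (mem_blockSpan_Umin α v)
  exact hκ'.mem_of_mem_blockSpan_self h β (hU hy)

theorem mem_Umin_univ (v : TS V Finset.univ) : v ∈ Umin V Finset.univ v := by
  have : IsContr (Finset.subset_univ _) (LinearMap.id : TS V (Finset.univ : Finset D) →ₗ[ℝ] _) :=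
    ⟨fun _ => 1, fun _ _ _ => rfl, fun z => by simp⟩
  exact this.mem_Umin v

theorem Umin_univ_le (v : TS V (Finset.univ : Finset D)) :
    Umin V Finset.univ v ≤ Submodule.span ℝ {v} := by
  refine Umin_le_of_contr fun κ hκ => ?_
  obtain ⟨c, rfl⟩ := hκ.self
  exact Submodule.smul_mem _ _ (Submodule.mem_span_singleton_self v)

instance finiteDimensional_Umin (α : Finset D) (v : TS V Finset.univ) :
    FiniteDimensional ℝ (Umin V α v) := by
  have key : ∃ U : Submodule ℝ (TS V α), FiniteDimensional ℝ U ∧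
      v ∈ blockSpan (isPartitionOf_compl α) (selfBlock α) U := by
    have hv : v ∈ Submodule.span ℝ (Set.range (merge V (isPartitionOf_compl α))) := by
      rw [span_merge]; trivial
    induction hv using Submodule.span_induction with
    | mem x hx =>
      obtain ⟨y, rfl⟩ := hx
      exact ⟨Submodule.span ℝ {y (selfBlock α)}, inferInstance, Submodule.subset_span
        ⟨y, Submodule.mem_span_singleton_self _, rfl⟩⟩
    | zero => exact ⟨⊥, inferInstance, Submodule.zero_mem _⟩
    | add x y _ _ hx hy =>
      obtain ⟨U, hU, hxU⟩ := hx
      obtain ⟨U', hU', hyU'⟩ := hy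
      exact ⟨U ⊔ U', inferInstance, Submodule.add_mem _ (blockSpan_mono _ _ le_sup_left hxU)
        (blockSpan_mono _ _ le_sup_right hyU')⟩
    | smul a x _ hx =>
      obtain ⟨U, hU, hxU⟩ := hx
      exact ⟨U, hU, Submodule.smul_mem _ _ hxU⟩
  obtain ⟨U, hU, hv⟩ := key
  exact Submodule.finiteDimensional_of_le (Umin_le hv)

end Umin

end Algebra

end TreeTensor

end

/-! ### Induction on the tree, full-rank coefficients, and frames of minimal subspaces -/

noncomputable section

namespace TreeTensor

open Module

/-- A biorthogonal family of functionals for a linearly independent family. -/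
theorem exists_dual_family {ι M : Type*} [DecidableEq ι] [AddCommGroup M] [Module ℝ M] {n : ι → M}
    (hn : LinearIndependent ℝ n) :
    ∃ ψ : ι → Dual ℝ M, ∀ j i, ψ j (n i) = if i = j then 1 else 0 := by
  choose ψ hψ using fun j => LinearMap.exists_extend ((Basis.span hn).coord j)
  refine ⟨ψ, fun j i => ?_⟩
  have h1 : (Basis.span hn i : M) = n i := congrArg Subtype.val (Basis.span_apply hn i)
  have h2 : ψ j (Basis.span hn i : M) = (Basis.span hn).coord j (Basis.span hn i) :=
    LinearMap.congr_fun (hψ j) (Basis.span hn i)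
  rw [← h1, h2, Basis.coord_apply, Basis.repr_self, Finsupp.single_apply]

theorem linearIndependent_of_dual {ι M : Type*} [Fintype ι] [DecidableEq ι] [AddCommGroup M]
    [Module ℝ M] {n : ι → M} {ψ : ι → Dual ℝ M} (h : ∀ j i, ψ j (n i) = if i = j then 1 else 0) :
    LinearIndependent ℝ n := by
  rw [Fintype.linearIndependent_iff]
  intro g hg j
  have := congrArg (ψ j) hg
  simpa [h] using this

/-- The columns of `A` are a dual family of the rows of `M`, written in the standard coordinates. -/
theorem exists_rightInverse {m n : Type*} [Fintype n] [DecidableEq n] [DecidableEq m]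
    {M : Matrix m n ℝ} (hM : LinearIndependent ℝ M.row) : ∃ A : Matrix n m ℝ, M * A = 1 := by
  obtain ⟨ψ, hψ⟩ := exists_dual_family hM
  refine ⟨Matrix.of fun c j => ψ j (Pi.single c 1), ?_⟩
  ext i j
  rw [Matrix.mul_apply, Matrix.one_apply, ← hψ j i]
  have h1 : M.row i = ∑ c, M i c • (Pi.single c (1 : ℝ) : n → ℝ) := by
    ext c
    simp [Finset.sum_apply, Pi.single_apply, Matrix.row]
  rw [h1, map_sum]
  simp

theorem maxRank_iff {m n : Type*} [Fintype m] [Fintype n] {M : Matrix m n ℝ}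
    (h : Fintype.card m ≤ Fintype.card n) : MaxRank M ↔ LinearIndependent ℝ M.row := by
  rw [MaxRank, min_eq_left h, Matrix.rank_eq_finrank_span_row,
    linearIndependent_iff_card_eq_finrank_span, eq_comm]
  rfl

section Tree

variable {D : Type u₁} [Fintype D] [DecidableEq D] (T : DimPartTree D)

theorem DimPartTree.exists_leaf_of_not_inner {α : Finset D} (hα : α ∈ T.vertices)
    (h : α ∉ T.inner) : ∃ k, α = {k} := by
  have h1 : ¬ 2 ≤ α.card := fun h2 => h (Finset.mem_filter.2 ⟨hα, h2⟩)
  have h2 := (T.nonempty_of_mem α hα).card_pos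
  exact Finset.card_eq_one.1 (by omega)

theorem DimPartTree.singleton_notMem_inner (k : D) : {k} ∉ T.inner := by
  simp [DimPartTree.inner]

theorem DimPartTree.inner_mem (γ : T.inner) : γ.1 ∈ T.vertices := (Finset.mem_filter.1 γ.2).1

theorem DimPartTree.son_mem (γ : T.inner) (β : T.sons γ) : β.1 ∈ T.vertices :=
  T.sons_subset _ (T.inner_mem γ) β.2

theorem DimPartTree.son_ne_univ (γ : T.inner) (β : T.sons γ) : β.1 ≠ Finset.univ := by
  intro h
  have h1 := T.card_lt_of_mem_sons γ.2 β.2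
  rw [h] at h1
  exact absurd h1 (not_lt.2 (Finset.card_le_univ _))

theorem DimPartTree.bottomUp {p : Finset D → Prop} (leaf : ∀ k, {k} ∈ T.vertices → p {k})
    (inner : ∀ γ : T.inner, (∀ β : T.sons γ, p β) → p γ) : ∀ α ∈ T.vertices, p α := by
  have : ∀ n, ∀ α ∈ T.vertices, α.card = n → p α := by
    intro n
    induction n using Nat.strong_induction_on with
    | _ n ih =>
      rintro α hα rfl
      by_cases h : α ∈ T.inner
      · exact inner ⟨α, h⟩ fun β =>
          ih _ (T.card_lt_of_mem_sons h β.2) β (T.son_mem ⟨α, h⟩ β) rfl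
      · obtain ⟨k, rfl⟩ := T.exists_leaf_of_not_inner hα h
        exact leaf k hα
  exact fun α hα => this _ α hα rfl

theorem DimPartTree.topDown {p : Finset D → Prop} (root : p Finset.univ)
    (step : ∀ γ : T.inner, p γ → ∀ β : T.sons γ, p β) : ∀ α ∈ T.vertices, p α := by
  have : ∀ n, ∀ α ∈ T.vertices, (Finset.univ : Finset D).card - α.card = n → p α := by
    intro n
    induction n using Nat.strong_induction_on with
    | _ n ih =>
      rintro β hβ rfl
      by_cases h : β = Finset.univ
      · exact h ▸ root
      · obtain ⟨γ, hγ, hβγ⟩ := T.mem_sons_of_ne_root β hβ h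
        -- A father is never a leaf, since leaves have no sons.
        have hγi : γ ∈ T.inner := by
          by_contra hni
          obtain ⟨k, rfl⟩ := T.exists_leaf_of_not_inner hγ hni
          rw [T.sons_eq_empty _ hγ (Finset.card_singleton k)] at hβγ
          simp at hβγ
        have h1 := T.card_lt_of_mem_sons hγi hβγ
        have h2 := Finset.card_le_univ γ
        rw [← Finset.card_univ] at h2
        exact step ⟨γ, hγi⟩ (ih _ (by omega) γ hγ rfl) ⟨β, hβγ⟩
  exact fun α hα => this _ α hα rfl

theorem DimPartTree.singleton_mem (k : D) : {k} ∈ T.vertices := by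
  have : ∀ α ∈ T.vertices, k ∈ α → {k} ∈ T.vertices := by
    refine T.bottomUp (fun k' hk' h => ?_) (fun γ ih h => ?_)
    · rwa [Finset.mem_singleton.1 h]
    · obtain ⟨β, hβ, hk⟩ := exists_block (T.partition_of_inner γ.2) ⟨k, h⟩
      exact ih ⟨β, hβ⟩ hk
  exact this _ T.root_mem (Finset.mem_univ k)

theorem DimPartTree.univ_mem_inner [Nontrivial D] : Finset.univ ∈ T.inner :=
  Finset.mem_filter.2 ⟨T.root_mem, Fintype.one_lt_card⟩

instance TreeRank.subsingleton (r : TreeRank D) : Subsingleton (Fin (r.rank Finset.univ)) := by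
  rw [r.rank_root]; infer_instance

variable {T} {r : TreeRank D}

/-- The matricisations of all `C^(γ)` have linearly independent rows. -/
def Coef.FullRank (C : Coef T r) : Prop :=
  ∀ γ : T.inner, LinearIndependent ℝ (Matrix.of (C γ)).row ∧
    ∀ μ : T.sons γ, LinearIndependent ℝ (C.matricisation γ μ).row

/-- One tuple with independent rows shows that no matricisation has more rows than columns; from
then on maximal rank and independence of the rows are the same condition. -/
theorem Coef.FullRank.isMaxRank_iff {C₀ : Coef T r} (h : C₀.FullRank) (C : Coef T r) :
    C.IsMaxRank ↔ C.FullRank := by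
  refine forall_congr' fun γ => and_congr (maxRank_iff ?_) (forall_congr' fun μ => maxRank_iff ?_)
  · simpa using (h γ).1.fintype_card_le_finrank
  · simpa using ((h γ).2 μ).fintype_card_le_finrank

theorem isOpen_setOf_fullRank : IsOpen {C : Coef T r | C.FullRank} := by
  simp only [Coef.FullRank, Set.ofPred_forall, Set.ofPred_and]
  refine isOpen_iInter_of_finite fun γ => IsOpen.inter ?_ (isOpen_iInter_of_finite fun μ => ?_)
  · refine isOpen_setOfPred_linearIndependent.preimage
      (f := fun C : Coef T r => (Matrix.of (C γ)).row) ?_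
    exact continuous_apply γ
  · refine isOpen_setOfPred_linearIndependent.preimage
      (f := fun C : Coef T r => (C.matricisation γ μ).row) ?_
    refine continuous_pi fun i => continuous_pi fun q => ?_
    simp only [Coef.matricisation, Matrix.row, Matrix.of_apply]
    fun_prop

end Tree

section Algebra

variable {D : Type u₁} {V : D → Type u₂} [∀ j, AddCommGroup (V j)] [∀ j, Module ℝ (V j)]
  [DecidableEq D] {P : Finset (Finset D)} {α : Finset D}

theorem dualT_sum_merge (h : IsPartitionOf P α) {d : P → ℕ} {n : ∀ β : P, Fin (d β) → TS V β.1}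
    {ψ : ∀ β : P, Fin (d β) → Dual ℝ (TS V β.1)}
    (hψ : ∀ β j i, ψ β j (n β i) = if i = j then 1 else 0) (c : (∀ β : P, Fin (d β)) → ℝ)
    (idx : ∀ β : P, Fin (d β)) :
    dualT h (fun β => ψ β (idx β)) (∑ p, c p • merge V h fun β => n β (p β)) = c idx := by
  rw [map_sum, Finset.sum_eq_single idx]
  · simp [dualT_merge, hψ]
  · intro p _ hp
    obtain ⟨β, hβ⟩ := Function.ne_iff.1 hp
    rw [map_smul, dualT_merge, Finset.prod_eq_zero (Finset.mem_univ β) (by simp [hψ, hβ]),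
      smul_zero]
  · simp

theorem piSplitAt_symm_eq_update {ι : Type*} [DecidableEq ι] (μ : ι) (β : ι → Type*)
    (p : ∀ i, β i) (j : β μ) :
    (Equiv.piSplitAt μ β).symm (j, fun i => p i) = Function.update p μ j := by
  funext i
  by_cases h : i = μ
  · subst h; simp
  · simp [h]

/-- Biorthogonality removes every term whose index differs from `idx` away from `μ`; what remains is
a combination of the vectors at `μ` with coefficients from one column of a matricisation. -/
theorem contr_sum_merge (h : IsPartitionOf P α) (μ : P) {d : P → ℕ}
    {n : ∀ β : P, Fin (d β) → TS V β.1} {ψ : ∀ β : P, Fin (d β) → Dual ℝ (TS V β.1)}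
    (hψ : ∀ β j i, ψ β j (n β i) = if i = j then 1 else 0) (c : (∀ β : P, Fin (d β)) → ℝ)
    (idx : ∀ β : P, Fin (d β)) :
    contr h μ (fun β => ψ β (idx β)) (∑ p, c p • merge V h fun β => n β (p β)) =
      ∑ j, c (Function.update idx μ j) • n μ j := by
  rw [map_sum, ← Equiv.sum_comp (Equiv.piSplitAt μ fun β => Fin (d β)).symm, Fintype.sum_prod_type]
  refine Finset.sum_congr rfl fun j _ => ?_
  refine (Finset.sum_eq_single (fun β : {β : P // β ≠ μ} => idx β) ?_ ?_).trans ?_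
  rotate_left 2
  · rw [piSplitAt_symm_eq_update, map_smul, contr_merge, Finset.prod_eq_one]
    · simp
    · intro δ hδ
      rw [Function.update_of_ne (Finset.ne_of_mem_erase hδ), hψ]
      simp
  · intro q _ hq
    obtain ⟨β, hβ⟩ := Function.ne_iff.1 hq
    rw [map_smul, contr_merge, Finset.prod_eq_zero (i := β.1), zero_smul, smul_zero]
    · simp [β.2]
    · simp [hψ, β.2, hβ]
  · simp

theorem span_merge_le (h : IsPartitionOf P α) {d : P → ℕ} (n : ∀ β : P, Fin (d β) → TS V β.1) :
    Submodule.span ℝ {w | ∃ x : ∀ β : P, TS V β, (∀ β, x β ∈ Submodule.span ℝ (Set.range (n β))) ∧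
      merge V h x = w} ≤
    Submodule.span ℝ (Set.range fun p : (∀ β : P, Fin (d β)) => merge V h fun β => n β (p β)) := by
  refine Submodule.span_le.2 ?_
  rintro _ ⟨x, hx, rfl⟩
  refine pi_span_induction (fun β : P => Set.range (n β)) Finset.univ (fun x => merge V h x ∈
    Submodule.span ℝ (Set.range fun p : (∀ β : P, Fin (d β)) => merge V h fun β => n β (p β)))
    ?_ ?_ x fun β _ => hx β
  · intro x β _
    exact ⟨Submodule.comap ((merge V h).toLinearMap x β) (Submodule.span ℝ (Set.range
      fun p : (∀ β : P, Fin (d β)) => merge V h fun β => n β (p β))), fun a => Iff.rfl⟩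
  · intro x hx
    choose p hp using fun β => hx β (Finset.mem_univ β)
    have : x = fun β => n β (p β) := funext fun β => (hp β).symm
    rw [this]
    exact Submodule.subset_span ⟨p, rfl⟩

variable [Fintype D] {T : DimPartTree D} {r : TreeRank D}

theorem frame_univ (x : ∀ k : D, Fin (r.rank {k}) → V k) (C : Coef T r)
    (i : Fin (r.rank Finset.univ)) : frame x C Finset.univ i = treeTensor x C := by
  rw [treeTensor, Subsingleton.elim i]

theorem dualT_frame {x : ∀ k : D, Fin (r.rank {k}) → V k} {C : Coef T r} (γ : T.inner)
    {ψ : ∀ δ : T.sons γ, Fin (r.rank δ) → Dual ℝ (TS V δ.1)}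
    (hψ : ∀ δ j i, ψ δ j (frame x C δ i) = if i = j then 1 else 0) (i : Fin (r.rank γ))
    (idx : ∀ δ : T.sons γ, Fin (r.rank δ)) :
    dualT (T.partition_of_inner γ.2) (fun δ => ψ δ (idx δ)) (frame x C γ i) = C γ i idx := by
  rw [frame_inner]
  exact dualT_sum_merge (T.partition_of_inner γ.2) hψ (C γ i) idx

/-- Elementary functionals dual to the frames of the sons recover the coefficients, so a relation
among frame vectors is a relation among the rows of `C γ`. -/
theorem frame_linearIndependent {x : ∀ k : D, Fin (r.rank {k}) → V k} {C : Coef T r}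
    (hx : ∀ k, LinearIndependent ℝ (x k)) (hC : C.FullRank) :
    ∀ α ∈ T.vertices, LinearIndependent ℝ (frame x C α) := by
  refine T.bottomUp (fun k _ => ?_) (fun γ ih => ?_)
  · have : frame x C {k} = leafEquiv V k ∘ x k := funext fun i => frame_leaf x C k i
    rw [this]
    exact (hx k).map' _ (LinearEquiv.ker _)
  · choose ψ hψ using fun β : T.sons γ => exists_dual_family (ih β)
    rw [Fintype.linearIndependent_iff]
    intro g hg
    refine Fintype.linearIndependent_iff.1 (hC γ).1 g ?_
    funext idx
    have := congrArg (dualT (T.partition_of_inner γ.2) fun β => ψ β (idx β)) hg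
    rw [map_sum, map_zero, Finset.sum_congr rfl fun i _ => (map_smul _ _ _).trans
      (congrArg (g i • ·) (dualT_frame γ hψ i idx))] at this
    simpa [Finset.sum_apply] using this

/-- Frame vectors of a son are obtained by contracting those of its father. -/
theorem frame_son_eq {x : ∀ k : D, Fin (r.rank {k}) → V k} {C : Coef T r} (γ : T.inner)
    (β : T.sons γ) {ψ : ∀ δ : T.sons γ, Fin (r.rank δ) → Dual ℝ (TS V δ.1)}
    (hψ : ∀ δ j i, ψ δ j (frame x C δ i) = if i = j then 1 else 0)
    {A : Matrix (Fin (r.rank γ) × ∀ δ : {δ : T.sons γ // δ ≠ β}, Fin (r.rank δ))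
      (Fin (r.rank β)) ℝ} (hA : C.matricisation γ β * A = 1) (j : Fin (r.rank β)) :
    frame x C β j = ∑ p, A p j • contr (T.partition_of_inner γ.2) β
      (fun δ => ψ δ ((Equiv.piSplitAt β fun δ : T.sons γ => Fin (r.rank δ)).symm (j, p.2) δ))
      (frame x C γ p.1) := by
  -- Contracting with index `p` yields the combination of the son's frame given by column `p` of the
  -- matricisation; the right inverse `A` then isolates the vector `j`.
  have h1 : ∀ p : Fin (r.rank γ) × ∀ δ : {δ : T.sons γ // δ ≠ β}, Fin (r.rank δ),
      contr (T.partition_of_inner γ.2) β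
        (fun δ => ψ δ ((Equiv.piSplitAt β fun δ : T.sons γ => Fin (r.rank δ)).symm (j, p.2) δ))
        (frame x C γ p.1) = ∑ l, C.matricisation γ β l p • frame x C β l := by
    intro p
    rw [frame_inner]
    refine (contr_sum_merge (T.partition_of_inner γ.2) β hψ (C γ p.1) _).trans ?_
    refine Finset.sum_congr rfl fun l _ => ?_
    congr 2
    rw [← piSplitAt_symm_eq_update]
    congr 1
    ext1
    · rfl
    · funext δ
      simp [δ.2]
  simp only [h1, Finset.smul_sum, smul_smul]
  rw [Finset.sum_comm]
  have h2 : ∀ l, ∑ p, A p j * C.matricisation γ β l p = if l = j then 1 else 0 := by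
    intro l
    rw [← Matrix.one_apply, ← hA, Matrix.mul_apply]
    exact Finset.sum_congr rfl fun p _ => mul_comm _ _
  simp only [← Finset.sum_smul, h2]
  simp

/-- Down the tree, `≤` holds because the father's frame is expanded in the son's frame, and `≥`
because full rank of the matricisation recovers the son's frame by contracting the father's. -/
theorem Umin_treeTensor {x : ∀ k : D, Fin (r.rank {k}) → V k} {C : Coef T r}
    (hx : ∀ k, LinearIndependent ℝ (x k)) (hC : C.FullRank) :
    ∀ α ∈ T.vertices, Umin V α (treeTensor x C) = Submodule.span ℝ (Set.range (frame x C α)) := by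
  refine T.topDown ?_ (fun γ ih β => ?_)
  · apply le_antisymm
    · refine (Umin_univ_le _).trans (Submodule.span_mono ?_)
      rintro _ rfl
      exact ⟨r.rootIndex, rfl⟩
    · refine Submodule.span_le.2 ?_
      rintro _ ⟨i, rfl⟩
      rw [frame_univ]
      exact mem_Umin_univ _
  · apply le_antisymm
    · refine Umin_le_of_le_blockSpan (T.partition_of_inner γ.2) β ?_
      rw [ih]
      refine Submodule.span_le.2 ?_
      rintro _ ⟨i, rfl⟩
      rw [frame_inner]
      refine Submodule.sum_mem _ fun idx _ => Submodule.smul_mem _ _ (Submodule.subset_span ?_)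
      exact ⟨_, Submodule.subset_span ⟨idx β, rfl⟩, rfl⟩
    · refine Submodule.span_le.2 ?_
      rintro _ ⟨j, rfl⟩
      choose ψ hψ using fun δ : T.sons γ => exists_dual_family
        (frame_linearIndependent hx hC δ (T.son_mem γ δ))
      obtain ⟨A, hA⟩ := exists_rightInverse ((hC γ).2 β)
      rw [frame_son_eq γ β hψ hA j]
      refine Submodule.sum_mem _ fun p _ => Submodule.smul_mem _ _ (contr_mem_Umin _ β _ ?_)
      rw [ih]
      exact Submodule.subset_span ⟨_, rfl⟩

theorem finrank_Umin_treeTensor {x : ∀ k : D, Fin (r.rank {k}) → V k} {C : Coef T r}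
    (hx : ∀ k, LinearIndependent ℝ (x k)) (hC : C.FullRank) :
    ∀ α ∈ T.vertices, Module.finrank ℝ (Umin V α (treeTensor x C)) = r.rank α := by
  intro α hα
  rw [Umin_treeTensor hx hC α hα, finrank_span_eq_card (frame_linearIndependent hx hC α hα),
    Fintype.card_fin]

/-- Bases of the minimal subspaces at all vertices are frames for suitable coefficients. -/
theorem exists_coef {v : TS V Finset.univ} (x : ∀ k : D, Fin (r.rank {k}) → V k)
    (n : ∀ α : Finset D, Fin (r.rank α) → TS V α) (hleaf : ∀ k i, n {k} i = leafEquiv V k (x k i))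
    (hn : ∀ α ∈ T.vertices, LinearIndependent ℝ (n α))
    (hspan : ∀ α ∈ T.vertices, Submodule.span ℝ (Set.range (n α)) = Umin V α v) :
    ∃ C : Coef T r, C.FullRank ∧ ∀ α ∈ T.vertices, frame x C α = n α := by
  have h1 : ∀ (γ : T.inner) (i : Fin (r.rank γ)), ∃ c : (∀ β : T.sons γ, Fin (r.rank β)) → ℝ,
      ∑ idx, c idx • merge V (T.partition_of_inner γ.2) (fun β => n β.1 (idx β)) = n γ i := by
    intro γ i
    apply (Submodule.mem_span_range_iff_exists_fun ℝ).1
    refine span_merge_le (T.partition_of_inner γ.2) (fun β : T.sons γ => n β.1) ?_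
    refine mem_span_merge_of_contr _ (fun β : T.sons γ => Submodule.span ℝ (Set.range (n β.1))) _
      fun β ψ => ?_
    rw [hspan _ (T.son_mem γ β)]
    refine contr_mem_Umin _ β ψ ?_
    rw [← hspan _ (T.inner_mem γ)]
    exact Submodule.subset_span ⟨i, rfl⟩
  choose C hC using h1
  refine ⟨C, fun γ => ⟨?_, fun μ => ?_⟩, T.bottomUp (fun k _ => ?_) fun γ ih => ?_⟩
  -- The map taking coefficients to combinations of elementary products sends row `i` to `n γ i`,
  -- and these vectors are independent.
  · refine LinearIndependent.of_comp (Fintype.linearCombination ℝ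
      fun idx : (∀ β : T.sons γ, Fin (r.rank β)) =>
        merge V (T.partition_of_inner γ.2) (fun β => n β.1 (idx β))) ?_
    convert hn γ (T.inner_mem γ) using 1
    funext i
    exact hC γ i
  · rw [Fintype.linearIndependent_iff]
    intro a ha
    obtain ⟨ψ, hψ⟩ := exists_dual_family (hn μ (T.son_mem γ μ))
    -- For a relation `a` among the rows, `χ` kills every contraction of every `n γ i`. Hence `Umin`
    -- at `γ` lies in `ker χ ⊗ …`, minimality puts `Umin` at `μ` inside `ker χ`, and `a j = χ (n μ
    -- j) = 0`.
    set χ : Dual ℝ (TS V μ.1) := ∑ j, a j • ψ j with hχ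
    have hχn : ∀ j, χ (n μ j) = a j := fun j => by simp [hχ, hψ]
    have hle : Umin V μ.1 v ≤ LinearMap.ker χ := by
      refine Umin_le_of_le_blockSpan (T.partition_of_inner γ.2) μ ?_
      rw [← hspan _ (T.inner_mem γ)]
      refine Submodule.span_le.2 ?_
      rintro _ ⟨i, rfl⟩
      refine mem_blockSpan_of_contr _ _ _ _ fun φ => ?_
      rw [← hC γ i, LinearMap.mem_ker, map_sum, map_sum,
        ← Equiv.sum_comp (Equiv.piSplitAt μ fun β : T.sons γ => Fin (r.rank β)).symm,
        Fintype.sum_prod_type, Finset.sum_comm]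
      refine Finset.sum_eq_zero fun q _ => ?_
      have h2 := congrFun ha (i, q)
      simp only [Finset.sum_apply, Pi.smul_apply, Pi.zero_apply] at h2
      have h3 : ∀ j, χ (contr (T.partition_of_inner γ.2) μ φ
          (C γ i ((Equiv.piSplitAt μ fun β : T.sons γ => Fin (r.rank β)).symm (j, q)) •
          merge V (T.partition_of_inner γ.2) (fun β => n β.1
            ((Equiv.piSplitAt μ fun β : T.sons γ => Fin (r.rank β)).symm (j, q) β)))) =
          (∏ δ : {δ // δ ≠ μ}, φ δ.1 (n δ.1.1 (q δ))) * (a j * Coef.matricisation C γ μ j (i, q)) := by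
        intro j
        rw [map_smul, contr_merge, map_smul, map_smul]
        have h4 : (Equiv.piSplitAt μ fun β : T.sons γ => Fin (r.rank β)).symm (j, q) μ = j := by
          simp
        have h5 : (∏ δ ∈ Finset.univ.erase μ, φ δ (n δ.1
            ((Equiv.piSplitAt μ fun β : T.sons γ => Fin (r.rank β)).symm (j, q) δ))) =
            ∏ δ : {δ // δ ≠ μ}, φ δ.1 (n δ.1.1 (q δ)) := by
          rw [Finset.prod_subtype (Finset.univ.erase μ) (p := fun δ => δ ≠ μ) (by simp)
            (fun δ => φ δ (n δ.1
            ((Equiv.piSplitAt μ fun β : T.sons γ => Fin (r.rank β)).symm (j, q) δ)))]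
          refine Finset.prod_congr rfl fun δ _ => ?_
          simp [δ.2]
        rw [h4, h5, hχn]
        simp only [smul_eq_mul, Coef.matricisation, Matrix.of_apply]
        ring
      rw [Finset.sum_congr rfl fun j _ => h3 j, ← Finset.mul_sum]
      refine mul_eq_zero_of_right _ ?_
      exact h2
    intro j
    rw [← hχn j]
    apply hle
    rw [← hspan _ (T.son_mem γ μ)]
    exact Submodule.subset_span ⟨j, rfl⟩
  · funext i
    rw [frame_leaf, hleaf]
  · funext i
    rw [frame_inner, ← hC γ i]
    refine Finset.sum_congr rfl fun idx _ => ?_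
    congr 2
    funext β
    rw [ih β]

end Algebra

end TreeTensor

end

/-! ### Boundedness of functionals and contractions -/

noncomputable section

namespace TreeTensor

open Module

section Norms

variable {D : Type u₁} [Fintype D] [DecidableEq D] {V : D → Type u₂}
  [∀ j, NormedAddCommGroup (V j)] [∀ j, NormedSpace ℝ (V j)] {T : DimPartTree D}

namespace TreeNorms

variable (N : TreeNorms T V)

/-- The space `V_α` with the norm `‖·‖_α`, for a vertex `α`. -/
def Space (_N : TreeNorms T V) (α : T.vertices) : Type (max u₁ u₂) := TS V α.1

instance (α : T.vertices) : AddCommGroup (N.Space α) := inferInstanceAs (AddCommGroup (TS V α.1))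

instance (α : T.vertices) : NormedAddCommGroup (N.Space α) :=
  AddGroupNorm.toNormedAddCommGroup
    { toFun := N.nm α.1
      map_zero' := map_zero _
      add_le' := map_add_le_add _
      neg' := map_neg_eq_map _
      eq_zero_of_map_eq_zero' := N.eq_zero_of_nm _ α.2 }

instance (α : T.vertices) : Module ℝ (N.Space α) := inferInstanceAs (Module ℝ (TS V α.1))

instance (α : T.vertices) : NormedSpace ℝ (N.Space α) where
  norm_smul_le a x := (map_smul_eq_mul (N.nm α.1) a x).le

/-- The identification of `V_α` with the normed space `(V_α, ‖·‖_α)`. -/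
def toSpace (α : T.vertices) : TS V α.1 ≃ₗ[ℝ] N.Space α := LinearEquiv.refl ℝ (TS V α.1)

theorem norm_toSpace (α : T.vertices) (x : TS V α.1) : ‖N.toSpace α x‖ = N.nm α.1 x := rfl

/-- Hahn–Banach: a norming functional, as used to bound contractions. -/
theorem exists_functional {α : Finset D} (hα : α ∈ T.vertices) (x : TS V α) :
    ∃ χ : Dual ℝ (TS V α), (∀ y, |χ y| ≤ N.nm α y) ∧ χ x = N.nm α x := by
  obtain ⟨g, hg, hx⟩ := exists_dual_vector'' ℝ (N.toSpace ⟨α, hα⟩ x)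
  refine ⟨g.toLinearMap ∘ₗ (N.toSpace ⟨α, hα⟩).toLinearMap, fun y => ?_, hx⟩
  refine (g.le_opNorm (N.toSpace ⟨α, hα⟩ y)).trans ?_
  rw [norm_toSpace]
  exact mul_le_of_le_one_left (apply_nonneg _ _) hg

/-- The real `sSup` of an unbounded set is zero, so boundedness must be known before the injective
norm controls anything. It holds because every tensor is a finite sum of products. -/
theorem bddAbove_injNorm (γ : T.inner) (z : TS V γ.1) :
    ∃ B : ℝ, ∀ φ : (∀ β : T.sons γ, Dual ℝ (TS V β.1)), (∀ β x, |φ β x| ≤ N.nm β x) →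
      |dualT (T.partition_of_inner γ.2) φ z| ≤ B := by
  have hz : z ∈ Submodule.span ℝ (Set.range (merge V (T.partition_of_inner γ.2))) := by
    rw [span_merge]; trivial
  induction hz using Submodule.span_induction with
  | mem y hy =>
    obtain ⟨x, rfl⟩ := hy
    refine ⟨∏ β : T.sons γ, N.nm β (x β), fun φ hφ => ?_⟩
    rw [dualT_merge, Finset.abs_prod]
    exact Finset.prod_le_prod (fun _ _ => abs_nonneg _) fun β _ => hφ β _
  | zero => exact ⟨0, fun φ _ => by simp⟩
  | add x y _ _ hx hy =>
    obtain ⟨B, hB⟩ := hx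
    obtain ⟨B', hB'⟩ := hy
    exact ⟨B + B', fun φ hφ => by
      rw [map_add]
      exact (abs_add_le _ _).trans (add_le_add (hB φ hφ) (hB' φ hφ))⟩
  | smul a x _ hx =>
    obtain ⟨B, hB⟩ := hx
    exact ⟨|a| * B, fun φ hφ => by
      rw [map_smul, smul_eq_mul, abs_mul]
      exact mul_le_mul_of_nonneg_left (hB φ hφ) (abs_nonneg a)⟩

theorem abs_dualT_le_injNorm (γ : T.inner) (z : TS V γ.1)
    {φ : ∀ β : T.sons γ, Dual ℝ (TS V β.1)} (hφ : ∀ β x, |φ β x| ≤ N.nm β x) :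
    |dualT (T.partition_of_inner γ.2) φ z| ≤ N.injNorm γ z := by
  obtain ⟨B, hB⟩ := N.bddAbove_injNorm γ z
  refine le_csSup ⟨B, ?_⟩ ⟨φ, hφ, rfl⟩
  rintro _ ⟨φ', hφ', rfl⟩
  exact hB φ' hφ'

omit [Fintype D] in
theorem _root_.TreeTensor.dualT_smul {P : Finset (Finset D)} {α : Finset D}
    (h : IsPartitionOf P α) (b : P → ℝ) (ψ : ∀ β : P, Dual ℝ (TS V β.1)) (z : TS V α) :
    dualT h (fun β => b β • ψ β) z = (∏ β, b β) * dualT h ψ z := by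
  have : dualT h (fun β => b β • ψ β) = (∏ β, b β) • dualT h ψ := by
    refine merge_ext h fun x => ?_
    simp [dualT_merge, Finset.prod_mul_distrib]
  rw [this]
  rfl

variable {N}

/-- Elementary functionals are bounded. -/
theorem DominatesInjective.abs_dualT_le (hinj : N.DominatesInjective) (γ : T.inner) :
    ∃ c : ℝ, ∀ (b : T.sons γ → ℝ) (φ : ∀ β : T.sons γ, Dual ℝ (TS V β.1)), (∀ β, 0 < b β) →
      (∀ β x, |φ β x| ≤ b β * N.nm β x) → ∀ z,
      |dualT (T.partition_of_inner γ.2) φ z| ≤ c * (∏ β, b β) * N.nm γ z := by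
  obtain ⟨c, hc⟩ := hinj γ
  refine ⟨c, fun b φ hb hφ z => ?_⟩
  have h1 : φ = fun β => b β • ((b β)⁻¹ • φ β) := by
    funext β
    rw [smul_smul, mul_inv_cancel₀ (hb β).ne', one_smul]
  rw [h1, dualT_smul, abs_mul, abs_of_pos (Finset.prod_pos fun β _ => hb β)]
  have h2 := (N.abs_dualT_le_injNorm γ z (φ := fun β => (b β)⁻¹ • φ β) fun β x => by
    rw [LinearMap.smul_apply, smul_eq_mul, abs_mul, abs_of_pos (inv_pos.2 (hb β)),
      inv_mul_le_iff₀ (hb β)]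
    exact hφ β x).trans (hc z)
  calc _ ≤ (∏ β, b β) * (c * N.nm γ z) :=
        mul_le_mul_of_nonneg_left h2 (Finset.prod_nonneg fun β _ => (hb β).le)
    _ = _ := by ring

variable (N) in
/-- Bounded functionals on `V_α`. -/
def BoundedDual (α : Finset D) (ψ : Dual ℝ (TS V α)) : Prop := ∃ c : ℝ, ∀ x, |ψ x| ≤ c * N.nm α x

variable (N) in
/-- Bounded linear maps `V_α → V_β`. -/
def BoundedMap {α β : Finset D} (κ : TS V α →ₗ[ℝ] TS V β) : Prop :=
  ∃ c : ℝ, ∀ x, N.nm β (κ x) ≤ c * N.nm α x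

theorem BoundedDual.exists_pos {α : Finset D} {ψ : Dual ℝ (TS V α)} (h : N.BoundedDual α ψ) :
    ∃ c : ℝ, 0 < c ∧ ∀ x, |ψ x| ≤ c * N.nm α x := by
  obtain ⟨c, hc⟩ := h
  refine ⟨max c 0 + 1, by positivity, fun x => (hc x).trans ?_⟩
  exact mul_le_mul_of_nonneg_right (by linarith [le_max_left c 0]) (apply_nonneg _ _)

theorem BoundedMap.exists_nonneg {α β : Finset D} {κ : TS V α →ₗ[ℝ] TS V β} (h : N.BoundedMap κ) :
    ∃ c : ℝ, 0 ≤ c ∧ ∀ x, N.nm β (κ x) ≤ c * N.nm α x := by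
  obtain ⟨c, hc⟩ := h
  refine ⟨max c 0, le_max_right _ _, fun x => (hc x).trans ?_⟩
  exact mul_le_mul_of_nonneg_right (le_max_left c 0) (apply_nonneg _ _)

theorem BoundedDual.sum {α : Finset D} {ι : Type*} [Fintype ι] (a : ι → ℝ)
    {ψ : ι → Dual ℝ (TS V α)} (h : ∀ i, N.BoundedDual α (ψ i)) :
    N.BoundedDual α (∑ i, a i • ψ i) := by
  choose c hc using h
  refine ⟨∑ i, |a i| * c i, fun x => ?_⟩
  rw [LinearMap.sum_apply, Finset.sum_mul]
  refine (Finset.abs_sum_le_sum_abs _ _).trans (Finset.sum_le_sum fun i _ => ?_)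
  rw [LinearMap.smul_apply, smul_eq_mul, abs_mul, mul_assoc]
  exact mul_le_mul_of_nonneg_left (hc i x) (abs_nonneg _)

theorem BoundedMap.sum {α β : Finset D} {ι : Type*} [Fintype ι] (a : ι → ℝ)
    {κ : ι → TS V α →ₗ[ℝ] TS V β} (h : ∀ i, N.BoundedMap (κ i)) :
    N.BoundedMap (∑ i, a i • κ i) := by
  choose c hc using h
  refine ⟨∑ i, |a i| * c i, fun x => ?_⟩
  rw [LinearMap.sum_apply, Finset.sum_mul]
  refine (Finset.le_sum_of_subadditive (N.nm β) (map_zero (N.nm β)).le (map_add_le_add _) _ _).trans (Finset.sum_le_sum fun i _ => ?_)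
  rw [LinearMap.smul_apply, map_smul_eq_mul, mul_assoc]
  exact mul_le_mul_of_nonneg_left (hc i x) (norm_nonneg _)

theorem BoundedMap.comp {α β γ : Finset D} {κ : TS V β →ₗ[ℝ] TS V γ} {μ : TS V α →ₗ[ℝ] TS V β}
    (hκ : N.BoundedMap κ) (hμ : N.BoundedMap μ) : N.BoundedMap (κ ∘ₗ μ) := by
  obtain ⟨c, hc0, hc⟩ := hκ.exists_nonneg
  obtain ⟨d, hd⟩ := hμ
  refine ⟨c * d, fun x => (hc _).trans ?_⟩
  rw [mul_assoc]
  exact mul_le_mul_of_nonneg_left (hd x) hc0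

theorem BoundedDual.comp {α β : Finset D} {ψ : Dual ℝ (TS V β)} {μ : TS V α →ₗ[ℝ] TS V β}
    (hψ : N.BoundedDual β ψ) (hμ : N.BoundedMap μ) : N.BoundedDual α (ψ ∘ₗ μ) := by
  obtain ⟨c, hc0, hc⟩ := hψ.exists_pos
  obtain ⟨d, hd⟩ := hμ
  refine ⟨c * d, fun x => (hc _).trans ?_⟩
  rw [mul_assoc]
  exact mul_le_mul_of_nonneg_left (hd x) hc0.le

theorem DominatesInjective.boundedDual_dualT (hinj : N.DominatesInjective) (γ : T.inner)
    {φ : ∀ β : T.sons γ, Dual ℝ (TS V β.1)} (hφ : ∀ β, N.BoundedDual β.1 (φ β)) :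
    N.BoundedDual γ.1 (dualT (T.partition_of_inner γ.2) φ) := by
  obtain ⟨c, hc⟩ := hinj.abs_dualT_le γ
  choose b hb hφ' using fun β => (hφ β).exists_pos
  exact ⟨_, hc b φ hb hφ'⟩

/-- The norm of a contraction is attained by a functional `χ` of dual norm at most one, and `χ`
after the contraction is an elementary functional. The bound has the factor `1` in place `β`, so it
does not depend on `χ` or on the tensor. -/
theorem DominatesInjective.boundedMap_contr (hinj : N.DominatesInjective) (γ : T.inner)
    (β : T.sons γ) {φ : ∀ β : T.sons γ, Dual ℝ (TS V β.1)} (hφ : ∀ β, N.BoundedDual β.1 (φ β)) :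
    N.BoundedMap (contr (T.partition_of_inner γ.2) β φ) := by
  obtain ⟨c, hc⟩ := hinj.abs_dualT_le γ
  choose b hb hφ' using fun β => (hφ β).exists_pos
  refine ⟨c * ∏ δ, Function.update b β 1 δ, fun z => ?_⟩
  obtain ⟨χ, hχ, hχz⟩ := N.exists_functional (T.son_mem γ β) (contr (T.partition_of_inner γ.2) β φ z)
  rw [← hχz, dual_contr]
  refine (le_abs_self _).trans (hc _ _ (fun δ => ?_) (fun δ x => ?_) z)
  · by_cases h : δ = β
    · subst h; simp
    · simpa [Function.update_of_ne h] using hb δ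
  · by_cases h : δ = β
    · subst h; simpa using hχ x
    · simpa [Function.update_of_ne h] using hφ' δ x

/-! ### The completion -/

variable (N)

theorem norm_embed (z : TS V (Finset.univ : Finset D)) : ‖N.embed z‖ = N.nm Finset.univ z :=
  UniformSpace.Completion.norm_coe (E := N.Normed) z

theorem embed_injective : Function.Injective N.embed :=
  (UniformSpace.Completion.toComplₗᵢ (𝕜 := ℝ) (E := N.Normed)).injective

theorem denseRange_embed : DenseRange N.embed :=
  UniformSpace.Completion.denseRange_coe (α := N.Normed)

theorem incl_injective (r : TreeRank D) : Function.Injective (N.incl (V := V) r) := fun _ _ h =>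
  Subtype.ext (N.embed_injective h)

/-- Bounded linear maps extend to the completion. -/
theorem exists_extension {Y : Type*} [NormedAddCommGroup Y] [NormedSpace ℝ Y] [CompleteSpace Y]
    (κ : TS V (Finset.univ : Finset D) →ₗ[ℝ] Y) (h : ∃ c : ℝ, ∀ x, ‖κ x‖ ≤ c * N.nm Finset.univ x) :
    ∃ κ' : N.Ambient →L[ℝ] Y, ∀ z, κ' (N.embed z) = κ z :=
  ⟨κ.extendOfNorm N.embed, fun z => LinearMap.extendOfNorm_eq N.denseRange_embed
    (by simpa only [norm_embed] using h) z⟩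

/-! ### Differentiability of the tree tensor -/

/-- Leaf vectors and coefficients. -/
abbrev _root_.TreeTensor.FrameParams (V : D → Type u₂) [∀ j, NormedAddCommGroup (V j)]
    [∀ j, NormedSpace ℝ (V j)] (T : DimPartTree D) (r : TreeRank D) : Type (max u₁ u₂) :=
  (∀ k : D, Fin (r.rank {k}) → V k) × Coef T r

/-- A leaf vector as a continuous linear function of the parameters. -/
def _root_.TreeTensor.leafProj {r : TreeRank D} (k : D) (i : Fin (r.rank {k})) :
    FrameParams V T r →L[ℝ] V k :=
  (ContinuousLinearMap.proj i).comp
    ((ContinuousLinearMap.proj (R := ℝ) (φ := fun k => Fin (r.rank {k}) → V k) k).comp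
      (ContinuousLinearMap.fst ℝ _ _))

/-- A coefficient as a continuous linear function of the parameters. -/
def _root_.TreeTensor.coefProj {r : TreeRank D} (γ : T.inner) (i : Fin (r.rank γ))
    (idx : ∀ β : T.sons γ, Fin (r.rank β)) : FrameParams V T r →L[ℝ] ℝ :=
  LinearMap.toContinuousLinearMap ((LinearMap.proj idx : (_ → ℝ) →ₗ[ℝ] ℝ) ∘ₗ
    (LinearMap.proj i : (Fin (r.rank γ) → _) →ₗ[ℝ] _) ∘ₗ
      (LinearMap.proj γ : Coef T r →ₗ[ℝ] _)) ∘L ContinuousLinearMap.snd ℝ _ _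

variable {N} {r : TreeRank D}

theorem IsTreeContinuous.exists_merge (hcont : N.IsTreeContinuous) (γ : T.inner) :
    ∃ m : ContinuousMultilinearMap ℝ (fun β : T.sons γ => N.Space ⟨β.1, T.son_mem γ β⟩)
        (N.Space ⟨γ.1, T.inner_mem γ⟩),
      ∀ x : ∀ β : T.sons γ, TS V β.1, m (fun β => N.toSpace ⟨β.1, T.son_mem γ β⟩ (x β)) =
        N.toSpace ⟨γ.1, T.inner_mem γ⟩ (merge V (T.partition_of_inner γ.2) x) := by
  obtain ⟨c, hc⟩ := hcont γ
  exact ⟨MultilinearMap.mkContinuous (((N.toSpace ⟨γ.1, T.inner_mem γ⟩).toLinearMap.compMultilinearMap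
    (merge V (T.partition_of_inner γ.2))).compLinearMap
      fun β => (N.toSpace ⟨β.1, T.son_mem γ β⟩).symm.toLinearMap) c (fun x => hc x), fun x => rfl⟩

variable (N) in
/-- The frame vectors as functions with values in a normed space. -/
def frameMap (α : T.vertices) (i : Fin (r.rank α)) (p : FrameParams V T r) : N.Space α :=
  N.toSpace α (frame p.1 p.2 α.1 i)

variable (N) in
/-- The leaf inclusion as a linear isometry. -/
def leafIsometry (k : D) : V k →ₗᵢ[ℝ] N.Space ⟨{k}, T.singleton_mem k⟩ where
  toLinearMap := (N.toSpace ⟨{k}, T.singleton_mem k⟩).toLinearMap ∘ₗ (leafEquiv V k).toLinearMap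
  norm_map' x := N.nm_leaf k x

theorem frameMap_leaf (k : D) (i : Fin (r.rank {k})) :
    (N.frameMap ⟨{k}, T.singleton_mem k⟩ i : FrameParams V T r → _) =
      fun p => N.leafIsometry k (p.1 k i) := by
  funext p
  rw [frameMap, frame_leaf]
  rfl

theorem frameMap_inner (γ : T.inner)
    {m : ContinuousMultilinearMap ℝ (fun β : T.sons γ => N.Space ⟨β.1, T.son_mem γ β⟩)
        (N.Space ⟨γ.1, T.inner_mem γ⟩)}
    (hm : ∀ x : ∀ β : T.sons γ, TS V β.1, m (fun β => N.toSpace ⟨β.1, T.son_mem γ β⟩ (x β)) =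
        N.toSpace ⟨γ.1, T.inner_mem γ⟩ (merge V (T.partition_of_inner γ.2) x))
    (i : Fin (r.rank γ)) :
    (N.frameMap ⟨γ.1, T.inner_mem γ⟩ i : FrameParams V T r → _) =
      fun p => ∑ idx : (∀ β : T.sons γ, Fin (r.rank β)),
        p.2 γ i idx • m fun β => N.frameMap ⟨β.1, T.son_mem γ β⟩ (idx β) p := by
  funext p
  rw [frameMap, frame_inner, map_sum]
  refine Finset.sum_congr rfl fun idx _ => ?_
  rw [map_smul, ← hm]
  rfl

/-- Bottom-up, each frame vector is a polynomial expression in coefficients and bounded multilinear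
products of the sons' vectors. -/
theorem IsTreeContinuous.contDiff_frameMap (hcont : N.IsTreeContinuous) :
    ∀ α (hα : α ∈ T.vertices) (i : Fin (r.rank α)),
      ContDiff ℝ ω (N.frameMap ⟨α, hα⟩ i : FrameParams V T r → _) := by
  have key := T.bottomUp (p := fun α => ∀ (hα : α ∈ T.vertices) (i : Fin (r.rank α)),
    ContDiff ℝ ω (N.frameMap ⟨α, hα⟩ i : FrameParams V T r → _)) (fun k hk _ i => ?_)
    (fun γ ih _ i => ?_)
  · exact fun α hα i => key α hα hα i
  · rw [frameMap_leaf]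
    exact (N.leafIsometry k).contDiff.comp
      (leafProj k i : FrameParams V T r →L[ℝ] V k).contDiff
  · obtain ⟨m, hm⟩ := hcont.exists_merge γ
    rw [frameMap_inner γ hm]
    refine ContDiff.sum fun idx _ => ContDiff.smul (coefProj γ i idx : FrameParams V T r →L[ℝ] ℝ).contDiff ?_
    exact m.contDiff.comp (contDiff_pi.2 fun β => ih β _ _)

theorem IsTreeContinuous.hasFDerivAt_frameMap (hcont : N.IsTreeContinuous) {α : Finset D}
    (hα : α ∈ T.vertices) (i : Fin (r.rank α)) (p : FrameParams V T r) :
    HasFDerivAt (N.frameMap ⟨α, hα⟩ i) (fderiv ℝ (N.frameMap ⟨α, hα⟩ i) p) p :=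
  ((hcont.contDiff_frameMap α hα i).differentiable (by simp) p).hasFDerivAt

variable (N) in
/-- The derivative of the frame at `p` in direction `d`. -/
def dframe (p d : FrameParams V T r) (α : Finset D) (i : Fin (r.rank α)) : TS V α :=
  if hα : α ∈ T.vertices then
    (N.toSpace ⟨α, hα⟩).symm (fderiv ℝ (N.frameMap ⟨α, hα⟩ i) p d) else 0

theorem dframe_leaf (p d : FrameParams V T r) (k : D) (i : Fin (r.rank {k})) :
    N.dframe p d {k} i = leafEquiv V k (d.1 k i) := by
  rw [dframe, dif_pos (T.singleton_mem k), frameMap_leaf, LinearEquiv.symm_apply_eq]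
  have h1 : HasFDerivAt (fun p : FrameParams V T r => N.leafIsometry k (p.1 k i))
      ((N.leafIsometry k).toContinuousLinearMap.comp (leafProj k i)) p :=
    ((N.leafIsometry k).toContinuousLinearMap.comp (leafProj k i)).hasFDerivAt
  rw [h1.fderiv]
  rfl

theorem IsTreeContinuous.dframe_inner (hcont : N.IsTreeContinuous) (p d : FrameParams V T r)
    (γ : T.inner) (i : Fin (r.rank γ)) :
    N.dframe p d γ.1 i =
      (∑ idx : (∀ β : T.sons γ, Fin (r.rank β)), d.2 γ i idx •
        merge V (T.partition_of_inner γ.2) fun β : T.sons γ => frame p.1 p.2 β.1 (idx β)) +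
      ∑ β : T.sons γ, ∑ idx : (∀ β : T.sons γ, Fin (r.rank β)), p.2 γ i idx •
        merge V (T.partition_of_inner γ.2)
          (Function.update (fun δ : T.sons γ => frame p.1 p.2 δ.1 (idx δ)) β
            (N.dframe p d β.1 (idx β))) := by
  obtain ⟨m, hm⟩ := hcont.exists_merge γ
  rw [dframe, dif_pos (T.inner_mem γ), frameMap_inner γ hm, LinearEquiv.symm_apply_eq]
  have h1 : ∀ idx : (∀ β : T.sons γ, Fin (r.rank β)),
      HasFDerivAt (fun p : FrameParams V T r => p.2 γ i idx) (coefProj γ i idx) p :=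
    fun idx => (coefProj γ i idx : FrameParams V T r →L[ℝ] ℝ).hasFDerivAt
  -- The product rule gives the two sums of the recursion: one differentiates the coefficient, the
  -- other each factor of the product in turn.
  have h2 := fun idx : (∀ β : T.sons γ, Fin (r.rank β)) =>
    (h1 idx).smul (HasFDerivAt.multilinear_comp (f := m) fun β =>
      hcont.hasFDerivAt_frameMap (T.son_mem γ β) (idx β) p)
  have h3 := HasFDerivAt.fun_sum fun idx (_ : idx ∈ Finset.univ) => h2 idx
  refine (congrArg (fun f => f d) (HasFDerivAt.fderiv h3)).trans ?_
  rw [sum_apply, map_add, map_sum, map_sum, add_comm]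
  have h4 : ∀ (β : T.sons γ) (idx : (∀ β : T.sons γ, Fin (r.rank β))),
      m.toContinuousLinearMap (fun δ => N.frameMap ⟨δ.1, T.son_mem γ δ⟩ (idx δ) p) β
        (fderiv ℝ (N.frameMap ⟨β.1, T.son_mem γ β⟩ (idx β)) p d) =
      N.toSpace ⟨γ.1, T.inner_mem γ⟩ (merge V (T.partition_of_inner γ.2)
          (Function.update (fun δ : T.sons γ => frame p.1 p.2 δ.1 (idx δ)) β
            (N.dframe p d β.1 (idx β)))) := by
    intro β idx
    rw [← hm]
    change m _ = m _
    congr 1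
    funext δ
    by_cases h : δ = β
    · subst h
      simp [dframe, T.son_mem γ δ]
    · simp [Function.update_of_ne h, frameMap]
  have h5 : ∀ idx : (∀ β : T.sons γ, Fin (r.rank β)),
      m (fun δ => N.frameMap ⟨δ.1, T.son_mem γ δ⟩ (idx δ) p) = N.toSpace ⟨γ.1, T.inner_mem γ⟩
        (merge V (T.partition_of_inner γ.2) fun β : T.sons γ => frame p.1 p.2 β.1 (idx β)) :=
    fun idx => hm _
  simp only [add_apply, smul_apply,
    sum_apply, ContinuousLinearMap.comp_apply,
    ContinuousLinearMap.smulRight_apply, h4, h5, Finset.sum_add_distrib, map_sum, map_smul]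
  rw [Finset.sum_comm' (t' := Finset.univ) (s' := fun _ => Finset.univ) (by simp)]
  simp only [Finset.smul_sum]
  rfl

theorem IsTreeContinuous.isTangentFamily_dframe (hcont : N.IsTreeContinuous)
    {W : ∀ k, Submodule ℝ (V k)} (p : FrameParams V T r) {d : FrameParams V T r}
    (hd : ∀ k i, d.1 k i ∈ W k) : IsTangentFamily p.1 p.2 W (N.dframe p d) :=
  ⟨fun k i => ⟨_, hd k i, dframe_leaf p d k i⟩, d.2, hcont.dframe_inner p d⟩

/-- A tangent family is determined at the vertices by its leaf vectors and its coefficients `C'`,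
because `dframe` satisfies the same recursion. -/
theorem IsTreeContinuous.exists_eq_dframe (hcont : N.IsTreeContinuous)
    {W : ∀ k, Submodule ℝ (V k)} {p : FrameParams V T r} {w : ∀ α, Fin (r.rank α) → TS V α}
    (hw : IsTangentFamily p.1 p.2 W w) :
    ∃ d : FrameParams V T r, (∀ k i, d.1 k i ∈ W k) ∧
      ∀ α ∈ T.vertices, ∀ i, w α i = N.dframe p d α i := by
  obtain ⟨hl, C', hC'⟩ := hw
  choose y hy hwy using hl
  refine ⟨(y, C'), hy, T.bottomUp (fun k _ i => ?_) (fun γ ih i => ?_)⟩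
  · rw [hwy, dframe_leaf]
  · rw [hC', hcont.dframe_inner]
    simp only [ih]

variable (N) in
/-- The tree tensor as a map into the completion. -/
def treeMap (p : FrameParams V T r) : N.Ambient := N.embed (treeTensor p.1 p.2)

variable (N) in
/-- The embedding of `(V_D, ‖·‖_D)` into the completion. -/
def rootEmbed : N.Space ⟨Finset.univ, T.root_mem⟩ →L[ℝ] N.Ambient :=
  LinearMap.mkContinuous (N.embed ∘ₗ (N.toSpace ⟨Finset.univ, T.root_mem⟩).symm.toLinearMap) 1
    (fun x => by
      rw [one_mul]
      exact (N.norm_embed _).le)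

theorem treeMap_eq : (N.treeMap : FrameParams V T r → N.Ambient) =
    N.rootEmbed ∘ N.frameMap ⟨Finset.univ, T.root_mem⟩ r.rootIndex := rfl

theorem IsTreeContinuous.contDiff_treeMap (hcont : N.IsTreeContinuous) :
    ContDiff ℝ ω (N.treeMap : FrameParams V T r → N.Ambient) :=
  N.rootEmbed.contDiff.comp (hcont.contDiff_frameMap _ T.root_mem r.rootIndex)

theorem IsTreeContinuous.hasFDerivAt_treeMap (hcont : N.IsTreeContinuous)
    (p : FrameParams V T r) : HasFDerivAt N.treeMap (fderiv ℝ N.treeMap p) p :=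
  ((hcont.contDiff_treeMap).differentiable (by simp) p).hasFDerivAt

theorem IsTreeContinuous.fderiv_treeMap (hcont : N.IsTreeContinuous) (p d : FrameParams V T r) :
    fderiv ℝ N.treeMap p d = N.embed (N.dframe p d Finset.univ r.rootIndex) := by
  have h1 := (N.rootEmbed.hasFDerivAt).comp p (hcont.hasFDerivAt_frameMap T.root_mem r.rootIndex p)
  rw [treeMap_eq, h1.fderiv, dframe, dif_pos T.root_mem]
  rfl

theorem IsTreeContinuous.mem_map_tangentZ_iff (hcont : N.IsTreeContinuous)
    (W : ∀ k, Submodule ℝ (V k)) (p : FrameParams V T r) (z : N.Ambient) :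
    z ∈ (tangentZ p.1 p.2 W).map N.embed ↔
      ∃ d : FrameParams V T r, (∀ k i, d.1 k i ∈ W k) ∧ fderiv ℝ N.treeMap p d = z := by
  constructor
  · rintro ⟨_, ⟨w, hw, rfl⟩, rfl⟩
    obtain ⟨d, hd, hwd⟩ := hcont.exists_eq_dframe hw
    exact ⟨d, hd, by rw [hcont.fderiv_treeMap, ← hwd _ T.root_mem]⟩
  · rintro ⟨d, hd, rfl⟩
    exact ⟨_, ⟨_, hcont.isTangentFamily_dframe p hd, rfl⟩, (hcont.fderiv_treeMap p d).symm⟩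

end TreeNorms

end Norms

end TreeTensor

end

/-! ### Dual frames and gauges -/

noncomputable section

namespace TreeTensor

open Module

section Algebra

variable {D : Type u₁} [Fintype D] [DecidableEq D] {V : D → Type u₂} [∀ j, AddCommGroup (V j)]
  [∀ j, Module ℝ (V j)] {T : DimPartTree D} {r : TreeRank D}

variable (T r) in
/-- Candidates for right inverses of the coefficient tensors `C^(γ)`, viewed as matrices with rows
indexed by `i_γ`. -/
abbrev DualCoef : Type u₁ :=
  ∀ γ : T.inner, Matrix (∀ β : T.sons γ, Fin (r.rank β)) (Fin (r.rank γ)) ℝ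

/-- Functionals on the spaces `V_α`, obtained from functionals on the `V_k` and from coefficients in
the same way as the frame vectors. -/
def dualFrame (φ : ∀ k : D, Fin (r.rank {k}) → Dual ℝ (V k)) (A : DualCoef T r) (α : Finset D) :
    Fin (r.rank α) → Dual ℝ (TS V α) :=
  if h : α ∈ T.inner then fun j =>
    ∑ idx : (∀ β : T.sons α, Fin (r.rank β)), A ⟨α, h⟩ idx j •
      dualT (T.partition_of_inner h) fun β : T.sons α => dualFrame φ A β.1 (idx β)
  else if h : ∃ k, {k} = α then
    h.choose_spec ▸ fun j => φ h.choose j ∘ₗ (leafEquiv V h.choose).symm.toLinearMap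
  else 0
termination_by α.card
decreasing_by exact T.card_lt_of_mem_sons h β.2

variable {φ : ∀ k : D, Fin (r.rank {k}) → Dual ℝ (V k)} {A : DualCoef T r}

theorem dualFrame_inner (γ : T.inner) (j : Fin (r.rank γ)) :
    dualFrame φ A γ.1 j = ∑ idx : (∀ β : T.sons γ, Fin (r.rank β)), A γ idx j •
      dualT (T.partition_of_inner γ.2) fun β : T.sons γ => dualFrame φ A β.1 (idx β) := by
  rw [dualFrame, dif_pos γ.2]

theorem dualFrame_leaf (k : D) (j : Fin (r.rank {k})) (y : V k) :
    dualFrame φ A {k} j (leafEquiv V k y) = φ k j y := by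
  have h2 : ∃ k', ({k'} : Finset D) = {k} := ⟨k, rfl⟩
  rw [dualFrame, dif_neg (T.singleton_notMem_inner k), dif_pos h2]
  have gen : ∀ (k' : D) (hk : ({k'} : Finset D) = {k}),
      (hk ▸ (fun j => φ k' j ∘ₗ (leafEquiv V k').symm.toLinearMap) :
        Fin (r.rank {k}) → Dual ℝ (TS V {k})) =
        fun j => φ k j ∘ₗ (leafEquiv V k).symm.toLinearMap := by
    intro k' hk
    obtain rfl := Finset.singleton_injective hk
    rfl
  rw [congrFun (gen _ h2.choose_spec) j]
  simp

variable {x : ∀ k : D, Fin (r.rank {k}) → V k} {C : Coef T r}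

theorem dualFrame_frame_inner (γ : T.inner)
    (h : ∀ (β : T.sons γ) j i, dualFrame φ A β.1 j (frame x C β i) = if i = j then 1 else 0)
    (j i : Fin (r.rank γ)) :
    dualFrame φ A γ.1 j (frame x C γ i) = (Matrix.of (C γ) * A γ) i j := by
  rw [dualFrame_inner, LinearMap.sum_apply, Matrix.mul_apply]
  refine Finset.sum_congr rfl fun idx _ => ?_
  rw [LinearMap.smul_apply, dualT_frame γ h, smul_eq_mul, mul_comm]
  rfl

/-- The coefficients are normalised with respect to `A`. -/
def Normalized (A : DualCoef T r) (C : Coef T r) : Prop :=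
  ∀ γ : T.inner, γ.1 ≠ Finset.univ → Matrix.of (C γ) * A γ = 1

/-- At an inner vertex the matrix of pairings is `C γ * A γ` once the sons are biorthogonal, so
normalisation propagates biorthogonality upwards. -/
theorem dualFrame_frame (hx : ∀ k j i, φ k j (x k i) = if i = j then 1 else 0)
    (hC : Normalized A C) : ∀ α ∈ T.vertices, α ≠ Finset.univ →
      ∀ j i, dualFrame φ A α j (frame x C α i) = if i = j then 1 else 0 := by
  refine T.bottomUp (fun k _ _ j i => ?_) (fun γ ih hγ j i => ?_)
  · rw [frame_leaf, dualFrame_leaf, hx]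
  · rw [dualFrame_frame_inner γ fun β => ih β (T.son_ne_univ γ β), hC γ hγ, Matrix.one_apply]

theorem normalized_of_dualFrame (h : ∀ α ∈ T.vertices, α ≠ Finset.univ →
      ∀ j i, dualFrame φ A α j (frame x C α i) = if i = j then 1 else 0) : Normalized A C := by
  intro γ hγ
  ext i j
  rw [← dualFrame_frame_inner γ fun β => h β (T.son_mem γ β) (T.son_ne_univ γ β),
    h γ (T.inner_mem γ) hγ, Matrix.one_apply]

/-- A complement is described by a biorthogonal family of functionals. -/
theorem isCompl_span_of_dual {ι M : Type*} [Fintype ι] [DecidableEq ι] [AddCommGroup M]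
    [Module ℝ M] {n : ι → M} {ψ : ι → Dual ℝ M} {W : Submodule ℝ M}
    (h : ∀ j i, ψ j (n i) = if i = j then 1 else 0) (hW : ∀ y, y ∈ W ↔ ∀ j, ψ j y = 0) :
    IsCompl (Submodule.span ℝ (Set.range n)) W := by
  constructor
  · rw [Submodule.disjoint_def]
    intro y hy hyW
    obtain ⟨c, rfl⟩ := (Submodule.mem_span_range_iff_exists_fun ℝ).1 hy
    have h1 : ∀ j, c j = 0 := fun j => by simpa [h] using (hW _).1 hyW j
    simp [h1]
  · rw [codisjoint_iff, Submodule.eq_top_iff']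
    intro y
    refine Submodule.mem_sup.2 ⟨∑ i, ψ i y • n i, ?_, y - ∑ i, ψ i y • n i, ?_, by simp⟩
    · exact Submodule.sum_mem _ fun i _ =>
        Submodule.smul_mem _ _ (Submodule.subset_span (Set.mem_range_self i))
    · exact (hW _).2 fun j => by simp [h]

end Algebra

section Norms

variable {D : Type u₁} [Fintype D] [DecidableEq D] {V : D → Type u₂}
  [∀ j, NormedAddCommGroup (V j)] [∀ j, NormedSpace ℝ (V j)] {T : DimPartTree D} {r : TreeRank D}

namespace TreeNorms

variable {N : TreeNorms T V}

theorem DominatesInjective.boundedDual_dualFrame (hinj : N.DominatesInjective)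
    (φ : ∀ k : D, Fin (r.rank {k}) → V k →L[ℝ] ℝ) (A : DualCoef T r) :
    ∀ α ∈ T.vertices, ∀ j,
      N.BoundedDual α (dualFrame (fun k j => (φ k j : V k →ₗ[ℝ] ℝ)) A α j) := by
  refine T.bottomUp (fun k _ j => ?_) (fun γ ih j => ?_)
  · refine ⟨‖φ k j‖, fun y => ?_⟩
    obtain ⟨y, rfl⟩ := (leafEquiv V k).surjective y
    rw [dualFrame_leaf, N.nm_leaf]
    exact (φ k j).le_opNorm y
  · rw [dualFrame_inner]
    exact BoundedDual.sum _ fun idx => hinj.boundedDual_dualT γ fun β => ih β _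

/-- The frame vectors of a tree tensor are bounded linear functions of the tensor. -/
theorem DominatesInjective.exists_contraction (hinj : N.DominatesInjective)
    {x : ∀ k : D, Fin (r.rank {k}) → V k} {C : Coef T r} (hC : C.FullRank)
    {φ : ∀ k : D, Fin (r.rank {k}) → V k →L[ℝ] ℝ} {A : DualCoef T r}
    (hx : ∀ k j i, φ k j (x k i) = if i = j then 1 else 0) (hA : Normalized A C) :
    ∀ α ∈ T.vertices, ∃ κ : Fin (r.rank α) → TS V Finset.univ →ₗ[ℝ] TS V α,
      (∀ i, N.BoundedMap (κ i)) ∧ (∀ i w, κ i w ∈ Umin V α w) ∧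
      (∀ i, κ i (treeTensor x C) = frame x C α i) ∧
      ∀ (h : α = Finset.univ) (i w), h ▸ κ i w = w := by
  refine T.topDown ⟨fun _ => LinearMap.id, fun _ => ⟨1, fun x => by simp⟩, fun _ w =>
    mem_Umin_univ w, fun i => (frame_univ x C i).symm, fun _ _ _ => rfl⟩ ?_
  rintro γ ⟨κ, hb, hm, hκ, -⟩ β
  obtain ⟨B, hB⟩ := exists_rightInverse ((hC γ).2 β)
  have hψ := fun δ : T.sons γ => dualFrame_frame hx hA δ (T.son_mem γ δ) (T.son_ne_univ γ δ)
  set ψ := fun δ : T.sons γ => dualFrame (fun k j => (φ k j : V k →ₗ[ℝ] ℝ)) A δ.1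
  -- The formula `frame_son_eq` for the fixed pair `x`, `C` is turned into an operator on all
  -- tensors: it uses only the bounded dual frame, the constants `B` and the father's maps.
  refine ⟨fun j => ∑ p, B p j • (contr (T.partition_of_inner γ.2) β (fun δ =>
    ψ δ ((Equiv.piSplitAt β fun δ : T.sons γ => Fin (r.rank δ)).symm (j, p.2) δ)) ∘ₗ κ p.1),
    fun j => ?_, fun j w => ?_, fun j => ?_, fun h => absurd h (T.son_ne_univ γ β)⟩
  · refine BoundedMap.sum (fun p => B p j) fun p => BoundedMap.comp ?_ (hb p.1)
    exact hinj.boundedMap_contr γ β fun δ => hinj.boundedDual_dualFrame φ A δ.1 (T.son_mem γ δ) _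
  · simp only [LinearMap.sum_apply, LinearMap.smul_apply, LinearMap.comp_apply]
    refine Submodule.sum_mem _ fun p _ => Submodule.smul_mem _ _ ?_
    exact contr_mem_Umin (T.partition_of_inner γ.2) β _ (hm p.1 w)
  · rw [frame_son_eq γ β hψ hB j, LinearMap.sum_apply]
    refine Finset.sum_congr rfl fun p _ => ?_
    rw [LinearMap.smul_apply, LinearMap.comp_apply, hκ]

/-- Linear functionals and maps which normalise the representations of tensors near
`treeTensor x C`. -/
structure Gauge (N : TreeNorms T V) (W : ∀ k, Submodule ℝ (V k))
    (x : ∀ k : D, Fin (r.rank {k}) → V k) (C : Coef T r) where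
  φ : ∀ k : D, Fin (r.rank {k}) → V k →L[ℝ] ℝ
  φ_x : ∀ k j i, φ k j (x k i) = if i = j then 1 else 0
  mem_W : ∀ k y, y ∈ W k ↔ ∀ j, φ k j y = 0
  A : DualCoef T r
  mul_A : ∀ γ, Matrix.of (C γ) * A γ = 1
  κ : ∀ α : Finset D, Fin (r.rank α) → TS V Finset.univ →ₗ[ℝ] TS V α
  κ_univ : ∀ i w, κ Finset.univ i w = w
  κ_mem : ∀ α ∈ T.vertices, ∀ i w, κ α i w ∈ Umin V α w
  κ_treeTensor : ∀ α ∈ T.vertices, ∀ i, κ α i (treeTensor x C) = frame x C α i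
  pair : ∀ α : Finset D, Fin (r.rank α) → Fin (r.rank α) → N.Ambient →L[ℝ] ℝ
  pair_embed : ∀ α ∈ T.vertices, ∀ j i w, pair α j i (N.embed w) =
    dualFrame (fun k j => (φ k j : V k →ₗ[ℝ] ℝ)) A α j (κ α i w)
  leaf : ∀ k : D, Fin (r.rank {k}) → N.Ambient →L[ℝ] V k
  leaf_embed : ∀ k i w, leafEquiv V k (leaf k i (N.embed w)) = κ {k} i w
  coef : ∀ γ : T.inner, Fin (r.rank γ) → (∀ β : T.sons γ, Fin (r.rank β)) → N.Ambient →L[ℝ] ℝ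
  coef_embed : ∀ γ i idx w, coef γ i idx (N.embed w) = dualT (T.partition_of_inner γ.2)
    (fun β => dualFrame (fun k j => (φ k j : V k →ₗ[ℝ] ℝ)) A β.1 (idx β)) (κ γ i w)
  projW : ∀ k, V k →L[ℝ] W k
  projW_eq : ∀ k (y : W k), projW k y = y

/-- In a Banach space closed complements are topological complements, which gives continuous `φ` and
projections onto `W`. Every functional or map read off the tensor is bounded for `‖·‖_D` and extends
to the completion. -/
theorem exists_gauge [∀ j, CompleteSpace (V j)] (hinj : N.DominatesInjective)
    {W : ∀ k, Submodule ℝ (V k)} (hW : ∀ k, IsClosed (W k : Set (V k)))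
    {x : ∀ k : D, Fin (r.rank {k}) → V k} (hx : ∀ k, LinearIndependent ℝ (x k))
    (hxW : ∀ k, IsCompl (Submodule.span ℝ (Set.range (x k))) (W k))
    {C : Coef T r} (hC : C.FullRank) : Nonempty (N.Gauge W x C) := by
  have hfin : ∀ k, FiniteDimensional ℝ (Submodule.span ℝ (Set.range (x k))) :=
    fun k => FiniteDimensional.span_of_finite ℝ (Set.finite_range _)
  have htop := fun k => Submodule.IsCompl.isTopCompl_of_isClosed (hxW k)
    (Submodule.closed_of_finiteDimensional _) (hW k)
  let φ : ∀ k : D, Fin (r.rank {k}) → V k →L[ℝ] ℝ := fun k j =>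
    (LinearMap.toContinuousLinearMap ((Basis.span (hx k)).coord j)).comp
      ((Submodule.span ℝ (Set.range (x k))).projectionOntoL (W k) (htop k))
  have hφx : ∀ k j i, φ k j (x k i) = if i = j then 1 else 0 := by
    intro k j i
    have h1 : (Basis.span (hx k) i : V k) = x k i := congrArg Subtype.val (Basis.span_apply (hx k) i)
    change (Basis.span (hx k)).coord j _ = _
    rw [← h1, ContinuousLinearMap.coe_coe, Submodule.projectionOntoL_apply_left (htop k),
      Basis.coord_apply, Basis.repr_self, Finsupp.single_apply]
  have hmem : ∀ k y, y ∈ W k ↔ ∀ j, φ k j y = 0 := by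
    intro k y
    rw [← Submodule.projectionOntoL_apply_eq_zero_iff (htop k),
      (Basis.span (hx k)).ext_elem_iff]
    simp [φ]
  choose A hA using fun γ => exists_rightInverse (hC γ).1
  have hnorm : Normalized A C := fun γ _ => hA γ
  have hκ : ∀ α, ∃ κ : Fin (r.rank α) → TS V Finset.univ →ₗ[ℝ] TS V α, α ∈ T.vertices →
      (∀ i, N.BoundedMap (κ i)) ∧ (∀ i w, κ i w ∈ Umin V α w) ∧
      (∀ i, κ i (treeTensor x C) = frame x C α i) ∧
      ∀ (h : α = Finset.univ) (i w), h ▸ κ i w = w := by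
    intro α
    by_cases h : α ∈ T.vertices
    · obtain ⟨κ, hκ⟩ := hinj.exists_contraction hC hφx hnorm α h
      exact ⟨κ, fun _ => hκ⟩
    · exact ⟨0, fun h' => absurd h' h⟩
  choose κ hκ using hκ
  have hpair : ∀ (α) (j i : Fin (r.rank α)), ∃ p : N.Ambient →L[ℝ] ℝ, α ∈ T.vertices → ∀ w,
      p (N.embed w) = dualFrame (fun k j => (φ k j : V k →ₗ[ℝ] ℝ)) A α j (κ α i w) := by
    intro α j i
    by_cases h : α ∈ T.vertices
    · obtain ⟨p, hp⟩ := N.exists_extension (dualFrame (fun k j => (φ k j : V k →ₗ[ℝ] ℝ)) A α j ∘ₗ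
        κ α i) ((hinj.boundedDual_dualFrame φ A α h j).comp ((hκ α h).1 i))
      exact ⟨p, fun _ => hp⟩
    · exact ⟨0, fun h' => absurd h' h⟩
  choose pair hpair using hpair
  have hleaf : ∀ (k : D) (i : Fin (r.rank {k})), ∃ p : N.Ambient →L[ℝ] V k, ∀ w,
      p (N.embed w) = (leafEquiv V k).symm (κ {k} i w) := by
    intro k i
    refine N.exists_extension ((leafEquiv V k).symm.toLinearMap ∘ₗ κ {k} i) ?_
    obtain ⟨c, hc⟩ := (hκ _ (T.singleton_mem k)).1 i
    refine ⟨c, fun w => le_of_eq_of_le ?_ (hc w)⟩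
    rw [← N.nm_leaf]
    simp
  choose leaf hleaf using hleaf
  choose coef hcoef using fun (γ : T.inner) i (idx : ∀ β : T.sons γ, Fin (r.rank β)) =>
    N.exists_extension (dualT (T.partition_of_inner γ.2)
      (fun β => dualFrame (fun k j => (φ k j : V k →ₗ[ℝ] ℝ)) A β.1 (idx β)) ∘ₗ κ γ i)
      ((hinj.boundedDual_dualT γ fun β =>
        hinj.boundedDual_dualFrame φ A β.1 (T.son_mem γ β) (idx β)).comp
        ((hκ γ (T.inner_mem γ)).1 i))
  exact ⟨{
    φ := φ
    φ_x := hφx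
    mem_W := hmem
    A := A
    mul_A := hA
    κ := κ
    κ_univ := fun i w => (hκ _ T.root_mem).2.2.2 rfl i w
    κ_mem := fun α hα => (hκ α hα).2.1
    κ_treeTensor := fun α hα => (hκ α hα).2.2.1
    pair := pair
    pair_embed := fun α hα j i => hpair α j i hα
    leaf := leaf
    leaf_embed := fun k i w => by rw [hleaf, LinearEquiv.apply_symm_apply]
    coef := coef
    coef_embed := hcoef
    projW := fun k => (W k).projectionOntoL _ (htop k).symm
    projW_eq := fun k y => Submodule.projectionOntoL_apply_left _ _ }⟩

end TreeNorms

end Norms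

end TreeTensor

end

noncomputable section

namespace TreeTensor

open Module

/-! ### Analyticity of the inverse of a matrix -/

theorem contDiff_det {X n : Type*} [NormedAddCommGroup X] [NormedSpace ℝ X] [Fintype n]
    [DecidableEq n] {M : X → Matrix n n ℝ} (hM : ∀ i j, ContDiff ℝ ω fun y => M y i j) :
    ContDiff ℝ ω fun y => (M y).det := by
  simp only [Matrix.det_apply]
  refine ContDiff.sum fun σ _ => ?_
  exact (contDiff_prod fun i _ => hM (σ i) i).const_smul _

/-- Cramer's rule: determinant and adjugate are polynomial in the entries. -/
theorem contDiffOn_inv_apply {X n : Type*} [NormedAddCommGroup X] [NormedSpace ℝ X] [Fintype n]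
    [DecidableEq n] {M : X → Matrix n n ℝ} (hM : ∀ i j, ContDiff ℝ ω fun y => M y i j) (i j : n) :
    ContDiffOn ℝ ω (fun y => (M y)⁻¹ i j) {y | (M y).det ≠ 0} := by
  simp only [Matrix.inv_def, Ring.inverse_eq_inv', Matrix.smul_apply, Matrix.adjugate_apply,
    smul_eq_mul]
  refine ContDiffOn.mul ((contDiff_det hM).contDiffOn.inv fun y hy => hy)
    (contDiff_det fun a b => ?_).contDiffOn
  by_cases h : a = j
  · subst h
    simpa using contDiff_const
  · simpa [Matrix.updateRow_ne h] using hM a b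

/-! ### The local retraction onto normalised representations -/

namespace TreeNorms.Gauge

variable {D : Type u₁} [Fintype D] [DecidableEq D] {V : D → Type u₂}
  [∀ j, NormedAddCommGroup (V j)] [∀ j, NormedSpace ℝ (V j)] {T : DimPartTree D} {r : TreeRank D}
  {N : TreeNorms T V} {W : ∀ k, Submodule ℝ (V k)} {x : ∀ k : D, Fin (r.rank {k}) → V k}
  {C : Coef T r} (g : N.Gauge W x C)

/-- The directions tangent to the normalised coefficients. -/
def _root_.TreeTensor.DualCoef.annihilator (A : DualCoef T r) : Submodule ℝ (Coef T r) where
  carrier := {C' | ∀ γ : T.inner, γ.1 ≠ Finset.univ → Matrix.of (C' γ) * A γ = 0}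
  zero_mem' := fun γ _ => Matrix.zero_mul (A γ)
  add_mem' := fun {a b} ha hb γ hγ => by
    have h1 := Matrix.add_mul (Matrix.of (a γ)) (Matrix.of (b γ)) (A γ)
    rw [ha γ hγ, hb γ hγ, add_zero] at h1
    exact h1
  smul_mem' := fun c a ha γ hγ => by
    have h1 := Matrix.smul_mul c (Matrix.of (a γ)) (A γ)
    rw [ha γ hγ, smul_zero] at h1
    exact h1

variable (W) in
/-- The parameters of normalised representations. -/
abbrev _root_.TreeTensor.DualCoef.Model (A : DualCoef T r) : Type (max u₁ u₂) :=
  (∀ k : D, Fin (r.rank {k}) → W k) × A.annihilator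

/-- The matrix of the vectors `κ^(α)_i(y)` with respect to the dual frame. -/
def mat (α : Finset D) (y : N.Ambient) : Matrix (Fin (r.rank α)) (Fin (r.rank α)) ℝ :=
  -- At the root `κ` is the identity and the coefficients are not normalised, so no correction is
  -- made.
  if α = Finset.univ then 1 else Matrix.of fun j i => g.pair α j i y

theorem contDiff_mat (α : Finset D) (j i : Fin (r.rank α)) :
    ContDiff ℝ ω fun y => g.mat α y j i := by
  by_cases h : α = Finset.univ
  · simpa [mat, h] using contDiff_const
  · simpa [mat, h] using (g.pair α j i).contDiff

/-- The tensors near which normalised representations are constructed. -/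
def domain : Set N.Ambient := {y | ∀ α ∈ T.vertices, (g.mat α y).det ≠ 0}

theorem isOpen_domain : IsOpen g.domain := by
  have : g.domain = ⋂ α ∈ T.vertices, {y | (g.mat α y).det ≠ 0} := by
    ext y; simp [domain]
  rw [this]
  exact isOpen_biInter_finset fun α _ =>
    isOpen_ne_fun (contDiff_det (g.contDiff_mat α)).continuous continuous_const

/-- The representation with given parameters. -/
def toParams (e : g.A.Model W) : FrameParams V T r :=
  (fun k i => x k i + (e.1 k i : V k), C + (e.2 : Coef T r))

theorem contDiff_toParams : ContDiff ℝ ω g.toParams := by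
  refine ContDiff.prodMk ?_ ?_
  · refine contDiff_pi.2 fun k => contDiff_pi.2 fun i => contDiff_const.add ?_
    exact ((W k).subtypeL.comp ((ContinuousLinearMap.proj i).comp
      ((ContinuousLinearMap.proj (R := ℝ) (φ := fun k => Fin (r.rank {k}) → W k) k).comp
        (ContinuousLinearMap.fst ℝ _ g.A.annihilator)))).contDiff
  · refine contDiff_const.add ?_
    exact (g.A.annihilator.subtypeL.comp (ContinuousLinearMap.snd ℝ
      (∀ k : D, Fin (r.rank {k}) → W k) g.A.annihilator)).contDiff

/-- A projection onto the directions tangent to the normalised coefficients. -/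
def projK : Coef T r →L[ℝ] g.A.annihilator :=
  (Submodule.ClosedComplemented.of_finiteDimensional g.A.annihilator).choose

theorem projK_eq (C' : g.A.annihilator) : g.projK C' = C' :=
  (Submodule.ClosedComplemented.of_finiteDimensional g.A.annihilator).choose_spec C'

/-- The parameters of the normalised representation of a tensor. -/
def retract (y : N.Ambient) : g.A.Model W :=
  -- The two projections only force values in the model space at arbitrary points of the completion;
  -- on normalised representations their arguments already lie in `W k` and in the annihilator.
  (fun k i => g.projW k (∑ l, (g.mat {k} y)⁻¹ l i • g.leaf k l y - x k i),
    g.projK fun γ i idx => ∑ l, (g.mat γ y)⁻¹ l i • g.coef γ l idx y - C γ i idx)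

theorem contDiffOn_retract : ContDiffOn ℝ ω g.retract g.domain := by
  have h1 : ∀ α ∈ T.vertices, ∀ l i,
      ContDiffOn ℝ ω (fun y => (g.mat α y)⁻¹ l i) g.domain := fun α hα l i =>
    (contDiffOn_inv_apply (g.contDiff_mat α) l i).mono fun y hy => hy α hα
  refine ContDiffOn.prodMk ?_ ?_
  · refine contDiffOn_pi.2 fun k => contDiffOn_pi.2 fun i => (g.projW k).contDiff.comp_contDiffOn ?_
    refine ContDiffOn.sub (ContDiffOn.sum fun l _ => ?_) contDiffOn_const
    exact (h1 _ (T.singleton_mem k) l i).smul (g.leaf k l).contDiff.contDiffOn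
  · refine g.projK.contDiff.comp_contDiffOn ?_
    refine contDiffOn_pi.2 fun γ => contDiffOn_pi.2 fun i => contDiffOn_pi.2 fun idx => ?_
    refine ContDiffOn.sub (ContDiffOn.sum fun l _ => ?_) contDiffOn_const
    exact (h1 _ (T.inner_mem γ) l i).smul (g.coef γ l idx).contDiff.contDiffOn

/-- The frame vector at `α` as read off from the tensor. -/
def vec (α : Finset D) (i : Fin (r.rank α)) (w : TS V (Finset.univ : Finset D)) : TS V α :=
  ∑ l, (g.mat α (N.embed w))⁻¹ l i • g.κ α l w

theorem vec_univ (i : Fin (r.rank Finset.univ)) (w : TS V (Finset.univ : Finset D)) :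
    g.vec Finset.univ i w = w := by
  simp only [vec, mat, if_true, inv_one, g.κ_univ, ← Finset.sum_smul]
  rw [Finset.sum_eq_single i (by simp [Subsingleton.elim _ i]) (by simp)]
  simp

theorem vec_mem {α : Finset D} (hα : α ∈ T.vertices) (i : Fin (r.rank α))
    (w : TS V (Finset.univ : Finset D)) : g.vec α i w ∈ Umin V α w :=
  Submodule.sum_mem _ fun l _ => Submodule.smul_mem _ _ (g.κ_mem α hα l w)

theorem dualFrame_κ {α : Finset D} (hα : α ∈ T.vertices) (h : α ≠ Finset.univ)
    (j i : Fin (r.rank α)) (w : TS V (Finset.univ : Finset D)) :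
    dualFrame (fun k j => (g.φ k j : V k →ₗ[ℝ] ℝ)) g.A α j (g.κ α i w) =
      g.mat α (N.embed w) j i := by
  rw [mat, if_neg h, Matrix.of_apply, g.pair_embed α hα]

theorem dualFrame_vec {α : Finset D} (hα : α ∈ T.vertices) (h : α ≠ Finset.univ)
    {w : TS V (Finset.univ : Finset D)} (hw : N.embed w ∈ g.domain) (j i : Fin (r.rank α)) :
    dualFrame (fun k j => (g.φ k j : V k →ₗ[ℝ] ℝ)) g.A α j (g.vec α i w) =
      if i = j then 1 else 0 := by
  have h1 : (g.mat α (N.embed w) * (g.mat α (N.embed w))⁻¹) j i = if i = j then 1 else 0 := by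
    rw [Matrix.mul_nonsing_inv _ (isUnit_iff_ne_zero.2 (hw α hα)), Matrix.one_apply]
    simp only [eq_comm]
  rw [← h1, vec, map_sum, Matrix.mul_apply]
  refine Finset.sum_congr rfl fun l _ => ?_
  rw [map_smul, g.dualFrame_κ hα h, smul_eq_mul, mul_comm]

section Normalised

variable {x' : ∀ k : D, Fin (r.rank {k}) → V k} {C' : Coef T r}

theorem linearIndependent (hx' : ∀ k j i, g.φ k j (x' k i) = if i = j then 1 else 0) (k : D) :
    LinearIndependent ℝ (x' k) :=
  linearIndependent_of_dual (ψ := fun j => (g.φ k j : V k →ₗ[ℝ] ℝ)) (hx' k)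

/-- Below the root, both families lie in the same minimal subspace, which the frame spans, and both
are biorthogonal to the dual frame; hence they agree. -/
theorem vec_treeTensor (hx' : ∀ k j i, g.φ k j (x' k i) = if i = j then 1 else 0)
    (hC' : C'.FullRank) (hA : Normalized g.A C') (hw : N.embed (treeTensor x' C') ∈ g.domain) :
    ∀ α ∈ T.vertices, ∀ i, g.vec α i (treeTensor x' C') = frame x' C' α i := by
  intro α hα i
  by_cases h : α = Finset.univ
  · subst h
    rw [vec_univ, frame_univ]
  · have h1 := dualFrame_frame (φ := fun k j => (g.φ k j : V k →ₗ[ℝ] ℝ)) hx' hA α hα h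
    have h2 := g.vec_mem hα i (treeTensor x' C')
    rw [Umin_treeTensor (g.linearIndependent hx') hC' α hα] at h2
    obtain ⟨c, hc⟩ := (Submodule.mem_span_range_iff_exists_fun ℝ).1 h2
    have h3 : ∀ j, c j = if i = j then 1 else 0 := by
      intro j
      rw [← g.dualFrame_vec hα h hw, ← hc, map_sum]
      simp [h1]
    rw [← hc]
    simp [h3]

theorem retract_treeTensor (hx' : ∀ k j i, g.φ k j (x' k i) = if i = j then 1 else 0)
    (hC' : C'.FullRank) (hA : Normalized g.A C') (hw : N.embed (treeTensor x' C') ∈ g.domain) :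
    g.retract (N.embed (treeTensor x' C')) =
      (fun k i => g.projW k (x' k i - x k i), g.projK (C' - C)) := by
  have hv := g.vec_treeTensor hx' hC' hA hw
  refine Prod.ext ?_ ?_
  · funext k i
    change g.projW k _ = _
    congr 2
    apply (leafEquiv V k).injective
    rw [← frame_leaf x' C' k i, ← hv _ (T.singleton_mem k), map_sum]
    simp only [map_smul, g.leaf_embed]
    rfl
  · change g.projK _ = _
    congr 1
    funext γ i idx
    change _ = C' γ i idx - C γ i idx
    congr 1
    rw [← dualT_frame γ (fun δ => dualFrame_frame (φ := fun k j => (g.φ k j : V k →ₗ[ℝ] ℝ)) hx' hA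
      δ (T.son_mem γ δ) (T.son_ne_univ γ δ)) i idx, ← hv _ (T.inner_mem γ), vec, map_sum]
    simp only [map_smul, g.coef_embed]

end Normalised

theorem φ_toParams (e : g.A.Model W) (k : D) (j i : Fin (r.rank {k})) :
    g.φ k j ((g.toParams e).1 k i) = if i = j then 1 else 0 := by
  rw [toParams, map_add, g.φ_x, (g.mem_W k _).1 (e.1 k i).2, add_zero]

theorem normalized_toParams (e : g.A.Model W) : Normalized g.A (g.toParams e).2 := by
  intro γ hγ
  have h1 := Matrix.add_mul (Matrix.of (C γ)) (Matrix.of ((e.2 : Coef T r) γ)) (g.A γ)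
  rw [g.mul_A, e.2.2 γ hγ, add_zero] at h1
  exact h1

theorem retract_treeMap (e : g.A.Model W) (hC : (g.toParams e).2.FullRank)
    (he : N.treeMap (g.toParams e) ∈ g.domain) : g.retract (N.treeMap (g.toParams e)) = e := by
  rw [treeMap, g.retract_treeTensor (g.φ_toParams e) hC (g.normalized_toParams e) he]
  refine Prod.ext ?_ ?_
  · funext k i
    simp [toParams, g.projW_eq]
  · simp [toParams, g.projK_eq]

/-- Normalised representations are parametrised by the model space. -/
theorem exists_toParams_eq {x' : ∀ k : D, Fin (r.rank {k}) → V k} {C' : Coef T r}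
    (hx' : ∀ k j i, g.φ k j (x' k i) = if i = j then 1 else 0) (hA : Normalized g.A C') :
    ∃ e, g.toParams e = (x', C') := by
  refine ⟨(fun k i => ⟨x' k i - x k i, (g.mem_W k _).2 fun j => ?_⟩, ⟨C' - C, fun γ hγ => ?_⟩), ?_⟩
  · rw [map_sub, hx', g.φ_x, sub_self]
  · have h1 := Matrix.sub_mul (Matrix.of (C' γ)) (Matrix.of (C γ)) (g.A γ)
    rw [g.mul_A, hA γ hγ, sub_self] at h1
    exact h1
  · simp [toParams]

/-- The corrected vectors are biorthogonal to the dual frame away from the root, hence independent.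
They lie in the minimal subspaces, so by dimension they are bases, and `exists_coef` provides the
coefficients; biorthogonality forces these to be normalised. -/
theorem exists_normalized [Nontrivial D] (w : FT V T r) (hw : N.embed w.1 ∈ g.domain) :
    ∃ e, (g.toParams e).2.FullRank ∧ treeTensor (g.toParams e).1 (g.toParams e).2 = w.1 := by
  have huniv : ∀ k, ({k} : Finset D) ≠ Finset.univ := fun k h => by
    have h1 := T.univ_mem_inner
    rw [← h] at h1
    exact T.singleton_notMem_inner k h1
  have hli : ∀ α ∈ T.vertices, LinearIndependent ℝ fun i => g.vec α i w.1 := by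
    intro α hα
    by_cases h : α = Finset.univ
    · subst h
      simp only [vec_univ]
      refine LinearIndependent.of_subsingleton r.rootIndex fun h0 => ?_
      have h1 := w.2 _ hα
      have h2 := Umin_univ_le w.1
      rw [h0, Submodule.span_zero_singleton, le_bot_iff] at h2
      rw [h0, h2, finrank_bot, r.rank_root] at h1
      exact zero_ne_one h1
    · exact linearIndependent_of_dual (g.dualFrame_vec hα h hw)
  obtain ⟨C', hC', hf⟩ := exists_coef (v := w.1)
    (fun k i => (leafEquiv V k).symm (g.vec {k} i w.1)) (fun α i => g.vec α i w.1) (by simp) hli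
    fun α hα => Submodule.eq_of_le_of_finrank_eq (Submodule.span_le.2 (by
      rintro _ ⟨i, rfl⟩
      exact g.vec_mem hα i w.1)) (by
      rw [finrank_span_eq_card (hli α hα), Fintype.card_fin, w.2 α hα])
  have hA : Normalized g.A C' := by
    refine normalized_of_dualFrame (φ := fun k j => (g.φ k j : V k →ₗ[ℝ] ℝ))
      (x := fun k i => (leafEquiv V k).symm (g.vec {k} i w.1)) fun α hα h j i => ?_
    rw [hf α hα]
    exact g.dualFrame_vec hα h hw j i
  obtain ⟨e, he⟩ := g.exists_toParams_eq (fun k j i => by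
    have h1 := g.dualFrame_vec (T.singleton_mem k) (huniv k) hw j i
    rwa [← (leafEquiv V k).apply_symm_apply (g.vec {k} i w.1), dualFrame_leaf] at h1) hA
  refine ⟨e, ?_, ?_⟩
  · rw [he]; exact hC'
  · rw [he, ← frame_univ _ _ r.rootIndex, hf _ T.root_mem]
    exact g.vec_univ _ _

theorem mem_domain_self [Nontrivial D] : N.embed (treeTensor x C) ∈ g.domain := by
  have hA : Normalized g.A C := fun γ _ => g.mul_A γ
  intro α hα
  have : g.mat α (N.embed (treeTensor x C)) = 1 := by
    by_cases h : α = Finset.univ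
    · rw [mat, if_pos h]
    · ext j i
      rw [← g.dualFrame_κ hα h, g.κ_treeTensor α hα,
        dualFrame_frame (φ := fun k j => (g.φ k j : V k →ₗ[ℝ] ℝ)) g.φ_x hA α hα h, Matrix.one_apply]
      simp only [eq_comm]
  rw [this, Matrix.det_one]
  exact one_ne_zero

theorem leafMin_eq {x' : ∀ k : D, Fin (r.rank {k}) → V k} {C' : Coef T r}
    (hx' : ∀ k, LinearIndependent ℝ (x' k)) (hC' : C'.FullRank) (k : D) :
    leafMin V k (treeTensor x' C') = Submodule.span ℝ (Set.range (x' k)) := by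
  rw [leafMin, Umin_treeTensor hx' hC' _ (T.singleton_mem k)]
  have : frame x' C' {k} = leafEquiv V k ∘ x' k := funext fun i => frame_leaf x' C' k i
  rw [this, Set.range_comp, ← LinearEquiv.coe_coe, Submodule.span_image,
    Submodule.comap_map_eq_of_injective (leafEquiv V k).injective]

/-- The normalised leaf vectors of `w` are biorthogonal to the functionals `φ k`, whose common
kernel is `W k`. -/
theorem isCompl_leafMin [Nontrivial D] (w : FT V T r) (hw : N.embed w.1 ∈ g.domain) (k : D) :
    IsCompl (leafMin V k w.1) (W k) := by
  obtain ⟨e, hC, he⟩ := g.exists_normalized w hw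
  rw [← he, leafMin_eq (g.linearIndependent (g.φ_toParams e)) hC]
  exact isCompl_span_of_dual (ψ := fun j => (g.φ k j : V k →ₗ[ℝ] ℝ)) (g.φ_toParams e k)
    (g.mem_W k)

/-- The tensors with given coefficients of full rank. -/
def _root_.TreeTensor.FT.ofFrame (x : ∀ k : D, Fin (r.rank {k}) → V k) (C : Coef T r)
    (hx : ∀ k, LinearIndependent ℝ (x k)) (hC : C.FullRank) : FT V T r :=
  ⟨treeTensor x C, finrank_Umin_treeTensor hx hC⟩

/-- Normalised representations form a local retraction onto the tensors of fixed rank. -/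
def localRetraction [Nontrivial D] (hcont : N.IsTreeContinuous) (v : FT V T r)
    (hv : treeTensor x C = v.1) : LocalRetraction (N.incl r) v (g.A.Model W) where
  s := g.retract
  f e := N.treeMap (g.toParams e)
  O := g.domain
  -- Full rank keeps the tensor in the fixed-rank set; the second condition keeps it where the
  -- retraction is analytic.
  Q := {e | (g.toParams e).2.FullRank ∧ N.treeMap (g.toParams e) ∈ g.domain}
  isOpen_O := g.isOpen_domain
  isOpen_Q := (isOpen_setOf_fullRank.preimage (continuous_snd.comp
    g.contDiff_toParams.continuous)).inter (g.isOpen_domain.preimage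
      (hcont.contDiff_treeMap.continuous.comp g.contDiff_toParams.continuous))
  mem_O := by
    rw [incl, ← hv]
    exact g.mem_domain_self
  contDiffOn_s := g.contDiffOn_retract
  contDiffOn_f := (hcont.contDiff_treeMap.comp g.contDiff_toParams).contDiffOn
  f_mem_range e he := ⟨FT.ofFrame _ _ (g.linearIndependent (g.φ_toParams e)) he.1, rfl⟩
  f_mem_O e he := he.2
  s_f e he := g.retract_treeMap e he.1 he.2
  s_mem w hw := by
    obtain ⟨e, hC, he⟩ := g.exists_normalized w hw
    have h1 : N.treeMap (g.toParams e) = N.incl r w := congrArg N.embed he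
    rw [← h1, g.retract_treeMap e hC (h1 ▸ hw)]
    exact ⟨hC, h1 ▸ hw⟩
  f_s w hw := by
    obtain ⟨e, hC, he⟩ := g.exists_normalized w hw
    have h1 : N.treeMap (g.toParams e) = N.incl r w := congrArg N.embed he
    rw [← h1, g.retract_treeMap e hC (h1 ▸ hw)]

end TreeNorms.Gauge

end TreeTensor

end

noncomputable section

namespace TreeTensor

open Module Topology

/-! ### Representations of tensors of fixed rank -/

section Algebra

variable {D : Type u₁} [Fintype D] [DecidableEq D] {V : D → Type u₂} [∀ j, AddCommGroup (V j)]
  [∀ j, Module ℝ (V j)] {T : DimPartTree D} {r : TreeRank D}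

instance finiteDimensional_leafMin (k : D) (v : TS V (Finset.univ : Finset D)) :
    FiniteDimensional ℝ (leafMin V k v) :=
  Module.Finite.equiv ((leafEquiv V k).ofSubmodule' (Umin V {k} v)).symm

theorem finrank_leafMin (v : FT V T r) (k : D) : finrank ℝ (leafMin V k v.1) = r.rank {k} :=
  ((leafEquiv V k).ofSubmodule' (Umin V {k} v.1)).finrank_eq.trans (v.2 _ (T.singleton_mem k))

theorem span_eq_leafMin (v : FT V T r) {k : D} {x : Fin (r.rank {k}) → V k}
    (hx : LinearIndependent ℝ x) (hm : ∀ i, x i ∈ leafMin V k v.1) :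
    Submodule.span ℝ (Set.range x) = leafMin V k v.1 :=
  Submodule.eq_of_le_of_finrank_eq (Submodule.span_le.2 (Set.range_subset_iff.2 hm)) (by
    rw [finrank_span_eq_card hx, Fintype.card_fin, finrank_leafMin])

theorem FT.ne_zero (v : FT V T r) : v.1 ≠ 0 := by
  intro h0
  have h1 := v.2 _ T.root_mem
  have h2 := Umin_univ_le v.1
  rw [h0, Submodule.span_zero_singleton, le_bot_iff] at h2
  rw [h0, h2, finrank_bot, r.rank_root] at h1
  exact zero_ne_one h1

/-- Bases of the minimal subspaces at the leaves can be completed to a representation. -/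
theorem exists_representation [Nontrivial D] (v : FT V T r) {x : ∀ k : D, Fin (r.rank {k}) → V k}
    (hx : ∀ k, LinearIndependent ℝ (x k)) (hm : ∀ k i, x k i ∈ leafMin V k v.1) :
    ∃ C : Coef T r, C.FullRank ∧ treeTensor x C = v.1 := by
  have huniv : ∀ k, ({k} : Finset D) ≠ Finset.univ := fun k h => by
    have h1 := T.univ_mem_inner
    rw [← h] at h1
    exact T.singleton_notMem_inner k h1
  -- One choice of bases for all vertices, prescribed to be `v` at the root and `x k` at the leaves.
  -- The prescriptions do not clash, since a leaf is never the root.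
  have h1 : ∀ α : Finset D, ∃ n : Fin (r.rank α) → TS V α,
      (α ∈ T.vertices → LinearIndependent ℝ n ∧ ∀ i, n i ∈ Umin V α v.1) ∧
      (∀ h : α = Finset.univ, n = h ▸ fun _ => v.1) ∧
      ∀ k (h : {k} = α), n = h ▸ fun i => leafEquiv V k (x k i) := by
    intro α
    by_cases h : α = Finset.univ
    · subst h
      refine ⟨fun _ => v.1, fun _ => ⟨?_, fun _ => mem_Umin_univ _⟩, fun _ => rfl,
        fun k hk => absurd hk (huniv k)⟩
      exact LinearIndependent.of_subsingleton r.rootIndex v.ne_zero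
    by_cases h' : ∃ k, {k} = α
    · obtain ⟨k, rfl⟩ := h'
      refine ⟨fun i => leafEquiv V k (x k i), fun _ => ⟨?_, fun i => hm k i⟩,
        fun hk => absurd hk h, fun k' hk => ?_⟩
      · exact (hx k).map' (leafEquiv V k).toLinearMap (LinearEquiv.ker _)
      · obtain rfl := Finset.singleton_injective hk
        rfl
    by_cases hα : α ∈ T.vertices
    · refine ⟨fun i => finBasisOfFinrankEq ℝ (Umin V α v.1) (v.2 α hα) i, fun _ => ⟨?_, fun i =>
        Subtype.prop _⟩, fun h'' => absurd h'' h, fun k hk => absurd ⟨k, hk⟩ h'⟩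
      exact (finBasisOfFinrankEq ℝ (Umin V α v.1) (v.2 α hα)).linearIndependent.map'
        (Umin V α v.1).subtype (Submodule.ker_subtype _)
    · exact ⟨0, fun h'' => absurd h'' hα, fun h'' => absurd h'' h, fun k hk => absurd ⟨k, hk⟩ h'⟩
  choose n hn hnu hnl using h1
  obtain ⟨C, hC, hf⟩ := exists_coef (v := v.1) x n (fun k i => congrFun (hnl _ k rfl) i)
    (fun α hα => (hn α hα).1) fun α hα => Submodule.eq_of_le_of_finrank_eq
      (Submodule.span_le.2 (Set.range_subset_iff.2 (hn α hα).2)) (by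
        rw [finrank_span_eq_card (hn α hα).1, Fintype.card_fin, v.2 α hα])
  refine ⟨C, hC, ?_⟩
  rw [← frame_univ _ _ r.rootIndex, hf _ T.root_mem, hnu _ rfl]

/-- Any tensor of rank `r` has a full-rank representation, which supplies the tuple needed by
`isMaxRank_iff`. -/
theorem FT.isMaxRank_iff [Nontrivial D] (v : FT V T r) (C : Coef T r) :
    C.IsMaxRank ↔ C.FullRank := by
  obtain ⟨C₀, hC₀, -⟩ := exists_representation v
    (x := fun k i => (finBasisOfFinrankEq ℝ (leafMin V k v.1) (finrank_leafMin v k) i : V k))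
    (fun k => (Basis.linearIndependent _).map' (leafMin V k v.1).subtype (Submodule.ker_subtype _))
    fun k i => Subtype.prop _
  exact hC₀.isMaxRank_iff C

end Algebra

section Norms

variable {D : Type u₁} [Fintype D] [DecidableEq D] {V : D → Type u₂}
  [∀ j, NormedAddCommGroup (V j)] [∀ j, NormedSpace ℝ (V j)] {T : DimPartTree D} {r : TreeRank D}

/-- Every choice of complements extends to a representation. -/
theorem exists_chartData [Nontrivial D] (v : FT V T r) {W : ∀ k, Submodule ℝ (V k)}
    (hW : ∀ k, IsClosed (W k : Set (V k))) (hc : ∀ k, IsCompl (leafMin V k v.1) (W k)) :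
    ∃ c : ChartData v, c.W = W := by
  obtain ⟨C, hC, h⟩ := exists_representation v
    (x := fun k i => (finBasisOfFinrankEq ℝ (leafMin V k v.1) (finrank_leafMin v k) i : V k))
    (fun k => (Basis.linearIndependent _).map' (leafMin V k v.1).subtype (Submodule.ker_subtype _))
    fun k i => Subtype.prop _
  exact ⟨⟨W, hW, hc, fun k => finBasisOfFinrankEq ℝ _ (finrank_leafMin v k), C,
    (v.isMaxRank_iff C).2 hC, h⟩, rfl⟩

theorem nonempty_chartData [Nontrivial D] (v : FT V T r) : Nonempty (ChartData v) := by
  have h1 := fun k => (Submodule.ClosedComplemented.of_finiteDimensional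
    (leafMin V k v.1)).exists_isClosed_isCompl
  choose W hW hc using h1
  exact ⟨(exists_chartData v hW hc).choose⟩

namespace ChartData

variable {v : FT V T r} (c : ChartData v) {N : TreeNorms T V}

theorem fullRank [Nontrivial D] : c.C.FullRank := (v.isMaxRank_iff _).1 c.maxRank_C

theorem linearIndependent_u (k : D) : LinearIndependent ℝ fun i => (c.u k i : V k) :=
  (c.u k).linearIndependent.map' (leafMin V k v.1).subtype (Submodule.ker_subtype _)

theorem nonempty_gauge [Nontrivial D] [∀ j, CompleteSpace (V j)] (hinj : N.DominatesInjective) :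
    Nonempty (N.Gauge c.W (fun k i => (c.u k i : V k)) c.C) := by
  refine TreeNorms.exists_gauge hinj c.isClosed_W c.linearIndependent_u (fun k => ?_) c.fullRank
  rw [span_eq_leafMin v (c.linearIndependent_u k) fun i => (c.u k i).2]
  exact c.isCompl_W k

theorem isOpen_dom [Nontrivial D] : IsOpen c.dom := by
  simp only [dom, v.isMaxRank_iff]
  exact isOpen_setOf_fullRank.preimage continuous_snd

/-- The linear part of the parametrisation. -/
def paramLin : c.Params →L[ℝ] FrameParams V T r :=
  (ContinuousLinearMap.pi fun k => ContinuousLinearMap.pi fun i =>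
    (c.W k).subtypeL.comp ((ContinuousLinearMap.apply ℝ (c.W k) (c.u k i)).comp
      ((ContinuousLinearMap.proj (R := ℝ) (φ := fun k => leafMin V k v.1 →L[ℝ] c.W k) k).comp
        (ContinuousLinearMap.fst ℝ _ (Coef T r))))).prod (ContinuousLinearMap.snd ℝ _ _)

/-- The leaf vectors and coefficients with given parameters. -/
def paramFrame (p : c.Params) : FrameParams V T r :=
  (fun k i => (c.u k i : V k), 0) + c.paramLin p

theorem embed_param (p : c.Params) : N.embed (c.param p) = N.treeMap (c.paramFrame p) := by
  exact congrArg (fun C => N.embed (treeTensor (c.paramFrame p).1 C)) (zero_add p.2).symm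

theorem hasFDerivAt_paramFrame (p : c.Params) : HasFDerivAt c.paramFrame c.paramLin p :=
  HasFDerivAt.const_add (𝕜 := ℝ) (E := c.Params) (F := FrameParams V T r)
    (fun k i => (c.u k i : V k), 0) (ContinuousLinearMap.hasFDerivAt c.paramLin)

theorem contDiff_embed_param (hcont : N.IsTreeContinuous) :
    ContDiff ℝ ω fun p => N.embed (c.param p) := by
  simp only [embed_param]
  have h : ContDiff ℝ ω c.paramLin :=
    ContinuousLinearMap.contDiff (𝕜 := ℝ) (E := c.Params) (F := FrameParams V T r) (n := ω)
      c.paramLin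
  exact hcont.contDiff_treeMap.comp (contDiff_const.add h)

theorem paramLin_surjective (d : FrameParams V T r) (hd : ∀ k i, d.1 k i ∈ c.W k) :
    ∃ p, c.paramLin p = d := by
  refine ⟨(fun k => LinearMap.toContinuousLinearMap ((c.u k).constr ℝ fun i => ⟨d.1 k i, hd k i⟩),
    d.2), Prod.ext ?_ rfl⟩
  funext k i
  change (((c.u k).constr ℝ fun i => (⟨d.1 k i, hd k i⟩ : c.W k)) (c.u k i) : V k) = _
  rw [Basis.constr_basis]

theorem hasFDerivAt_embed_param (hcont : N.IsTreeContinuous) (p : c.Params) :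
    HasFDerivAt (fun p => N.embed (c.param p))
      ((fderiv ℝ N.treeMap (c.paramFrame p)).comp c.paramLin) p := by
  simp only [embed_param]
  exact (hcont.hasFDerivAt_treeMap _).comp p (c.hasFDerivAt_paramFrame p)

/-- The linear part of the parametrisation attains exactly the directions whose leaf components lie
in `W`; these are the ones describing `tangentZ`. -/
theorem range_fderiv_embed_param (hcont : N.IsTreeContinuous) (p : c.Params) :
    (((fderiv ℝ N.treeMap (c.paramFrame p)).comp c.paramLin).range : Set N.Ambient) =
      (tangentZ (c.paramFrame p).1 (c.paramFrame p).2 c.W).map N.embed := by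
  ext z
  simp only [SetLike.mem_coe]
  rw [hcont.mem_map_tangentZ_iff]
  constructor
  · rintro ⟨q, rfl⟩
    exact ⟨c.paramLin q, fun k i => (q.1 k (c.u k i)).2, rfl⟩
  · rintro ⟨d, hd, rfl⟩
    obtain ⟨q, rfl⟩ := c.paramLin_surjective d hd
    exact ⟨q, rfl⟩

/-- The parameters of the base point. -/
def base : c.Params := (0, c.C)

theorem base_mem : c.base ∈ c.dom := c.maxRank_C

theorem paramFrame_base : c.paramFrame c.base = (fun k i => (c.u k i : V k), c.C) := by
  refine Prod.ext ?_ (zero_add _)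
  funext k i
  exact add_zero _

theorem param_base : c.param c.base = v.1 := by
  rw [← c.treeTensor_eq]
  change treeTensor (c.paramFrame c.base).1 c.C = _
  rw [paramFrame_base]

variable [∀ j, CompleteSpace (V j)]

theorem linearIndependent_param [Nontrivial D] (hinj : N.DominatesInjective) (p : c.Params) (k : D) :
    LinearIndependent ℝ ((c.paramFrame p).1 k) ∧
      IsCompl (Submodule.span ℝ (Set.range ((c.paramFrame p).1 k))) (c.W k) := by
  obtain ⟨g⟩ := c.nonempty_gauge hinj
  have h1 : ∀ j i, g.φ k j ((c.paramFrame p).1 k i) = if i = j then 1 else 0 := by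
    intro j i
    change g.φ k j ((c.u k i : V k) + (p.1 k (c.u k i) : V k)) = _
    rw [map_add, g.φ_x, (g.mem_W k _).1 (p.1 k (c.u k i)).2, add_zero]
  exact ⟨linearIndependent_of_dual (ψ := fun j => (g.φ k j : V k →ₗ[ℝ] ℝ)) h1,
    isCompl_span_of_dual (ψ := fun j => (g.φ k j : V k →ₗ[ℝ] ℝ)) h1 (g.mem_W k)⟩

theorem param_mem [Nontrivial D] (hinj : N.DominatesInjective) {p : c.Params} (hp : p ∈ c.dom) :
    ∀ α ∈ T.vertices, finrank ℝ (Umin V α (c.param p)) = r.rank α :=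
  finrank_Umin_treeTensor (fun k => (c.linearIndependent_param hinj p k).1)
    ((v.isMaxRank_iff _).1 hp)

/-- The representations with given parameters. -/
theorem exists_chartData_param [Nontrivial D] (hinj : N.DominatesInjective) {p : c.Params} (hp : p ∈ c.dom)
    {w : FT V T r} (hw : w.1 = c.param p) :
    ∃ c' : ChartData w, c'.W = c.W ∧ (fun k i => (c'.u k i : V k)) = (c.paramFrame p).1 ∧
      c'.C = p.2 := by
  have h1 := c.linearIndependent_param hinj p
  have h2 : ∀ k, leafMin V k w.1 = Submodule.span ℝ (Set.range ((c.paramFrame p).1 k)) := by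
    rw [hw]
    exact TreeNorms.Gauge.leafMin_eq (fun k => (h1 k).1) ((v.isMaxRank_iff _).1 hp)
  have h3 : ∀ k i, (((Basis.span (h1 k).1).map (LinearEquiv.ofEq _ _ (h2 k).symm) i :
      leafMin V k w.1) : V k) = (c.paramFrame p).1 k i := fun k i => by
    rw [Basis.map_apply, LinearEquiv.coe_ofEq_apply, Basis.span_apply]
  refine ⟨⟨c.W, c.isClosed_W, fun k => ?_, fun k => (Basis.span (h1 k).1).map
    (LinearEquiv.ofEq _ _ (h2 k).symm), p.2, hp, ?_⟩, rfl, ?_, rfl⟩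
  · rw [h2]
    exact (h1 k).2
  · simp only [h3]
    exact hw.symm
  · simp only [h3]

/-- Write each `u k i` as `a + b` with `a` in the minimal subspace of `w` and `b` in `W k`; setting
`L` to `-b` on this basis vector moves it to `a`. The moved vectors are independent, so they
complete to a representation of `w`. -/
theorem exists_param [Nontrivial D] (w : FT V T r) (hinj : N.DominatesInjective) (hw : w ∈ c.nhd) :
    ∃ p ∈ c.dom, c.param p = w.1 := by
  have h1 : ∀ k i, ∃ b : c.W k, (c.u k i : V k) + b ∈ leafMin V k w.1 := by
    intro k i
    have h2 : (c.u k i : V k) ∈ leafMin V k w.1 ⊔ c.W k := by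
      rw [(hw k).sup_eq_top]; trivial
    obtain ⟨a, ha, b, hb, hab⟩ := Submodule.mem_sup.1 h2
    refine ⟨-⟨b, hb⟩, ?_⟩
    rw [← hab]
    simpa using ha
  choose b hb using h1
  let L : ∀ k, leafMin V k v.1 →L[ℝ] c.W k := fun k =>
    LinearMap.toContinuousLinearMap ((c.u k).constr ℝ (b k))
  have hL : ∀ k i, L k (c.u k i) = b k i := fun k i => (c.u k).constr_basis ℝ (b k) i
  have h3 := c.linearIndependent_param hinj (L, c.C)
  have h4 : ∀ k i, (c.paramFrame (L, c.C)).1 k i = (c.u k i : V k) + b k i := fun k i =>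
    congrArg (fun z : c.W k => (c.u k i : V k) + z) (hL k i)
  obtain ⟨C, hC, hCw⟩ := exists_representation w (fun k => (h3 k).1) fun k i => by
    rw [h4]; exact hb k i
  exact ⟨(L, C), (v.isMaxRank_iff C).2 hC, hCw⟩

/-- The tangent space at `v` does not depend on the parametrisation. -/
theorem range_fderiv_eq_Z [Nontrivial D] (hcont : N.IsTreeContinuous) (hinj : N.DominatesInjective)
    (g : N.Gauge c.W (fun k i => (c.u k i : V k)) c.C) :
    (fderiv ℝ (g.localRetraction hcont v c.treeTensor_eq).f
      ((g.localRetraction hcont v c.treeTensor_eq).s (N.incl r v))).range = c.Z N := by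
  have hZ : (c.Z N : Set N.Ambient) =
      (tangentZ (c.paramFrame c.base).1 (c.paramFrame c.base).2 c.W).map N.embed := by
    rw [paramFrame_base]
    rfl
  -- The tensor `v` is represented by the base point itself, so both parametrisations are
  -- differentiated at the same frame parameters.
  have hs : g.toParams ((g.localRetraction hcont v c.treeTensor_eq).s (N.incl r v)) =
      c.paramFrame c.base := by
    rw [paramFrame_base]
    change g.toParams (g.retract (N.embed v.1)) = _
    have h1 := g.retract_treeTensor g.φ_x c.fullRank (fun γ _ => g.mul_A γ) g.mem_domain_self
    have h2 : treeTensor (fun k i => (c.u k i : V k)) c.C = v.1 := c.treeTensor_eq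
    rw [h2] at h1
    rw [h1]
    simp [TreeNorms.Gauge.toParams]
  set L := g.localRetraction hcont v c.treeTensor_eq
  apply le_antisymm
  · rintro _ ⟨e, rfl⟩
    rw [← SetLike.mem_coe, hZ, SetLike.mem_coe, hcont.mem_map_tangentZ_iff, ← hs]
    have h1 : HasFDerivAt g.toParams (fderiv ℝ g.toParams (L.s (N.incl r v))) (L.s (N.incl r v)) :=
      (g.contDiff_toParams.differentiable (by simp) _).hasFDerivAt
    have h2 := (hcont.hasFDerivAt_treeMap (g.toParams (L.s (N.incl r v)))).comp _ h1
    refine ⟨fderiv ℝ g.toParams (L.s (N.incl r v)) e, fun k i => ?_, ?_⟩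
    -- A leaf vector of `toParams` is a constant plus a linear map into `W`, so its derivative takes
    -- values in `W`.
    · have h3 : HasFDerivAt (fun e : g.A.Model c.W => (g.toParams e).1 k i)
          ((leafProj k i).comp (fderiv ℝ g.toParams (L.s (N.incl r v)))) (L.s (N.incl r v)) :=
        (leafProj k i : FrameParams V T r →L[ℝ] V k).hasFDerivAt.comp _ h1
      let l : g.A.Model c.W →L[ℝ] V k := (c.W k).subtypeL.comp ((ContinuousLinearMap.proj i).comp
        ((ContinuousLinearMap.proj (R := ℝ) (φ := fun k => Fin (r.rank {k}) → c.W k) k).comp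
          (ContinuousLinearMap.fst ℝ _ g.A.annihilator)))
      have h4 : HasFDerivAt l l (L.s (N.incl r v)) := l.hasFDerivAt
      have h5 := congrArg (fun f => f e) (h3.unique (h4.const_add (c.u k i : V k)))
      change leafProj k i (fderiv ℝ g.toParams (L.s (N.incl r v)) e) ∈ c.W k
      change leafProj k i (fderiv ℝ g.toParams (L.s (N.incl r v)) e) = _ at h5
      rw [h5]
      exact (e.1 k i).2
    · exact congrArg (fun f => f e) h2.fderiv.symm
  -- Conversely, `Z` is the range of the derivative of `param`, a differentiable map into the
  -- tensors of fixed rank near the base point.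
  · rw [← SetLike.coe_subset_coe, hZ, ← c.range_fderiv_embed_param hcont]
    have h1 : N.embed (c.param c.base) = N.incl r v := congrArg N.embed c.param_base
    have h2 : ∀ᶠ p in 𝓝 c.base, N.embed (c.param p) ∈ Set.range (N.incl r) := by
      filter_upwards [c.isOpen_dom.mem_nhds c.base_mem] with p hp
      exact ⟨⟨c.param p, c.param_mem hinj hp⟩, rfl⟩
    have h3 := c.hasFDerivAt_embed_param hcont c.base
    exact L.range_le_of_mapsTo (Y := c.Params) L.mem_O h3 h1 h2

end ChartData

end Norms

end TreeTensor

end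

noncomputable section

namespace TreeTensor

open Module Topology

/-! ### The model spaces are isomorphic -/

/-- The first determinant is nonzero on a neighbourhood of `t = 0`, an infinite set; the second
excludes only the finitely many roots of a characteristic polynomial. -/
theorem exists_det_ne_zero {n : Type*} [Fintype n] [DecidableEq n] (M M' : Matrix n n ℝ) :
    ∃ t : ℝ, (1 + t • M).det ≠ 0 ∧ (M' + t • 1).det ≠ 0 := by
  have h1 : {t : ℝ | (1 + t • M).det ≠ 0} ∈ 𝓝 (0 : ℝ) := by
    refine ContinuousAt.preimage_mem_nhds (f := fun t : ℝ => (1 + t • M).det) ?_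
      (isOpen_ne.mem_nhds (by simp))
    exact (Continuous.matrix_det (by fun_prop)).continuousAt
  obtain ⟨t, ht, ht'⟩ := (infinite_of_mem_nhds _ h1).exists_notMem_finset (-M').charpoly.roots.toFinset
  refine ⟨t, ht, fun h => ht' ?_⟩
  rw [Multiset.mem_toFinset, Polynomial.mem_roots (Matrix.charpoly_monic _).ne_zero,
    Polynomial.IsRoot, Matrix.eval_charpoly, ← h, sub_neg_eq_add, add_comm,
    Matrix.scalar_apply, Matrix.smul_one_eq_diagonal]

theorem isCompl_span_of_det_ne_zero {ι M : Type*} [Fintype ι] [DecidableEq ι] [AddCommGroup M]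
    [Module ℝ M] {n : ι → M} {φ : ι → Dual ℝ M} {W : Submodule ℝ M}
    (h : (Matrix.of fun j i => φ j (n i)).det ≠ 0) (hW : ∀ y, y ∈ W ↔ ∀ j, φ j y = 0) :
    IsCompl (Submodule.span ℝ (Set.range n)) W := by
  set G : Matrix ι ι ℝ := Matrix.of fun j i => φ j (n i)
  have hG : IsUnit G.det := isUnit_iff_ne_zero.2 h
  -- Multiplying the functionals by `G⁻¹` makes them biorthogonal to `n` without changing their
  -- common kernel.
  refine isCompl_span_of_dual (ψ := fun j => ∑ l, G⁻¹ j l • φ l) (fun j i => ?_) fun y => ?_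
  · have h1 : (G⁻¹ * G) j i = if i = j then 1 else 0 := by
      rw [Matrix.nonsing_inv_mul _ hG, Matrix.one_apply]
      simp only [eq_comm]
    rw [← h1, Matrix.mul_apply, LinearMap.sum_apply]
    rfl
  · rw [hW]
    have h2 : ∀ j, (∑ l, G⁻¹ j l • φ l) y = (G⁻¹.mulVec fun l => φ l y) j := fun j => by
      simp [Matrix.mulVec, dotProduct, LinearMap.sum_apply]
    simp only [h2]
    constructor
    · intro h3 j
      rw [show (fun l => φ l y) = 0 from funext h3, Matrix.mulVec_zero]
      rfl
    · intro h3 j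
      have h4 : G.mulVec (G⁻¹.mulVec fun l => φ l y) = fun l => φ l y := by
        rw [Matrix.mulVec_mulVec, Matrix.mul_nonsing_inv _ hG, Matrix.one_mulVec]
      rw [show (G⁻¹.mulVec fun l => φ l y) = 0 from funext h3, Matrix.mulVec_zero] at h4
      exact (congrFun h4 j).symm

/-- Closed subspaces with a common closed complement are isomorphic. -/
theorem nonempty_equiv_of_isTopCompl {M : Type*} [NormedAddCommGroup M] [NormedSpace ℝ M]
    {U W W' : Submodule ℝ M} (h : Submodule.IsTopCompl W U) (h' : Submodule.IsTopCompl W' U) :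
    Nonempty (W ≃L[ℝ] W') := by
  have key : ∀ {W W' : Submodule ℝ M} (h : Submodule.IsTopCompl W U)
      (h' : Submodule.IsTopCompl W' U) (w : W),
      W.projectionOntoL U h (W'.projectionOntoL U h' w : M) = w := by
    intro W W' h h' w
    have h1 : W'.projectionL U h' w + U.projectionL W' h'.symm w = w :=
      Submodule.projectionL_add_projectionL_eq_self h' _
    have h2 : (W'.projectionOntoL U h' (w : M) : M) = (w : M) - U.projectionL W' h'.symm w := by
      rw [Submodule.coe_projectionOntoL_apply]
      exact eq_sub_of_add_eq h1
    rw [h2, map_sub, Submodule.projectionOntoL_apply_left,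
      (Submodule.projectionOntoL_apply_eq_zero_iff h).2 (Submodule.projectionL_apply_mem _ _),
      sub_zero]
  exact ⟨ContinuousLinearEquiv.equivOfInverse
    ((W'.projectionOntoL U h').comp W.subtypeL) ((W.projectionOntoL U h).comp W'.subtypeL)
    (key h h') (key h' h)⟩

/-- The span of the `n i + t • n' i` is a common complement of `W` and `W'` for suitable `t`: the
pairing matrices are `1 + t • M` with `φ` and `M' + t • 1` with `φ'`. -/
theorem nonempty_equiv_of_dual {ι M : Type*} [Fintype ι] [DecidableEq ι] [NormedAddCommGroup M]
    [NormedSpace ℝ M] [CompleteSpace M] {n n' : ι → M} {φ φ' : ι → M →L[ℝ] ℝ}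
    {W W' : Submodule ℝ M} (h : ∀ j i, φ j (n i) = if i = j then 1 else 0)
    (h' : ∀ j i, φ' j (n' i) = if i = j then 1 else 0) (hW : ∀ y, y ∈ W ↔ ∀ j, φ j y = 0)
    (hW' : ∀ y, y ∈ W' ↔ ∀ j, φ' j y = 0) : Nonempty (W ≃L[ℝ] W') := by
  obtain ⟨t, ht, ht'⟩ := exists_det_ne_zero (Matrix.of fun j i => φ j (n' i))
    (Matrix.of fun j i => φ' j (n i))
  have hcl : ∀ {φ : ι → M →L[ℝ] ℝ} {W : Submodule ℝ M} (_ : ∀ y, y ∈ W ↔ ∀ j, φ j y = 0),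
      IsClosed (W : Set M) := by
    intro φ W hW
    have : (W : Set M) = ⋂ j, {y | φ j y = 0} := by
      ext y; simp [hW]
    rw [this]
    exact isClosed_iInter fun j => isClosed_eq (φ j).continuous continuous_const
  have h1 := isCompl_span_of_det_ne_zero (n := fun i => n i + t • n' i)
    (φ := fun j => (φ j : M →ₗ[ℝ] ℝ)) (W := W) (by
      convert ht using 2
      ext j i
      simp [h, Matrix.one_apply, eq_comm]) hW
  have h2 := isCompl_span_of_det_ne_zero (n := fun i => n i + t • n' i)
    (φ := fun j => (φ' j : M →ₗ[ℝ] ℝ)) (W := W') (by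
      convert ht' using 2
      ext j i
      simp [h', Matrix.one_apply, eq_comm]) hW'
  have := FiniteDimensional.span_of_finite ℝ (Set.finite_range fun i => n i + t • n' i)
  have hU : IsClosed (Submodule.span ℝ (Set.range fun i => n i + t • n' i) : Set M) :=
    Submodule.closed_of_finiteDimensional _
  exact nonempty_equiv_of_isTopCompl
    (Submodule.IsCompl.isTopCompl_of_isClosed h1.symm (hcl hW) hU)
    (Submodule.IsCompl.isTopCompl_of_isClosed h2.symm (hcl hW') hU)

section Coef

variable {D : Type u₁} [Fintype D] [DecidableEq D] {T : DimPartTree D} {r : TreeRank D}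

/-- Multiplication of the coefficients by `A`, away from the root. -/
def DualCoef.mulMap (A : DualCoef T r) : Coef T r →ₗ[ℝ]
    ∀ γ : {γ : T.inner // γ.1 ≠ Finset.univ}, Matrix (Fin (r.rank γ.1)) (Fin (r.rank γ.1)) ℝ where
  toFun C' γ := Matrix.of (C' γ.1) * A γ.1
  map_add' a b := funext fun γ => Matrix.add_mul (Matrix.of (a γ.1)) (Matrix.of (b γ.1)) (A γ.1)
  map_smul' c a := funext fun γ => Matrix.smul_mul c (Matrix.of (a γ.1)) (A γ.1)

theorem DualCoef.ker_mulMap (A : DualCoef T r) : LinearMap.ker A.mulMap = A.annihilator := by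
  ext C'
  exact ⟨fun h γ hγ => congrFun h ⟨γ, hγ⟩, fun h => funext fun γ => h γ.1 γ.2⟩

/-- At each vertex `B * C` is a preimage of `B`, as `C * A = 1`. Hence the dimension of the
annihilator depends only on the ranks. -/
theorem DualCoef.mulMap_surjective {A : DualCoef T r} {C : Coef T r} (hA : Normalized A C) :
    Function.Surjective A.mulMap := by
  intro B
  let C' : Coef T r := fun γ => if h : γ.1 ≠ Finset.univ then
    Matrix.of.symm (B ⟨γ, h⟩ * Matrix.of (C γ)) else 0
  refine ⟨C', funext fun γ => ?_⟩
  have h1 : C' γ.1 = Matrix.of.symm (B γ * Matrix.of (C γ.1)) := dif_pos γ.2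
  have h2 : A.mulMap C' γ = Matrix.of (C' γ.1) * A γ.1 := rfl
  rw [h2, h1, Equiv.apply_symm_apply, Matrix.mul_assoc, hA γ.1 γ.2, Matrix.mul_one]

theorem DualCoef.finrank_annihilator {A : DualCoef T r} {C : Coef T r} (hA : Normalized A C) :
    finrank ℝ A.annihilator + finrank ℝ (∀ γ : {γ : T.inner // γ.1 ≠ Finset.univ},
      Matrix (Fin (r.rank γ.1)) (Fin (r.rank γ.1)) ℝ) = finrank ℝ (Coef T r) := by
  rw [← A.mulMap.finrank_range_add_finrank_ker, DualCoef.ker_mulMap,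
    LinearMap.range_eq_top.2 (DualCoef.mulMap_surjective hA), finrank_top, add_comm]

end Coef

theorem TreeNorms.Gauge.nonempty_model_equiv {D : Type u₁} [Fintype D] [DecidableEq D]
    {V : D → Type u₂} [∀ j, NormedAddCommGroup (V j)] [∀ j, NormedSpace ℝ (V j)]
    [∀ j, CompleteSpace (V j)] {T : DimPartTree D} {r : TreeRank D} {N : TreeNorms T V}
    {W W' : ∀ k, Submodule ℝ (V k)} {x x' : ∀ k : D, Fin (r.rank {k}) → V k} {C C' : Coef T r}
    (g : N.Gauge W x C) (g' : N.Gauge W' x' C') :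
    Nonempty (g.A.Model W ≃L[ℝ] g'.A.Model W') := by
  have e := fun k =>
    (nonempty_equiv_of_dual (g.φ_x k) (g'.φ_x k) (g.mem_W k) (g'.mem_W k)).some
  have h1 := DualCoef.finrank_annihilator (A := g.A) (C := C) fun γ _ => g.mul_A γ
  rw [← DualCoef.finrank_annihilator (A := g'.A) (C := C') fun γ _ => g'.mul_A γ] at h1
  exact ⟨(ContinuousLinearEquiv.piCongrRight fun k =>
    ContinuousLinearEquiv.piCongrRight fun _ => (e k)).prodCongr
      (ContinuousLinearEquiv.ofFinrankEq (add_right_cancel h1))⟩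

end TreeTensor

end

/-! ### Submersivity, openness and assembly of the theorem -/

noncomputable section

open Topology in
/-- Smoothness and submersivity of a map into a submanifold with prescribed tangent spaces. -/
theorem contMDiffAt_and_surjective_of_isImmersionAt {X E Y M : Type*} [NormedAddCommGroup X]
    [NormedSpace ℝ X] [NormedAddCommGroup E] [NormedSpace ℝ E] [NormedAddCommGroup Y]
    [NormedSpace ℝ Y] [TopologicalSpace M] [ChartedSpace E M] [IsManifold 𝓘(ℝ, E) ω M] {i : M → X}
    (hi : IsInducing i) {Φ : Y → M} {y : Y}
    (himm : Manifold.IsImmersionAt 𝓘(ℝ, E) 𝓘(ℝ, X) ω i (Φ y))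
    (hinj : Function.Injective (mfderiv 𝓘(ℝ, E) 𝓘(ℝ, X) i (Φ y))) {P : Y → X} {P' : Y →L[ℝ] X}
    (hP : ContDiffAt ℝ ω P y) (hP' : HasFDerivAt P P' y) (hev : i ∘ Φ =ᶠ[𝓝 y] P)
    (hr : Set.range (mfderiv 𝓘(ℝ, E) 𝓘(ℝ, X) i (Φ y)) ⊆ Set.range P') :
    ContMDiffAt 𝓘(ℝ, Y) 𝓘(ℝ, E) ω Φ y ∧
      Function.Surjective (mfderiv 𝓘(ℝ, Y) 𝓘(ℝ, E) Φ y) := by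
  have h1 : ContDiffAt ℝ ω (i ∘ Φ) y := hP.congr_of_eventuallyEq hev
  have h2 : ContMDiffAt 𝓘(ℝ, Y) 𝓘(ℝ, E) ω Φ y :=
    (ContMDiffAt.iff_comp_isImmersionAt himm).2
      ⟨hi.continuousAt_iff.2 h1.continuousAt, h1.contMDiffAt⟩
  refine ⟨h2, fun e => ?_⟩
  -- The derivative of `i` composed with that of `Φ` is `P'`, so `q` with `P' q` equal to the image
  -- of `e` works after cancelling the injective derivative of `i`.
  obtain ⟨q, hq⟩ := hr ⟨e, rfl⟩
  refine ⟨q, hinj ?_⟩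
  rw [← hq]
  have h3 := mfderiv_comp y (himm.contMDiffAt.mdifferentiableAt (by simp))
    (h2.mdifferentiableAt (by simp))
  rw [mfderiv_eq_fderiv, (hP'.congr_of_eventuallyEq hev).fderiv] at h3
  exact (congrArg (fun f => f q) h3).symm

namespace TreeTensor

variable {D : Type u₁} [Fintype D] [DecidableEq D] [Nontrivial D] {V : D → Type u₂}
  [∀ j, NormedAddCommGroup (V j)] [∀ j, NormedSpace ℝ (V j)] [∀ j, CompleteSpace (V j)]
  {T : DimPartTree D} {r : TreeRank D} {N : TreeNorms T V}

/-- A common model space for all tensors of fixed rank. -/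
theorem exists_modelSpace (r : TreeRank D) (hinj : N.DominatesInjective) :
    ∃ (E : Type (max u₁ u₂)) (_ : NormedAddCommGroup E) (_ : NormedSpace ℝ E)
      (_ : CompleteSpace E), ∀ (v : FT V T r) (c : ChartData v)
        (g : N.Gauge c.W (fun k i => (c.u k i : V k)) c.C),
          Nonempty (g.A.Model c.W ≃L[ℝ] E) := by
  by_cases hne : Nonempty (FT V T r)
  · obtain ⟨v₀⟩ := hne
    obtain ⟨c₀⟩ := nonempty_chartData v₀
    obtain ⟨g₀⟩ := c₀.nonempty_gauge hinj
    have := fun k => (c₀.isClosed_W k).completeSpace_coe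
    have := FiniteDimensional.complete ℝ g₀.A.annihilator
    exact ⟨g₀.A.Model c₀.W, inferInstance, inferInstance, inferInstance,
      fun v c g => g.nonempty_model_equiv g₀⟩
  -- With no tensor of rank `r` any Banach space will do.
  · exact ⟨PUnit, inferInstance, inferInstance, inferInstance, fun v => absurd ⟨v⟩ hne⟩

/-- Near `v`, all tensors of fixed rank have minimal subspaces complementary to the `W_k`. -/
theorem ChartData.isOpen_nhd [TopologicalSpace (FT V T r)] (hi : Topology.IsInducing (N.incl r))
    (hinj : N.DominatesInjective) {v : FT V T r} (c : ChartData v) : IsOpen c.nhd := by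
  rw [isOpen_iff_mem_nhds]
  intro w hw
  -- The same complements serve at `w`; a gauge built there keeps them complementary on a whole
  -- neighbourhood of `w`.
  obtain ⟨c', hc'⟩ := exists_chartData w c.isClosed_W hw
  obtain ⟨g⟩ := c'.nonempty_gauge hinj
  have h1 : N.incl r ⁻¹' g.domain ∈ nhds w := by
    have h2 := g.mem_domain_self
    have h3 : TreeTensor.treeTensor (fun k i => (c'.u k i : V k)) c'.C = w.1 := c'.treeTensor_eq
    rw [h3] at h2
    exact (g.isOpen_domain.preimage hi.continuous).mem_nhds h2
  filter_upwards [h1] with w' hw' k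
  rw [← hc']
  exact g.isCompl_leafMin w' hw' k

theorem ChartData.closedComplemented_Z (hcont : N.IsTreeContinuous) (hinj : N.DominatesInjective)
    {v : FT V T r} (c : ChartData v) : (c.Z N).ClosedComplemented := by
  obtain ⟨g⟩ := c.nonempty_gauge hinj
  rw [← c.range_fderiv_eq_Z hcont hinj g]
  exact LocalRetraction.closedComplemented_range _

end TreeTensor

end

theorem mainTheorem6 {D : Type u₁} [Fintype D] [DecidableEq D] [Nontrivial D]
    {V : D → Type u₂} [∀ j, NormedAddCommGroup (V j)] [∀ j, NormedSpace ℝ (V j)]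
    [∀ j, CompleteSpace (V j)]
    (T : TreeTensor.DimPartTree D) (r : TreeTensor.TreeRank D) (N : TreeTensor.TreeNorms T V)
    (hcont : N.IsTreeContinuous) (hinj : N.DominatesInjective) :
    (∀ v : TreeTensor.FT V T r, Nonempty (TreeTensor.ChartData v) ∧
      ∀ c : TreeTensor.ChartData v, (c.Z N).ClosedComplemented) ∧
    ∃ (E : Type (max u₁ u₂)) (_ : NormedAddCommGroup E) (_ : NormedSpace ℝ E)
      (_ : CompleteSpace E) (_ : TopologicalSpace (TreeTensor.FT V T r))
      (_ : ChartedSpace E (TreeTensor.FT V T r)),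
      IsManifold 𝓘(ℝ, E) ω (TreeTensor.FT V T r) ∧
      Function.Injective (N.incl r) ∧
      ∀ v : TreeTensor.FT V T r,
        Manifold.IsImmersionAt 𝓘(ℝ, E) 𝓘(ℝ, N.Ambient) ω (N.incl r) v ∧
        ∀ c : TreeTensor.ChartData v,
          (mfderiv 𝓘(ℝ, E) 𝓘(ℝ, N.Ambient) (N.incl r) v).range = c.Z N ∧
          IsOpen c.nhd ∧
          ∃ Φ : c.Params → TreeTensor.FT V T r,
            (∀ p ∈ c.dom, (Φ p).1 = c.param p) ∧ Φ '' c.dom = c.nhd ∧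
            ContMDiffOn 𝓘(ℝ, c.Params) 𝓘(ℝ, E) ω Φ c.dom ∧
            ∀ p ∈ c.dom,
              Function.Surjective (mfderiv 𝓘(ℝ, c.Params) 𝓘(ℝ, E) Φ p) := by
  refine ⟨fun v => ⟨TreeTensor.nonempty_chartData v, fun c => c.closedComplemented_Z hcont hinj⟩, ?_⟩
  obtain ⟨E, _, _, _, hE⟩ := TreeTensor.exists_modelSpace r hinj
  have hL : ∀ v : TreeTensor.FT V T r, Nonempty (LocalRetraction (N.incl r) v E) := by
    intro v
    obtain ⟨c⟩ := TreeTensor.nonempty_chartData v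
    obtain ⟨g⟩ := c.nonempty_gauge hinj
    obtain ⟨e⟩ := hE v c g
    exact ⟨(g.localRetraction hcont v c.treeTensor_eq).congr e⟩
  obtain ⟨_, _, hman, hi, him⟩ :=
    exists_submanifold_structure (N.incl r) (N.incl_injective r) hL
  have hrange : ∀ (v : TreeTensor.FT V T r) (c : TreeTensor.ChartData v),
      (mfderiv 𝓘(ℝ, E) 𝓘(ℝ, N.Ambient) (N.incl r) v).range = c.Z N := by
    intro v c
    obtain ⟨g⟩ := c.nonempty_gauge hinj
    obtain ⟨e⟩ := hE v c g
    rw [(him v).2.2 ((g.localRetraction hcont v c.treeTensor_eq).congr e),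
      ← LocalRetraction.range_fderiv_eq (g.localRetraction hcont v c.treeTensor_eq),
      c.range_fderiv_eq_Z hcont hinj g]
  refine ⟨E, inferInstance, inferInstance, inferInstance, inferInstance, inferInstance, hman,
    N.incl_injective r, fun v => ⟨(him v).1, fun c => ⟨hrange v c, c.isOpen_nhd hi hinj, ?_⟩⟩⟩
  classical
  let Φ : c.Params → TreeTensor.FT V T r := fun p =>
    -- The value `v` off the domain is arbitrary: the domain is open, so derivatives at its points
    -- do not see it.
    if h : p ∈ c.dom then ⟨c.param p, c.param_mem hinj h⟩ else v
  have hΦ : ∀ p ∈ c.dom, (Φ p).1 = c.param p := fun p hp =>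
    congrArg Subtype.val (dif_pos hp)
  have key : ∀ p ∈ c.dom, ContMDiffAt 𝓘(ℝ, c.Params) 𝓘(ℝ, E) ω Φ p ∧
      Function.Surjective (mfderiv 𝓘(ℝ, c.Params) 𝓘(ℝ, E) Φ p) := by
    intro p hp
    refine contMDiffAt_and_surjective_of_isImmersionAt hi (him (Φ p)).1 (him (Φ p)).2.1
      (c.contDiff_embed_param hcont).contDiffAt (c.hasFDerivAt_embed_param hcont p) ?_ ?_
    · filter_upwards [c.isOpen_dom.mem_nhds hp] with q hq
      exact congrArg N.embed (hΦ q hq)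
    -- The parameters `p` form a representation of `Φ p` with the same `W`, so the tangent space
    -- there, being independent of the representation, equals the range of the derivative of the
    -- parametrisation.
    · obtain ⟨c', hW, hu, hC⟩ := c.exists_chartData_param hinj hp (hΦ p hp)
      have h1 := c.range_fderiv_embed_param hcont p
      have h2 : c'.Z N = (TreeTensor.tangentZ (c.paramFrame p).1 (c.paramFrame p).2 c.W).map
          N.embed := by
        rw [TreeTensor.ChartData.Z, hu, hC, hW]
        congr 2
        exact (zero_add p.2).symm
      rw [← h2, ← hrange] at h1
      exact h1.ge
  refine ⟨Φ, hΦ, ?_, fun p hp => (key p hp).1.contMDiffWithinAt, fun p hp => (key p hp).2⟩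
  ext w
  constructor
  · rintro ⟨p, hp, rfl⟩
    obtain ⟨c', hW, -⟩ := c.exists_chartData_param hinj hp (hΦ p hp)
    intro k
    rw [← hW]
    exact c'.isCompl_W k
  · intro hw
    obtain ⟨p, hp, h⟩ := c.exists_param w hinj hw
    exact ⟨p, hp, Subtype.ext ((hΦ p hp).trans h)⟩
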